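/- All vector spaces are over $\mathbb Q$; graded objects are families of vector spaces, $(W^\vee)_n=\mathrm{Hom}(W^n,\mathbb Q)$, and $(sL)_n=L_{n-1}$. An \emph{enriched vector space} is a graded vector space $T=T_{\ge 0}$ with a family of degree $0$ surjections $\rho_\alpha:T\to T_\alpha$ onto (totally) finite dimensional graded spaces such that the index set is (non-empty and) directed for $\alpha\ge\beta\Leftrightarrow\ker\rho_\alpha\subset\ker\rho_\beta$ and $\bigcap_\alpha\ker\rho_\alpha=0$; an \emph{enriched Lie algebra} is a graded Lie algebra $L=L_{\geq 0}$ with such a family of surjective morphisms $\rho_\alpha:L\to L_\alpha$ onto finite dimensional nilpotent graded Lie algebras. Either one is \emph{complete} if it equals its completion, $\varprojlim_\alpha T_\alpha$ resp. $\varprojlim_\alpha L_\alpha$ (taken degreewise). A degree $0$ linear map is \emph{coherent} if the preimage of each kernel of the target family contains a kernel of the source family; isomorphisms of enriched objects are isomorphisms that are coherent in both directions. For a complete enriched vector space $T$, the free graded Lie algebra $\mathbb L_T$ has the enriched structure given by $\mathbb L_T\to\mathbb L_{T_\alpha}\to\mathbb L_{T_\alpha}/\mathbb L_{T_\alpha}^{n}$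 ($n\ge 1$), where $E^1=E$, $E^{n+1}=[E,E^n]$; $\overline{\mathbb L}_T$ denotes its completion, and an enriched Lie algebra is \emph{profree} if it is isomorphic to some $\overline{\mathbb L}_T$. The \emph{quadratic model} of a complete enriched Lie algebra $L$ is the free graded commutative algebra $\Lambda V$ on $V=\varinjlim_\alpha (sL_\alpha)^\vee$ with the derivation $d:V\to\Lambda^2V$ given by $\langle dv,sx,sy\rangle=(-1)^{1+\deg y}\langle v,s[x,y]\rangle$. Finally $L^{(2)}=\{x\in L:\rho_\alpha x\in[L_\alpha,L_\alpha]\text{ for all }\alpha\}$ is the closure of $[L,L]$. \textbf{Theorem.} Let $L$ be a complete enriched Lie algebra with quadratic model $(\Lambda V,d)$. The following are equivalent: (i) $L\cong\overline{\mathbb L}_T$ is profree; (ii) $H(\Lambda V)=\mathbb Q\oplus(V\cap\ker d)$, i.e. the canonical map $\mathbb Q\oplus(V\cap\ker d)\to H(\Lambda V)$ is an isomorphism. Moreover the duality $sL\to V^\vee$, $sx\mapsto\langle\,\cdot\,,sx\rangle$, is an isomorphism; and for every complete enriched vector space $T$ and every isomorphism $\overline{\mathbb L}_T\cong L$ of enriched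 Lie algebras, it induces, on division by $L^{(2)}$, an isomorphism $s(L/L^{(2)})\cong(V\cap\ker d)^\vee$, whose composite with $T\to\overline{\mathbb L}_T\cong L\to L/L^{(2)}$ is an isomorphism of enriched vector spaces $sT\cong(V\cap\ker d)^\vee$ (the dual being enriched by the annihilators of the finite dimensional subspaces of $V\cap\ker d$). -/

import Mathlib

open scoped DirectSum TensorProduct

universe u v w z

noncomputable section

namespace EnrichedLie

/-! ## Graded vector spaces

A graded rational vector space concentrated in degrees `≥ 0` is a family `T : ℕ → Type u` of
`ℚ`-vector spaces; `T n` is the component of degree `n`. -/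

section Spaces

variable {T : ℕ → Type u} [∀ n, AddCommGroup (T n)] [∀ n, Module ℚ (T n)]
variable {S : ℕ → Type w} [∀ n, AddCommGroup (S n)] [∀ n, Module ℚ (S n)]
variable {ι : Type v} {κ : Type z}

/-- Graded subspaces, ordered by inclusion in every degree. -/
abbrev GSub (T : ℕ → Type u) [∀ n, AddCommGroup (T n)] [∀ n, Module ℚ (T n)] : Type u :=
  ∀ n, Submodule ℚ (T n)

/-- The quotient graded vector space `T / K`. -/
abbrev GQuot (K : GSub T) : ℕ → Type u := fun n => T n ⧸ K n

/-- `⨁ n, T n / K n` is finite dimensional: every component is finite dimensional and almost all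
components vanish. -/
def FiniteCodim (K : GSub T) : Prop :=
  (∀ n, FiniteDimensional ℚ (T n ⧸ K n)) ∧ ∃ N, ∀ n, N ≤ n → K n = ⊤

/-- The family `K` is directed for `α ≥ β ↔ K α ≤ K β`. -/
def IsDirectedFamily (K : ι → GSub T) : Prop :=
  Nonempty ι ∧ ∀ α β, ∃ γ, K γ ≤ K α ∧ K γ ≤ K β

/-- The family of quotient maps `T → T / K α` is an enriched structure on the graded vector
space `T`. (A surjection `ρ_α` is given by its kernel `K α`.) -/
structure IsEnrichedSpace (K : ι → GSub T) : Prop where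
  finiteCodim : ∀ α, FiniteCodim (K α)
  directed : IsDirectedFamily K
  separated : ∀ n (x : T n), (∀ α, x ∈ K α n) → x = 0

/-- The inverse limit `lim_α T / K α`, in each degree: compatible families. -/
def invLim (K : ι → GSub T) (n : ℕ) : Submodule ℚ (∀ α, T n ⧸ K α n) where
  carrier := {x | ∀ α β (h : K α ≤ K β), Submodule.factor (h n) (x α) = x β}
  add_mem' := fun {x y} hx hy α β h => by
    rw [Pi.add_apply, Pi.add_apply, map_add, hx α β h, hy α β h]
  zero_mem' := fun α β h => by rw [Pi.zero_apply, Pi.zero_apply, map_zero]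
  smul_mem' := fun c x hx α β h => by
    rw [Pi.smul_apply, Pi.smul_apply, map_smul, hx α β h]

/-- The canonical map `T → lim_α T / K α`. -/
def toLim (K : ι → GSub T) (n : ℕ) : T n →ₗ[ℚ] invLim K n :=
  LinearMap.codRestrict (invLim K n) (LinearMap.pi fun α => (K α n).mkQ) fun x α β h => by
    simp [LinearMap.pi_apply]

/-- `T` is complete: `T = lim_α T / K α`. -/
def IsLimComplete (K : ι → GSub T) : Prop := ∀ n, Function.Bijective (toLim K n)

/-- The kernels of the projections `lim_α T / K α → T / K α`. -/
def limKer (K : ι → GSub T) (α : ι) : GSub (fun n => invLim K n) :=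
  fun n => LinearMap.ker (LinearMap.proj α ∘ₗ (invLim K n).subtype)

/-- Coherent maps (of degree `0`). -/
def Coherent (K : ι → GSub T) (J : κ → GSub S) (f : ∀ n, T n →ₗ[ℚ] S n) : Prop :=
  ∀ β, ∃ α, ∀ n, ∀ x ∈ K α n, f n x ∈ J β n

/-- The closure of a graded subspace `S`: the elements whose image in every `T / K α`
lies in the image of `S`. -/
def limClosure (K : ι → GSub T) (S : GSub T) : GSub T :=
  fun n => ⨅ α, ((S n).map (K α n).mkQ).comap (K α n).mkQ

/-- The enriched structure of the dual `W^∨` of a graded vector space: the annihilators of the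
finite dimensional subspaces of `W`, each given by a finite set of homogeneous elements
spanning it. -/
def dualFamily (W : ℕ → Type w) [∀ n, AddCommGroup (W n)] [∀ n, Module ℚ (W n)]
    (F : Finset (Σ n, W n)) : GSub (fun n => Module.Dual ℚ (W n)) :=
  fun n => (Submodule.span ℚ {a : W n | (⟨n, a⟩ : Σ n, W n) ∈ F}).dualAnnihilator

end Spaces

/-! ## Graded Lie algebras -/

/-- A graded Lie algebra over `ℚ`, concentrated in degrees `≥ 0`. -/
class GradedLie (L : ℕ → Type u) [∀ n, AddCommGroup (L n)] [∀ n, Module ℚ (L n)] where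
  br : ∀ {i j k : ℕ}, i + j = k → (L i →ₗ[ℚ] L j →ₗ[ℚ] L k)
  skew : ∀ {i j k : ℕ} (h : i + j = k) (h' : j + i = k) (x : L i) (y : L j),
    br h x y + (-1 : ℚ) ^ (i * j) • br h' y x = 0
  jacobi : ∀ {i j k ij jk ik m : ℕ} (hij : i + j = ij) (hjk : j + k = jk) (hik : i + k = ik)
    (h₁ : i + jk = m) (h₂ : ij + k = m) (h₃ : j + ik = m) (x : L i) (y : L j) (z : L k),
    br h₁ x (br hjk y z) = br h₂ (br hij x y) z + (-1 : ℚ) ^ (i * j) • br h₃ y (br hik x z)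

section Lie

variable {L : ℕ → Type u} [∀ n, AddCommGroup (L n)] [∀ n, Module ℚ (L n)] [GradedLie L]
variable {M : ℕ → Type w} [∀ n, AddCommGroup (M n)] [∀ n, Module ℚ (M n)] [GradedLie M]
variable {ι : Type v} {κ : Type z}

open GradedLie

/-- The lower central series, with `lcs L k = L^{k+1}`: `L^1 = L`, `L^{k+1} = [L, L^k]`. -/
def lcs (L : ℕ → Type u) [∀ n, AddCommGroup (L n)] [∀ n, Module ℚ (L n)] [GradedLie L] :
    ℕ → GSub L
  | 0 => ⊤
  | k + 1 => fun n => Submodule.span ℚ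
      {a | ∃ (i j : ℕ) (h : i + j = n) (x : L i) (y : L j), y ∈ lcs L k j ∧ a = br h x y}

/-- `L` is nilpotent. -/
def IsNilpotentLie (L : ℕ → Type u) [∀ n, AddCommGroup (L n)] [∀ n, Module ℚ (L n)]
    [GradedLie L] : Prop := ∃ k, lcs L k = ⊥

/-- Graded ideals. -/
structure GradedIdeal (L : ℕ → Type u) [∀ n, AddCommGroup (L n)] [∀ n, Module ℚ (L n)]
    [GradedLie L] where
  sub : GSub L
  br_mem : ∀ {i j k : ℕ} (h : i + j = k) (x : L i) (y : L j), y ∈ sub j → br h x y ∈ sub k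

theorem GradedIdeal.br_mem_left (I : GradedIdeal L) {i j k : ℕ} (h : i + j = k) (x : L i)
    (y : L j) (hx : x ∈ I.sub i) : br h x y ∈ I.sub k := by
  have h' : j + i = k := by omega
  rw [eq_neg_of_add_eq_zero_left (skew h h' x y)]
  exact neg_mem (Submodule.smul_mem _ _ (I.br_mem h' y x hx))

/-- The bracket of `L / I`. -/
def GradedIdeal.quotBr (I : GradedIdeal L) {i j k : ℕ} (h : i + j = k) :
    GQuot I.sub i →ₗ[ℚ] GQuot I.sub j →ₗ[ℚ] GQuot I.sub k :=
  Submodule.liftQ (I.sub i)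
    { toFun := fun x => Submodule.mapQ (I.sub j) (I.sub k) (br h x) fun y hy => I.br_mem h x y hy
      map_add' := fun x y => by
        apply Submodule.linearMap_qext; ext z; simp
      map_smul' := fun c x => by
        apply Submodule.linearMap_qext; ext z; simp }
    fun x hx => by
      rw [LinearMap.mem_ker]
      apply Submodule.linearMap_qext
      ext y
      simpa using I.br_mem_left h x y hx

theorem GradedIdeal.quotBr_mk (I : GradedIdeal L) {i j k : ℕ} (h : i + j = k) (x : L i)
    (y : L j) : I.quotBr h (Submodule.Quotient.mk x) (Submodule.Quotient.mk y) =
      Submodule.Quotient.mk (br h x y) := rfl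

/-- The quotient graded Lie algebra `L / I`. -/
instance GradedIdeal.quotLie (I : GradedIdeal L) : GradedLie (GQuot I.sub) where
  br := I.quotBr
  skew := fun h h' x y => by
    induction x using Submodule.Quotient.induction_on with | _ x => ?_
    induction y using Submodule.Quotient.induction_on with | _ y => ?_
    rw [I.quotBr_mk, I.quotBr_mk, ← Submodule.Quotient.mk_smul, ← Submodule.Quotient.mk_add,
      skew h h', Submodule.Quotient.mk_zero]
  jacobi := fun hij hjk hik h₁ h₂ h₃ x y z => by
    induction x using Submodule.Quotient.induction_on with | _ x => ?_
    induction y using Submodule.Quotient.induction_on with | _ y => ?_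
    induction z using Submodule.Quotient.induction_on with | _ z => ?_
    simp only [I.quotBr_mk]
    rw [← Submodule.Quotient.mk_smul, ← Submodule.Quotient.mk_add,
      jacobi hij hjk hik h₁ h₂ h₃]

/-- The family of quotient maps `L → L / I α` is an enriched structure on the graded Lie
algebra `L`. (A surjection `ρ_α` is given by its kernel `I α`.) -/
structure IsEnriched (I : ι → GradedIdeal L) : Prop where
  finiteCodim : ∀ α, FiniteCodim (I α).sub
  nilpotent : ∀ α, IsNilpotentLie (GQuot (I α).sub)
  directed : IsDirectedFamily fun α => (I α).sub
  separated : ∀ n (x : L n), (∀ α, x ∈ (I α).sub n) → x = 0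

/-- The inverse limit of the graded Lie algebras `L / I α` is a graded Lie algebra, with
componentwise bracket. -/
instance limLie (I : ι → GradedIdeal L) : GradedLie (fun n => invLim (fun α => (I α).sub) n) where
  br := fun {i j k} h => LinearMap.mk₂ ℚ
    (fun x y => ⟨fun α => (I α).quotBr h (x.1 α) (y.1 α), fun α β hαβ => by
      have hx := x.2 α β hαβ
      have hy := y.2 α β hαβ
      dsimp only at hx hy ⊢
      rw [← hx, ← hy]
      induction x.1 α using Submodule.Quotient.induction_on with | _ a => ?_
      induction y.1 α using Submodule.Quotient.induction_on with | _ b => ?_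
      rfl⟩)
    (fun x x' y => by ext α; simp)
    (fun c x y => by ext α; simp)
    (fun x y y' => by ext α; simp)
    (fun c x y => by ext α; simp)
  skew := fun h h' x y => by
    apply Subtype.ext
    funext α
    exact (I α).quotLie.skew h h' (x.1 α) (y.1 α)
  jacobi := fun hij hjk hik h₁ h₂ h₃ x y z => by
    apply Subtype.ext
    funext α
    exact (I α).quotLie.jacobi hij hjk hik h₁ h₂ h₃ (x.1 α) (y.1 α) (z.1 α)

/-- An isomorphism `(L, K) ≅ (M, J)` of graded Lie algebras with families of graded subspaces:
an isomorphism of graded Lie algebras that is coherent together with its inverse. -/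
structure EnrichedIso (K : ι → GSub L) (J : κ → GSub M) where
  equiv : ∀ n, L n ≃ₗ[ℚ] M n
  map_br : ∀ {i j k : ℕ} (h : i + j = k) (x : L i) (y : L j),
    equiv k (br h x y) = br h (equiv i x) (equiv j y)
  coherent : Coherent K J fun n => (equiv n).toLinearMap
  coherent_symm : Coherent J K fun n => (equiv n).symm.toLinearMap

end Lie

/-! ## Free graded Lie algebras -/

section Free

variable (T : ℕ → Type u) [∀ n, AddCommGroup (T n)] [∀ n, Module ℚ (T n)]

/-- Lie expressions in the homogeneous elements of `T`, by degree. -/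
inductive LieExpr (T : ℕ → Type u) : ℕ → Type u
  | of {n : ℕ} (t : T n) : LieExpr T n
  | zero (n : ℕ) : LieExpr T n
  | add {n : ℕ} (a b : LieExpr T n) : LieExpr T n
  | smul {n : ℕ} (c : ℚ) (a : LieExpr T n) : LieExpr T n
  | br {i j k : ℕ} (h : i + j = k) (a : LieExpr T i) (b : LieExpr T j) : LieExpr T k

/-- The smallest congruence for which the generators are linear and the axioms of a graded
Lie algebra hold. -/
inductive LieRel : ∀ {n : ℕ}, LieExpr T n → LieExpr T n → Prop
  | refl {n : ℕ} (a : LieExpr T n) : LieRel a a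
  | symm {n : ℕ} {a b : LieExpr T n} : LieRel a b → LieRel b a
  | trans {n : ℕ} {a b c : LieExpr T n} : LieRel a b → LieRel b c → LieRel a c
  | add_congr {n : ℕ} {a a' b b' : LieExpr T n} : LieRel a a' → LieRel b b' → LieRel (.add a b) (.add a' b')
  | smul_congr {n : ℕ} (c : ℚ) {a a' : LieExpr T n} : LieRel a a' → LieRel (.smul c a) (.smul c a')
  | br_congr {i j k : ℕ} (h : i + j = k) {a a' : LieExpr T i} {b b' : LieExpr T j} :
      LieRel a a' → LieRel b b' → LieRel (.br h a b) (.br h a' b')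
  | add_assoc {n : ℕ} (a b c : LieExpr T n) : LieRel (.add (.add a b) c) (.add a (.add b c))
  | add_comm {n : ℕ} (a b : LieExpr T n) : LieRel (.add a b) (.add b a)
  | zero_add {n : ℕ} (a : LieExpr T n) : LieRel (.add (.zero n) a) a
  | neg_add {n : ℕ} (a : LieExpr T n) : LieRel (.add (.smul (-1) a) a) (.zero n)
  | one_smul {n : ℕ} (a : LieExpr T n) : LieRel (.smul 1 a) a
  | mul_smul {n : ℕ} (c d : ℚ) (a : LieExpr T n) : LieRel (.smul (c * d) a) (.smul c (.smul d a))
  | smul_add {n : ℕ} (c : ℚ) (a b : LieExpr T n) :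
      LieRel (.smul c (.add a b)) (.add (.smul c a) (.smul c b))
  | add_smul {n : ℕ} (c d : ℚ) (a : LieExpr T n) :
      LieRel (.smul (c + d) a) (.add (.smul c a) (.smul d a))
  | of_add {n : ℕ} (s t : T n) : LieRel (.of (s + t)) (.add (.of s) (.of t))
  | of_smul {n : ℕ} (c : ℚ) (t : T n) : LieRel (.of (c • t)) (.smul c (.of t))
  | br_add {i j k : ℕ} (h : i + j = k) (a : LieExpr T i) (b b' : LieExpr T j) :
      LieRel (.br h a (.add b b')) (.add (.br h a b) (.br h a b'))
  | br_smul {i j k : ℕ} (h : i + j = k) (c : ℚ) (a : LieExpr T i) (b : LieExpr T j) :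
      LieRel (.br h a (.smul c b)) (.smul c (.br h a b))
  | add_br {i j k : ℕ} (h : i + j = k) (a a' : LieExpr T i) (b : LieExpr T j) :
      LieRel (.br h (.add a a') b) (.add (.br h a b) (.br h a' b))
  | smul_br {i j k : ℕ} (h : i + j = k) (c : ℚ) (a : LieExpr T i) (b : LieExpr T j) :
      LieRel (.br h (.smul c a) b) (.smul c (.br h a b))
  | skew {i j k : ℕ} (h : i + j = k) (h' : j + i = k) (a : LieExpr T i) (b : LieExpr T j) :
      LieRel (.add (.br h a b) (.smul ((-1) ^ (i * j)) (.br h' b a))) (.zero k)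
  | jacobi {i j k ij jk ik m : ℕ} (hij : i + j = ij) (hjk : j + k = jk) (hik : i + k = ik)
      (h₁ : i + jk = m) (h₂ : ij + k = m) (h₃ : j + ik = m)
      (a : LieExpr T i) (b : LieExpr T j) (c : LieExpr T k) :
      LieRel (.br h₁ a (.br hjk b c))
        (.add (.br h₂ (.br hij a b) c) (.smul ((-1) ^ (i * j)) (.br h₃ b (.br hik a c))))

/-- The setoid of the congruence `LieRel`. -/
def relSetoid (n : ℕ) : Setoid (LieExpr T n) := ⟨LieRel T, .refl, .symm, .trans⟩

/-- The free graded Lie algebra `𝕃_T` on the graded vector space `T`. -/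
def FreeLie (n : ℕ) : Type u := Quotient (relSetoid T n)

namespace FreeLie

variable {T}

/-- The class of an expression. -/
def mk {n : ℕ} (a : LieExpr T n) : FreeLie T n := Quotient.mk (relSetoid T n) a

theorem sound {n : ℕ} {a b : LieExpr T n} (h : LieRel T a b) : mk a = mk b :=
  Quotient.sound (s := relSetoid T n) h

theorem ind {n : ℕ} {P : FreeLie T n → Prop} (h : ∀ a, P (mk a)) (x : FreeLie T n) : P x :=
  Quotient.ind (s := relSetoid T n) h x

instance (n : ℕ) : Zero (FreeLie T n) := ⟨mk (.zero n)⟩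

instance (n : ℕ) : Add (FreeLie T n) :=
  ⟨Quotient.map₂ .add fun _ _ h _ _ h' => LieRel.add_congr h h'⟩

instance (n : ℕ) : SMul ℚ (FreeLie T n) :=
  ⟨fun c => Quotient.map (.smul c) fun _ _ h => LieRel.smul_congr c h⟩

instance (n : ℕ) : Neg (FreeLie T n) := ⟨fun x => (-1 : ℚ) • x⟩

theorem mk_add {n : ℕ} (a b : LieExpr T n) : mk (.add a b) = mk a + mk b := rfl

theorem mk_smul {n : ℕ} (c : ℚ) (a : LieExpr T n) : mk (.smul c a) = c • mk a := rfl

instance (n : ℕ) : AddGroup (FreeLie T n) :=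
  AddGroup.ofLeftAxioms
    (fun x y z => by
      induction x using ind with | _ a => ?_
      induction y using ind with | _ b => ?_
      induction z using ind with | _ c => ?_
      exact sound (.add_assoc a b c))
    (fun x => by
      induction x using ind with | _ a => ?_
      exact sound (.zero_add a))
    (fun x => by
      induction x using ind with | _ a => ?_
      exact sound (.neg_add a))

instance (n : ℕ) : AddCommGroup (FreeLie T n) where
  add_comm := fun x y => by
    induction x using ind with | _ a => ?_
    induction y using ind with | _ b => ?_
    exact sound (.add_comm a b)

instance (n : ℕ) : Module ℚ (FreeLie T n) :=
  Module.ofMinimalAxioms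
    (fun c x y => by
      induction x using ind with | _ a => ?_
      induction y using ind with | _ b => ?_
      exact sound (.smul_add c a b))
    (fun c d x => by
      induction x using ind with | _ a => ?_
      exact sound (.add_smul c d a))
    (fun c d x => by
      induction x using ind with | _ a => ?_
      exact sound (.mul_smul c d a))
    (fun x => by
      induction x using ind with | _ a => ?_
      exact sound (.one_smul a))

/-- The inclusion `T → 𝕃_T`. -/
def of (n : ℕ) : T n →ₗ[ℚ] FreeLie T n where
  toFun := fun t => mk (.of t)
  map_add' := fun s t => sound (.of_add s t)
  map_smul' := fun c t => sound (.of_smul c t)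

instance : GradedLie (FreeLie T) where
  br := fun {i j k} h => LinearMap.mk₂ ℚ
    (Quotient.map₂ (.br h) fun _ _ h₁ _ _ h₂ => LieRel.br_congr h h₁ h₂)
    (fun x x' y => by
      induction x using ind with | _ a => ?_
      induction x' using ind with | _ a' => ?_
      induction y using ind with | _ b => ?_
      exact sound (.add_br h a a' b))
    (fun c x y => by
      induction x using ind with | _ a => ?_
      induction y using ind with | _ b => ?_
      exact sound (.smul_br h c a b))
    (fun x y y' => by
      induction x using ind with | _ a => ?_
      induction y using ind with | _ b => ?_
      induction y' using ind with | _ b' => ?_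
      exact sound (.br_add h a b b'))
    (fun c x y => by
      induction x using ind with | _ a => ?_
      induction y using ind with | _ b => ?_
      exact sound (.br_smul h c a b))
  skew := fun h h' x y => by
    induction x using ind with | _ a => ?_
    induction y using ind with | _ b => ?_
    exact sound (.skew h h' a b)
  jacobi := fun hij hjk hik h₁ h₂ h₃ x y z => by
    induction x using ind with | _ a => ?_
    induction y using ind with | _ b => ?_
    induction z using ind with | _ c => ?_
    exact sound (.jacobi hij hjk hik h₁ h₂ h₃ a b c)

variable {M : ℕ → Type w} [∀ n, AddCommGroup (M n)] [∀ n, Module ℚ (M n)] [GradedLie M]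

/-- The value of a Lie expression under a linear map `T → M`. -/
def eval (f : ∀ n, T n →ₗ[ℚ] M n) : ∀ {n : ℕ}, LieExpr T n → M n
  | _, .of t => f _ t
  | _, .zero _ => 0
  | _, .add a b => eval f a + eval f b
  | _, .smul c a => c • eval f a
  | _, .br h a b => GradedLie.br h (eval f a) (eval f b)

theorem eval_rel (f : ∀ n, T n →ₗ[ℚ] M n) {n : ℕ} {a b : LieExpr T n} (h : LieRel T a b) :
    eval f a = eval f b := by
  induction h with
  | refl a => rfl
  | symm _ ih => exact ih.symm
  | trans _ _ ih₁ ih₂ => exact ih₁.trans ih₂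
  | add_congr _ _ ih₁ ih₂ => simp only [eval, ih₁, ih₂]
  | smul_congr c _ ih => simp only [eval, ih]
  | br_congr h _ _ ih₁ ih₂ => simp only [eval, ih₁, ih₂]
  | add_assoc a b c => exact _root_.add_assoc _ _ _
  | add_comm a b => exact _root_.add_comm _ _
  | zero_add a => exact _root_.zero_add _
  | neg_add a => simp [eval]
  | one_smul a => simp [eval]
  | mul_smul c d a => exact SemigroupAction.mul_smul _ _ _
  | smul_add c a b => simp [eval]
  | add_smul c d a => exact _root_.add_smul _ _ _
  | of_add s t => simp [eval]
  | of_smul c t => simp [eval]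
  | br_add h a b b' => simp [eval]
  | br_smul h c a b => simp [eval]
  | add_br h a a' b => simp [eval]
  | smul_br h c a b => simp [eval]
  | skew h h' a b => exact GradedLie.skew h h' _ _
  | jacobi hij hjk hik h₁ h₂ h₃ a b c => exact GradedLie.jacobi hij hjk hik h₁ h₂ h₃ _ _ _

/-- The extension of a linear map `T → M` to `𝕃_T`. -/
def lift (f : ∀ n, T n →ₗ[ℚ] M n) (n : ℕ) : FreeLie T n →ₗ[ℚ] M n where
  toFun := Quotient.lift (s := relSetoid T n) (eval f) fun _ _ h => eval_rel f h
  map_add' := fun x y => by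
    induction x using ind with | _ a => ?_
    induction y using ind with | _ b => ?_
    rfl
  map_smul' := fun c x => by
    induction x using ind with | _ a => ?_
    rfl

theorem lift_br (f : ∀ n, T n →ₗ[ℚ] M n) {i j k : ℕ} (h : i + j = k) (x : FreeLie T i)
    (y : FreeLie T j) :
    lift f k (GradedLie.br h x y) = GradedLie.br h (lift f i x) (lift f j y) := by
  induction x using ind with | _ a => ?_
  induction y using ind with | _ b => ?_
  rfl

/-- The morphism `𝕃_T → 𝕃_{T/K}` induced by `T → T / K`. -/
def toQuot (K : GSub T) (n : ℕ) : FreeLie T n →ₗ[ℚ] FreeLie (GQuot K) n :=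
  lift (fun n => of n ∘ₗ (K n).mkQ) n

end FreeLie

theorem lcs_br_mem {L : ℕ → Type u} [∀ n, AddCommGroup (L n)] [∀ n, Module ℚ (L n)]
    [GradedLie L] (m : ℕ) : ∀ {i j k : ℕ} (h : i + j = k) (x : L i) (y : L j),
    y ∈ lcs L m j → GradedLie.br h x y ∈ lcs L m k := by
  induction m with
  | zero => intros; trivial
  | succ m ih =>
    intro i j k h x y hy
    refine Submodule.span_induction (p := fun y _ => GradedLie.br h x y ∈ lcs L (m + 1) k)
      ?_ ?_ ?_ ?_ hy
    · rintro _ ⟨p, q, hpq, a, b, hb, rfl⟩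
      exact Submodule.subset_span ⟨i, j, h, x, _, ih hpq a b hb, rfl⟩
    · rw [map_zero]; exact zero_mem _
    · intro a b _ _ ha hb; rw [map_add]; exact add_mem ha hb
    · intro c a _ ha; rw [map_smul]; exact Submodule.smul_mem _ c ha

variable {T} {κ : Type z}

/-- The enriched structure of `𝕃_T` defined by an enriched structure of `T`: the kernels of
the morphisms `𝕃_T → 𝕃_{T_α} → 𝕃_{T_α} / (𝕃_{T_α})^{m+1}`, where `T_α = T / K α`. -/
def freeIdeal (K : κ → GSub T) (p : κ × ℕ) : GradedIdeal (FreeLie T) where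
  sub := fun n => (lcs (FreeLie (GQuot (K p.1))) p.2 n).comap (FreeLie.toQuot (K p.1) n)
  br_mem := fun h x y hy => by
    rw [Submodule.mem_comap] at hy ⊢
    unfold FreeLie.toQuot at hy ⊢
    rw [FreeLie.lift_br]
    exact lcs_br_mem _ h _ _ hy

/-- The underlying family of graded subspaces of `𝕃_T`. -/
def freeFamily (K : κ → GSub T) : κ × ℕ → GSub (FreeLie T) := fun p => (freeIdeal K p).sub

/-- The completion of `𝕃_T`. -/
abbrev Profree (K : κ → GSub T) : ℕ → Type (max u z) := fun n => invLim (freeFamily K) n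

/-- The graded Lie algebra structure of the completion of `𝕃_T`. -/
instance profreeLie (K : κ → GSub T) : GradedLie (Profree K) := limLie (freeIdeal K)

/-- The enriched structure of the completion of `𝕃_T`. -/
def profreeFamily (K : κ → GSub T) : κ × ℕ → GSub (Profree K) := limKer (freeFamily K)

/-- The map `T → 𝕃_T → completion of 𝕃_T`. -/
def profreeOf (K : κ → GSub T) (n : ℕ) : T n →ₗ[ℚ] Profree K n :=
  toLim (freeFamily K) n ∘ₗ FreeLie.of n

end Free

/-- `(L, I)` is profree: it is isomorphic, as an enriched Lie algebra, to the completion of `𝕃_T`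
for a complete enriched vector space `T`. -/
def IsProfree {L : ℕ → Type u} [∀ n, AddCommGroup (L n)] [∀ n, Module ℚ (L n)] [GradedLie L]
    {ι : Type v} (I : ι → GradedIdeal L) : Prop :=
  ∃ (T : ℕ → Type u) (_ : ∀ n, AddCommGroup (T n)) (_ : ∀ n, Module ℚ (T n))
    (κ : Type v) (K : κ → GSub T), IsEnrichedSpace K ∧ IsLimComplete K ∧
      Nonempty (EnrichedIso (profreeFamily K) fun α => (I α).sub)

/-! ## Free graded commutative algebras on spaces of positive degree -/

section Lambda

variable (V : ℕ → Type u) [∀ n, AddCommGroup (V n)] [∀ n, Module ℚ (V n)]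

/-- Graded commutativity of the generators; `V n` is placed in degree `n + 1`. -/
inductive CommRel : TensorAlgebra ℚ (⨁ n, V n) → TensorAlgebra ℚ (⨁ n, V n) → Prop
  | comm (m n : ℕ) (a : V m) (b : V n) : CommRel
      (TensorAlgebra.ι ℚ (DirectSum.lof ℚ ℕ V m a) * TensorAlgebra.ι ℚ (DirectSum.lof ℚ ℕ V n b))
      ((-1 : ℚ) ^ ((m + 1) * (n + 1)) •
        (TensorAlgebra.ι ℚ (DirectSum.lof ℚ ℕ V n b) *
          TensorAlgebra.ι ℚ (DirectSum.lof ℚ ℕ V m a)))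

/-- The free graded commutative algebra `ΛV`, where `V n` is the component of degree `n + 1`
of the generating space. -/
def Lambda : Type u := (ringConGen (CommRel V)).Quotient

instance : Ring (Lambda V) := inferInstanceAs (Ring (ringConGen (CommRel V)).Quotient)

instance : Algebra ℚ (Lambda V) := inferInstanceAs (Algebra ℚ (ringConGen (CommRel V)).Quotient)

/-- The quotient map from the tensor algebra. -/
def Lambda.proj : TensorAlgebra ℚ (⨁ n, V n) →ₐ[ℚ] Lambda V :=
  RingCon.mkₐ ℚ (ringConGen (CommRel V))

variable {V}

/-- The inclusion of the generators of degree `n + 1`. -/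
def gen (n : ℕ) : V n →ₗ[ℚ] Lambda V :=
  (Lambda.proj V).toLinearMap ∘ₗ TensorAlgebra.ι ℚ ∘ₗ DirectSum.lof ℚ ℕ V n

theorem gen_comm (m n : ℕ) (a : V m) (b : V n) :
    gen m a * gen n b = (-1 : ℚ) ^ ((m + 1) * (n + 1)) • (gen n b * gen m a) := by
  have : Lambda.proj V _ = Lambda.proj V _ :=
    (RingCon.eq _).2 (RingCon.le_ringConGen (r := CommRel V) _ _ (CommRel.comm m n a b))
  rw [map_mul, map_smul, map_mul] at this
  exact this

/-- The product `V^{i+1} ⊗ V^{j+1} → Λ²V`. -/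
def genMul (i j : ℕ) : V i ⊗[ℚ] V j →ₗ[ℚ] Lambda V :=
  TensorProduct.lift ((LinearMap.mul ℚ (Lambda V)).compl₁₂ (gen i) (gen j))

theorem gen_genMul_comm (m i j : ℕ) (a : V m) (t : V i ⊗[ℚ] V j) :
    gen m a * genMul i j t = (-1 : ℚ) ^ ((m + 1) * (i + j)) • (genMul i j t * gen m a) := by
  induction t using TensorProduct.induction_on with
  | zero => simp
  | add s t hs ht => rw [map_add, mul_add (gen m a), hs, ht, add_mul (genMul i j s), smul_add]
  | tmul b c =>
    simp only [genMul, TensorProduct.lift.tmul, LinearMap.compl₁₂_apply, LinearMap.mul_apply']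
    rw [← mul_assoc, gen_comm m i, smul_mul_assoc, mul_assoc, gen_comm m j, mul_smul_comm,
      smul_smul, mul_assoc, ← pow_add]
    congr 1
    rw [show (m + 1) * (i + 1) + (m + 1) * (j + 1) = (m + 1) * (i + j) + 2 * (m + 1) by ring,
      pow_add, pow_mul]
    simp

/-- The quadratic map `V → Λ²V` of degree `1` with components `δ i j : V^{i+j+1} → V^{i+1} ⊗ V^{j+1}`. -/
def quad (δ : ∀ {i j n : ℕ}, i + j = n → (V n →ₗ[ℚ] V i ⊗[ℚ] V j)) (n : ℕ) :
    V n →ₗ[ℚ] Lambda V :=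
  ∑ p ∈ (Finset.HasAntidiagonal.antidiagonal n).attach,
    genMul p.1.1 p.1.2 ∘ₗ δ (Finset.HasAntidiagonal.mem_antidiagonal.1 p.2)

theorem gen_quad_comm (δ : ∀ {i j n : ℕ}, i + j = n → (V n →ₗ[ℚ] V i ⊗[ℚ] V j))
    (m n : ℕ) (a : V m) (b : V n) :
    gen m a * quad δ n b = (-1 : ℚ) ^ ((m + 1) * n) • (quad δ n b * gen m a) := by
  simp only [quad, LinearMap.sum_apply, Finset.mul_sum, Finset.sum_mul, Finset.smul_sum,
    LinearMap.comp_apply]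
  refine Finset.sum_congr rfl fun p _ => ?_
  rw [gen_genMul_comm, Finset.HasAntidiagonal.mem_antidiagonal.1 p.2]

/-- The map `v ↦ (σ v, dv; 0, v)` on generators, `σ` the degree involution. -/
def derivGen (δ : ∀ {i j n : ℕ}, i + j = n → (V n →ₗ[ℚ] V i ⊗[ℚ] V j)) :
    (⨁ n, V n) →ₗ[ℚ] Matrix (Fin 2) (Fin 2) (Lambda V) :=
  DirectSum.toModule ℚ ℕ _ fun n =>
    { toFun := fun v => !![(-1 : ℚ) ^ (n + 1) • gen n v, quad δ n v; 0, gen n v]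
      map_add' := fun v w => by
        ext i j; fin_cases i <;> fin_cases j <;> simp
      map_smul' := fun c v => by
        ext i j; fin_cases i <;> fin_cases j <;> simp [smul_comm c] }

/-- The algebra map `a ↦ (σ a, da; 0, a)`; its multiplicativity is the Leibniz rule
`d(ab) = da · b + σ(a) · db`. -/
def derivMat (δ : ∀ {i j n : ℕ}, i + j = n → (V n →ₗ[ℚ] V i ⊗[ℚ] V j)) :
    Lambda V →ₐ[ℚ] Matrix (Fin 2) (Fin 2) (Lambda V) :=
  RingCon.liftₐEquiv (ringConGen (CommRel V)) ⟨TensorAlgebra.lift ℚ (derivGen δ), by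
    refine RingCon.ringConGen_le.2 fun x y hxy => ?_
    obtain ⟨m, n, a, b⟩ := hxy
    simp only [RingCon.ker_apply, RingHom.coe_coe, map_mul, map_smul, TensorAlgebra.lift_ι_apply, derivGen, DirectSum.toModule_lof,
      LinearMap.coe_mk, AddHom.coe_mk]
    have h1 := gen_comm m n a b
    have h2 := gen_quad_comm δ m n a b
    have h3 : quad δ m a * gen n b = (-1 : ℚ) ^ ((n + 1) * m) • (gen n b * quad δ m a) := by
      rw [gen_quad_comm δ n m b a, smul_smul, ← pow_add, Even.neg_one_pow ⟨_, rfl⟩, one_smul]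
    ext i j
    fin_cases i <;> fin_cases j
    · simp [h1, smul_smul]
      ring_nf
    · have e1 : (-1 : ℚ) ^ (m + 1) * (-1) ^ ((m + 1) * n) = (-1) ^ ((m + 1) * (n + 1)) := by
        rw [← pow_add]; congr 1; ring
      have e2 : (-1 : ℚ) ^ ((n + 1) * m) = (-1) ^ ((m + 1) * (n + 1)) * (-1) ^ (n + 1) := by
        rw [← pow_add, show (m + 1) * (n + 1) + (n + 1) = (n + 1) * m + 2 * (n + 1) by ring,
          pow_add _ ((n + 1) * m), pow_mul _ 2]
        simp
      simp [h2, h3, smul_smul, e1, e2]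
      abel
    · simp
    · simp [h1]⟩

/-- The derivation `d` of `ΛV` of degree `1` that extends `quad δ`. -/
def derivExt (δ : ∀ {i j n : ℕ}, i + j = n → (V n →ₗ[ℚ] V i ⊗[ℚ] V j)) :
    Lambda V →ₗ[ℚ] Lambda V where
  toFun := fun a => derivMat δ a 0 1
  map_add' := fun a b => by simp
  map_smul' := fun c a => by simp

end Lambda
/-! ## The quadratic model of a complete enriched Lie algebra -/

section Model

variable {L : ℕ → Type u} [∀ n, AddCommGroup (L n)] [∀ n, Module ℚ (L n)] [GradedLie L]
variable {ι : Type v}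

open GradedLie

/-- The generating space `V = colim_α (s L_α)^∨` of the quadratic model, `L_α = L / I α`.
The component of degree `n + 1` is `colim_α ((L_α)_n)^∨`; here `((L_α)_n)^∨` is the space of linear
forms on `L n` vanishing on `I α`, and the direct limit of these subspaces is their union (as
the family is directed). -/
def predual (I : ι → GradedIdeal L) (n : ℕ) : Submodule ℚ (Module.Dual ℚ (L n)) :=
  ⨆ α, ((I α).sub n).dualAnnihilator

/-- The duality `sL → V^∨`, `⟨v, sx⟩ = v x`. -/
def duality (I : ι → GradedIdeal L) (n : ℕ) : L n →ₗ[ℚ] Module.Dual ℚ (predual I n) :=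
  LinearMap.flip (predual I n).subtype

theorem mem_predual {I : ι → GradedIdeal L} (hI : IsEnriched I) {n : ℕ}
    {f : Module.Dual ℚ (L n)} :
    f ∈ predual I n ↔ ∃ α, f ∈ ((I α).sub n).dualAnnihilator := by
  have := hI.directed.1
  refine Submodule.mem_iSup_of_directed _ fun α β => ?_
  obtain ⟨γ, hα, hβ⟩ := hI.directed.2 α β
  exact ⟨γ, Submodule.dualAnnihilator_anti (hα n), Submodule.dualAnnihilator_anti (hβ n)⟩

/-- The pairing `(a ⊗ b)(x, y) = a x * b y`. -/
def pairing (I : ι → GradedIdeal L) (i j : ℕ) :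
    predual I i ⊗[ℚ] predual I j →ₗ[ℚ] (L i →ₗ[ℚ] L j →ₗ[ℚ] ℚ) :=
  TensorProduct.lift (LinearMap.mk₂ ℚ
    (fun a b => (LinearMap.mul ℚ ℚ).compl₁₂ a.1 b.1)
    (fun a a' b => by ext x y; simp)
    (fun c a b => by ext x y; simp [mul_assoc])
    (fun a b b' => by ext x y; simp [mul_add])
    (fun c a b => by ext x y; simp [mul_left_comm]))

theorem pairing_tmul (I : ι → GradedIdeal L) (i j : ℕ) (a : predual I i) (b : predual I j)
    (x : L i) (y : L j) : pairing I i j (a ⊗ₜ b) x y = a.1 x * b.1 y := rfl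

theorem pairing_injective (I : ι → GradedIdeal L) (i j : ℕ) :
    Function.Injective (pairing I i j) := by
  classical
  rw [injective_iff_map_eq_zero]
  intro t ht
  let B := Module.Basis.ofVectorSpace ℚ (predual I j)
  refine (LinearEquiv.map_eq_zero_iff (TensorProduct.equivFinsuppOfBasisRight B)).1 ?_
  set c := TensorProduct.equivFinsuppOfBasisRight B t with hc
  have hts : t = c.sum fun k a => a ⊗ₜ[ℚ] B k := by
    rw [← (TensorProduct.equivFinsuppOfBasisRight (M := predual I i) B).symm_apply_apply t, ← hc,
      TensorProduct.equivFinsuppOfBasisRight_symm_apply]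
  ext k x
  have hx : ∑ k ∈ c.support, ((c k).1 x) • B k = 0 := by
    apply Subtype.ext
    ext y
    have := LinearMap.congr_fun (LinearMap.congr_fun ht x) y
    rw [hts, Finsupp.sum, map_sum] at this
    simpa [pairing_tmul, LinearMap.sum_apply] using this
  by_cases hk : k ∈ c.support
  · simpa using linearIndependent_iff'.1 B.linearIndependent c.support _ hx k hk
  · rw [Finsupp.notMem_support_iff.1 hk]; rfl

theorem bracket_mem_range {I : ι → GradedIdeal L} (hI : IsEnriched I) {i j n : ℕ}
    (h : i + j = n) (v : predual I n) :
    (LinearMap.compr₂ (br h) v.1 : L i →ₗ[ℚ] L j →ₗ[ℚ] ℚ) ∈ LinearMap.range (pairing I i j) := by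
  obtain ⟨α, hα⟩ := (mem_predual hI).1 v.2
  rw [Submodule.mem_dualAnnihilator] at hα
  have := (hI.finiteCodim α).1 i
  let B := Module.finBasis ℚ (L i ⧸ (I α).sub i)
  choose e he using fun k => Submodule.Quotient.mk_surjective _ (B k)
  let a : ∀ _, predual I i := fun k =>
    ⟨B.coord k ∘ₗ ((I α).sub i).mkQ, (mem_predual hI).2 ⟨α, by
      rw [Submodule.mem_dualAnnihilator]
      intro x hx
      simp [(Submodule.Quotient.mk_eq_zero _).2 hx]⟩⟩
  let b : ∀ _, predual I j := fun k =>
    ⟨v.1 ∘ₗ br h (e k), (mem_predual hI).2 ⟨α, by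
      rw [Submodule.mem_dualAnnihilator]
      intro y hy
      exact hα _ ((I α).br_mem h _ _ hy)⟩⟩
  refine ⟨∑ k, a k ⊗ₜ b k, ?_⟩
  ext x y
  have hx : x - ∑ k, B.coord k (Submodule.Quotient.mk x) • e k ∈ (I α).sub i := by
    rw [← Submodule.Quotient.mk_eq_zero, Submodule.Quotient.mk_sub, sub_eq_zero]
    conv_lhs => rw [← B.sum_repr (Submodule.Quotient.mk x)]
    rw [← Submodule.mkQ_apply, ← Submodule.mkQ_apply, map_sum]
    simp [he]
  have := hα _ ((I α).br_mem_left h _ y hx)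
  rw [map_sub, LinearMap.sub_apply, map_sub, sub_eq_zero] at this
  rw [LinearMap.compr₂_apply, this]
  simp [pairing_tmul, LinearMap.sum_apply, a, b]

/-- The dual of the bracket: `cobracket hI h v` is the element of `V^{i+1} ⊗ V^{j+1}` whose value at
`(x, y)` is `v [x, y]`. -/
def cobracket {I : ι → GradedIdeal L} (hI : IsEnriched I) {i j n : ℕ} (h : i + j = n) :
    predual I n →ₗ[ℚ] predual I i ⊗[ℚ] predual I j :=
  (LinearEquiv.ofInjective _ (pairing_injective I i j)).symm.toLinearMap ∘ₗ
    LinearMap.codRestrict (LinearMap.range (pairing I i j))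
      { toFun := fun v => (br h).compr₂ v.1
        map_add' := fun v w => by ext x y; simp
        map_smul' := fun c v => by ext x y; simp }
      (bracket_mem_range hI h)

theorem pairing_cobracket {I : ι → GradedIdeal L} (hI : IsEnriched I) {i j n : ℕ}
    (h : i + j = n) (v : predual I n) (x : L i) (y : L j) :
    pairing I i j (cobracket hI h v) x y = v.1 (br h x y) := by
  have := LinearEquiv.apply_symm_apply (LinearEquiv.ofInjective _ (pairing_injective I i j))
    ⟨_, bracket_mem_range hI h v⟩
  exact LinearMap.congr_fun (LinearMap.congr_fun (congrArg Subtype.val this) x) y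

/-- The algebra `ΛV` of the quadratic model of `(L, I)`. -/
abbrev Model (I : ι → GradedIdeal L) : Type u := Lambda fun n => predual I n

/-- The differential of the quadratic model: the derivation with
`dv = 1/2 ∑_{i+j=n} (-1)^{ij+i} ∑ a ∧ b` for `v ∈ V^{n+1}`, where `∑ a ⊗ b ∈ V^{i+1} ⊗ V^{j+1}` is dual to
the bracket `L_i × L_j → L_n` composed with `v`. Equivalently
`⟨dv, sx, sy⟩ = (-1)^{deg y + 1} ⟨v, s[x,y]⟩`, with
`⟨a ∧ b, sx, sy⟩ = ⟨a, sy⟩⟨b, sx⟩ + (-1)^{deg a deg b} ⟨b, sy⟩⟨a, sx⟩`. -/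
def modelD {I : ι → GradedIdeal L} (hI : IsEnriched I) : Model I →ₗ[ℚ] Model I :=
  derivExt fun {i j _} h => ((1 / 2 : ℚ) * (-1) ^ (i * j + i)) • cobracket hI h

/-- `V ∩ ker d`, in degree `n + 1`. -/
def cycleGen {I : ι → GradedIdeal L} (hI : IsEnriched I) (n : ℕ) :
    Submodule ℚ (predual I n) :=
  LinearMap.ker (modelD hI ∘ₗ gen (V := fun n => predual I n) n)

/-- The cohomology `H(ΛV) = ker d / im d`. (As `d ∘ d = 0` by the Jacobi identity, `im d` is its own
intersection with `ker d`, which is how it is written here.) -/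
abbrev Cohomology {I : ι → GradedIdeal L} (hI : IsEnriched I) : Type u :=
  LinearMap.ker (modelD hI) ⧸ (LinearMap.range (modelD hI)).submoduleOf (LinearMap.ker (modelD hI))

theorem modelD_algebraMap {I : ι → GradedIdeal L} (hI : IsEnriched I) (c : ℚ) :
    modelD hI (algebraMap ℚ (Model I) c) = 0 := by
  change derivMat _ (algebraMap ℚ (Model I) c) 0 1 = 0
  rw [AlgHom.commutes, Matrix.algebraMap_matrix_apply]
  simp

/-- The canonical map `ℚ ⊕ (V ∩ ker d) → H(ΛV)`. -/
def toCohomology {I : ι → GradedIdeal L} (hI : IsEnriched I) :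
    ℚ × (⨁ n, cycleGen hI n) →ₗ[ℚ] Cohomology hI :=
  Submodule.mkQ _ ∘ₗ LinearMap.codRestrict (LinearMap.ker (modelD hI))
    (LinearMap.coprod (Algebra.linearMap ℚ (Model I))
      (DirectSum.toModule ℚ ℕ (Model I) fun n =>
        gen (V := fun n => predual I n) n ∘ₗ (cycleGen hI n).subtype))
    fun p => by
      rw [LinearMap.coprod_apply, LinearMap.mem_ker, map_add, Algebra.linearMap_apply,
        modelD_algebraMap, zero_add]
      induction p.2 using DirectSum.induction_on with
      | zero => simp
      | add a b ha hb => rw [map_add, map_add, ha, hb, add_zero]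
      | of n v =>
        have := LinearMap.mem_ker.1 v.2
        rw [← DirectSum.lof_eq_of ℚ, DirectSum.toModule_lof]
        exact this

end Model
end EnrichedLie

end

open EnrichedLie

/-! The quadratic model is the Chevalley–Eilenberg algebra on the continuous dual V of L, and (ii)
says that its cohomology sits in word lengths 0 and 1. Since V only sees continuous forms, L can be
replaced by any graded Lie algebra F with a dense map to L; `IsCE` records what is needed.
Contractions i_x and Lie derivatives L_x = [d, i_x] with x in F then reduce identities in ΛV to
identities on generators (`IsCE.lieDer_ctr`, `IsCE.lieDer_lieDer`, `IsCE.d_lieDer`). Injectivity of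
the canonical map is automatic because d raises word length (`toCohomology_injective`), so only
surjectivity is at stake.

(i) ⇒ (ii). Take F = 𝕃_T, let θ be the derivation of 𝕃_T that is the identity on T, and W the
derivation of ΛV dual to θ. As 𝕃_T is free, there is a twisted derivation η from 𝕃_T to (ΛV)^∨ that
vanishes on T and satisfies, up to signs, η[x,y] = x·η(y) − y·η(x) + 2 θx ∧ θy. Its transpose V ⊗ V
→ V extends to a second order operator H of degree −1 that kills V, and dH + Hd = W² − W. Both sides
are second order, so it suffices to compare them on V and on products of two generators
(`secondOrder_homotopy`). On V the identity is dual to the fact that the bracket maps η(x) to θ²x −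
θx; on products it is the recursion for η. On word lengths at least two, W has weights r ≥ 2, where
r² − r ≠ 0; hence cocycles there are boundaries (`exists_eq_add_of_homotopy`). The transposes exist
in V, and not merely in the full dual of 𝕃_T, because η is continuous
(`IsTwist.apply_eq_zero_of_mem_ker`, `IsTwist.apply_eq_zero_of_mem_lcs`).

(ii) ⇒ (i). Take T = (V ∩ ker d)^∨. A retraction of V onto V ∩ ker d dualizes to a coherent section
T → L, which extends to 𝕃_T → L. The image is dense, because each L_α is nilpotent and T covers its
abelianization. It remains to see that each continuous linear form u on 𝕃_T comes from V. By
induction on the length of brackets, u ∘ [ , ] is given by a cocycle in Λ²V; by (ii) it equals dv,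
so v and u agree on brackets, and a cycle corrects v on T (`IsCE.exists_of_mem_dualAnnihilator`). A
dense map to a complete space that induces the topology of its source identifies the target with the
completion (`IsDenseMap.exists_equiv`).

The dualities rest on the fact that a complete enriched space is the dual of its continuous dual
(`coherentDual_eval_bijective`). The elements of V ∩ ker d are the continuous forms that kill
brackets, and for profree L restriction to T identifies them with the continuous dual of T. -/

noncomputable section
namespace EnrichedLie

/-! ### The algebra ΛV: recursion on generators, parity, derivations. -/

section LambdaCalculus

variable {V : ℕ → Type u} [∀ n, AddCommGroup (V n)] [∀ n, Module ℚ (V n)]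

/-! ## Operators on `ΛV` defined by left recursion -/

theorem Lambda.induction {p : Lambda V → Prop} (one : p 1) (add : ∀ a b, p a → p b → p (a + b))
    (smul : ∀ (c : ℚ) a, p a → p (c • a)) (mul : ∀ n (v : V n) a, p a → p (gen n v * a))
    (a : Lambda V) : p a := by
  -- The extra right factor `a` is what lets the induction pass through products in the tensor
  -- algebra.
  have key : ∀ t : TensorAlgebra ℚ (⨁ n, V n), ∀ a, p a → p (Lambda.proj V t * a) := by
    intro t
    induction t using TensorAlgebra.induction with
    | algebraMap r =>
      intro a ha
      rw [AlgHom.commutes, ← Algebra.smul_def]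
      exact smul r a ha
    | ι x =>
      intro a ha
      induction x using DirectSum.induction_on with
      | zero => simpa using smul 0 a ha
      | of n v => exact mul n v a ha
      | add x y hx hy => rw [map_add, map_add, add_mul]; exact add _ _ hx hy
    | mul x y hx hy => intro a ha; rw [map_mul, mul_assoc]; exact hx _ (hy _ ha)
    | add x y hx hy => intro a ha; rw [map_add, add_mul]; exact add _ _ (hx _ ha) (hy _ ha)
  obtain ⟨t, rfl⟩ : ∃ t, Lambda.proj V t = a := RingCon.mkₐ_surjective _ a
  simpa using key t 1 one

variable {P : Type w} [AddCommGroup P] [Module ℚ P]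

/-- The linear map `D : ΛV → P` with `D 1 = c` and `D (v a) = F v a + S v (D a)`. -/
theorem Lambda.exists_op (S : ∀ n, V n →ₗ[ℚ] Module.End ℚ P) (F : ∀ n, V n →ₗ[ℚ] (Lambda V →ₗ[ℚ] P))
    (hS : ∀ m n (v : V m) (w : V n) (x : P),
      S m v (S n w x) = (-1 : ℚ) ^ ((m + 1) * (n + 1)) • S n w (S m v x))
    (hF : ∀ m n (v : V m) (w : V n) (a : Lambda V),
      F m v (gen n w * a) + S m v (F n w a) =
        (-1 : ℚ) ^ ((m + 1) * (n + 1)) • (F n w (gen m v * a) + S n w (F m v a))) (c : P) :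
    ∃ D : Lambda V →ₗ[ℚ] P, D 1 = c ∧ ∀ n v a, D (gen n v * a) = F n v a + S n v (D a) := by
  -- A generator v acts on ΛV × P by (a, x) ↦ (v a, F v a + S v x). The hypotheses make these
  -- operators satisfy the relations of ΛV, so ΛV acts, and D a is the second component of a · (1,
  -- c).
  let act : ∀ n, V n →ₗ[ℚ] Module.End ℚ (Lambda V × P) := fun n =>
    { toFun := fun v =>
        ((LinearMap.mulLeft ℚ (gen n v)) ∘ₗ LinearMap.fst ℚ _ _).prod
          ((F n v) ∘ₗ LinearMap.fst ℚ _ _ + (S n v) ∘ₗ LinearMap.snd ℚ _ _)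
      map_add' := fun v w => by
        ext x <;> simp [add_mul]
      map_smul' := fun c v => by
        ext x <;> simp }
  let Φ : Lambda V →ₐ[ℚ] Module.End ℚ (Lambda V × P) :=
    RingCon.liftₐEquiv (ringConGen (CommRel V))
      ⟨TensorAlgebra.lift ℚ (DirectSum.toModule ℚ ℕ _ act), by
        refine RingCon.ringConGen_le.2 fun x y hxy => ?_
        obtain ⟨m, n, v, w⟩ := hxy
        simp only [RingCon.ker_apply, RingHom.coe_coe, map_mul, map_smul,
          TensorAlgebra.lift_ι_apply, DirectSum.toModule_lof]
        refine LinearMap.ext fun x => Prod.ext ?_ ?_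
        · change gen m v * (gen n w * x.1) = (-1 : ℚ) ^ ((m + 1) * (n + 1)) • (gen n w * (gen m v * x.1))
          rw [← mul_assoc, gen_comm, smul_mul_assoc, mul_assoc]
        · change F m v (gen n w * x.1) + S m v (F n w x.1 + S n w x.2) =
            (-1 : ℚ) ^ ((m + 1) * (n + 1)) • (F n w (gen m v * x.1) + S n w (F m v x.1 + S m v x.2))
          rw [map_add, map_add, ← add_assoc, hF, hS, ← add_assoc, smul_add _ _ (S n w (S m v x.2))]⟩
  have hΦ : ∀ n v, Φ (gen n v) = act n v := fun n v => by
    change TensorAlgebra.lift ℚ (DirectSum.toModule ℚ ℕ _ act) (TensorAlgebra.ι ℚ (DirectSum.lof ℚ ℕ V n v)) = _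
    simp only [TensorAlgebra.lift_ι_apply, DirectSum.toModule_lof]
  have hfst : ∀ a : Lambda V, (Φ a (1, c)).1 = a := by
    intro a
    induction a using Lambda.induction with
    | one => simp
    | add a b ha hb => rw [map_add, LinearMap.add_apply, Prod.fst_add, ha, hb]
    | smul r a ha => rw [map_smul, LinearMap.smul_apply, Prod.smul_fst, ha]
    | mul n v a ha =>
      rw [map_mul, hΦ]
      change gen n v * (Φ a (1, c)).1 = _
      rw [ha]
  refine ⟨LinearMap.snd ℚ _ _ ∘ₗ LinearMap.applyₗ (1, c) ∘ₗ Φ.toLinearMap, ?_, ?_⟩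
  · simp
  · intro n v a
    simp only [LinearMap.comp_apply, AlgHom.toLinearMap_apply, map_mul, hΦ]
    change F n v (Φ a (1, c)).1 + _ = _
    rw [hfst]
    rfl

theorem Lambda.ext {D E : Lambda V →ₗ[ℚ] P} (one : D 1 = E 1)
    (mul : ∀ n v a, D a = E a → D (gen n v * a) = E (gen n v * a)) : D = E := by
  ext a
  induction a using Lambda.induction with
  | one => exact one
  | add a b ha hb => rw [map_add, map_add, ha, hb]
  | smul r a ha => rw [map_smul, map_smul, ha]
  | mul n v a ha => exact mul n v a ha

/-- Powers of `-1` whose exponents have the same parity are equal. -/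
theorem neg_one_pow_eq_of_parity {a b : ℕ} (h : Even a ↔ Even b) : (-1 : ℚ) ^ a = (-1) ^ b :=
  neg_one_pow_congr h

/-- The signed left multiplications `v ↦ (-1)^{k |v|} v`. -/
def signMul (k n : ℕ) : V n →ₗ[ℚ] Module.End ℚ (Lambda V) :=
  (-1 : ℚ) ^ (k * (n + 1)) • ((LinearMap.mul ℚ (Lambda V)) ∘ₗ gen n)

theorem signMul_apply (k n : ℕ) (v : V n) (a : Lambda V) :
    signMul k n v a = (-1 : ℚ) ^ (k * (n + 1)) • (gen n v * a) := rfl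

/-- A special case of `Lambda.exists_op`. -/
theorem Lambda.exists_signOp (k : ℕ) (F : ∀ n, V n →ₗ[ℚ] Module.End ℚ (Lambda V))
    (hF : ∀ m n (v : V m) (w : V n) (a : Lambda V),
      F m v (gen n w * a) + (-1 : ℚ) ^ (k * (m + 1)) • (gen m v * F n w a) =
        (-1 : ℚ) ^ ((m + 1) * (n + 1)) • (F n w (gen m v * a) +
          (-1 : ℚ) ^ (k * (n + 1)) • (gen n w * F m v a))) (c : Lambda V) :
    ∃ D : Lambda V →ₗ[ℚ] Lambda V, D 1 = c ∧ ∀ n v a,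
      D (gen n v * a) = F n v a + (-1 : ℚ) ^ (k * (n + 1)) • (gen n v * D a) := by
  refine Lambda.exists_op (signMul k) F (fun m n v w x => ?_) hF c
  simp only [signMul_apply, mul_smul_comm, ← mul_assoc]
  rw [gen_comm m n v w]
  simp only [smul_mul_assoc, smul_smul]
  congr 1
  ring

theorem Lambda.exists_parity : ∃ D : Lambda V →ₗ[ℚ] Lambda V, D 1 = 1 ∧ ∀ n v a,
    D (gen n v * a) = (-1 : ℚ) ^ (n + 1) • (gen n v * D a) := by
  obtain ⟨D, h1, h2⟩ := Lambda.exists_signOp (V := V) 1 0 (by intros; simp) 1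
  exact ⟨D, h1, fun n v a => by simpa using h2 n v a⟩

/-- The parity automorphism of `ΛV`. -/
def Lambda.parity : Lambda V →ₗ[ℚ] Lambda V := Lambda.exists_parity.choose

theorem parity_one : Lambda.parity (1 : Lambda V) = 1 := Lambda.exists_parity.choose_spec.1

theorem parity_gen_mul (n : ℕ) (v : V n) (a : Lambda V) :
    Lambda.parity (gen n v * a) = (-1 : ℚ) ^ (n + 1) • (gen n v * Lambda.parity a) := by
  exact Lambda.exists_parity.choose_spec.2 n v a

theorem parity_gen (n : ℕ) (v : V n) : Lambda.parity (gen n v) = (-1 : ℚ) ^ (n + 1) • gen n v := by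
  simpa [parity_one] using parity_gen_mul n v 1

theorem parity_mul (a b : Lambda V) : Lambda.parity (a * b) = Lambda.parity a * Lambda.parity b := by
  induction a using Lambda.induction with
  | one => simp [parity_one]
  | add a a' ha hb => rw [add_mul, map_add, map_add, ha, hb, add_mul]
  | smul r a ha => rw [smul_mul_assoc, map_smul, map_smul, ha, smul_mul_assoc]
  | mul n v a ha => rw [mul_assoc, parity_gen_mul, parity_gen_mul, ha, smul_mul_assoc, mul_assoc]

/-- `parity ^ k`. -/
def parityPow (k : ℕ) : Lambda V →ₗ[ℚ] Lambda V := Lambda.parity ^ k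

theorem parityPow_zero (a : Lambda V) : parityPow 0 a = a := rfl

theorem parityPow_succ (k : ℕ) (a : Lambda V) : parityPow (k + 1) a = Lambda.parity (parityPow k a) := by
  rw [parityPow, pow_succ']; rfl

theorem parityPow_one (k : ℕ) : parityPow k (1 : Lambda V) = 1 := by
  induction k with
  | zero => rfl
  | succ k ih => rw [parityPow_succ, ih, parity_one]

theorem parityPow_gen_mul (k n : ℕ) (v : V n) (a : Lambda V) :
    parityPow k (gen n v * a) = (-1 : ℚ) ^ (k * (n + 1)) • (gen n v * parityPow k a) := by
  induction k with
  | zero => simp [parityPow_zero]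
  | succ k ih =>
    rw [parityPow_succ, ih, map_smul, parity_gen_mul, parityPow_succ, smul_smul, ← pow_add]
    congr 2; ring

theorem parityPow_eq_of_parity {k : ℕ} {e : ℕ} {a : Lambda V} (h : Lambda.parity a = (-1 : ℚ) ^ e • a) :
    parityPow k a = (-1 : ℚ) ^ (k * e) • a := by
  induction k with
  | zero => simp [parityPow_zero]
  | succ k ih => rw [parityPow_succ, ih, map_smul, h, smul_smul, ← pow_add]; congr 2; ring

theorem parityPow_add (k l : ℕ) (a : Lambda V) :
    parityPow (k + l) a = parityPow k (parityPow l a) := by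
  rw [parityPow, pow_add]; rfl

/-! ## Derivations -/

/-- Derivations of parity `k`. -/
structure IsDer (k : ℕ) (D : Lambda V →ₗ[ℚ] Lambda V) : Prop where
  one : D 1 = 0
  gen_mul : ∀ n (v : V n) a,
    D (gen n v * a) = D (gen n v) * a + (-1 : ℚ) ^ (k * (n + 1)) • (gen n v * D a)
  parity : ∀ a, Lambda.parity (D a) = (-1 : ℚ) ^ k • D (Lambda.parity a)

theorem IsDer.ext {k : ℕ} {D E : Lambda V →ₗ[ℚ] Lambda V} (hD : IsDer k D) (hE : IsDer k E)
    (h : ∀ n (v : V n), D (gen n v) = E (gen n v)) : D = E :=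
  Lambda.ext (hD.one.trans hE.one.symm) fun n v a ha => by
    rw [hD.gen_mul, hE.gen_mul, h, ha]

theorem IsDer.zero (k : ℕ) : IsDer k (0 : Lambda V →ₗ[ℚ] Lambda V) :=
  ⟨rfl, by intros; simp, by intros; simp⟩

theorem IsDer.smul {k : ℕ} {D : Lambda V →ₗ[ℚ] Lambda V} (hD : IsDer k D) (c : ℚ) :
    IsDer k (c • D) :=
  ⟨by simp [hD.one], fun n v a => by
    simp only [LinearMap.smul_apply]
    rw [hD.gen_mul, smul_add, smul_mul_assoc, mul_smul_comm, smul_comm c], fun a => by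
    simp only [LinearMap.smul_apply, map_smul]
    rw [hD.parity, smul_comm]⟩

theorem IsDer.add {k : ℕ} {D E : Lambda V →ₗ[ℚ] Lambda V} (hD : IsDer k D) (hE : IsDer k E) :
    IsDer k (D + E) :=
  ⟨by simp [hD.one, hE.one], fun n v a => by
    simp only [LinearMap.add_apply]
    rw [hD.gen_mul, hE.gen_mul, add_mul, mul_add (gen n v), smul_add]; abel, fun a => by
    simp only [LinearMap.add_apply, map_add]
    rw [hD.parity, hE.parity, smul_add]⟩

theorem IsDer.congr_parity {k l : ℕ} {D : Lambda V →ₗ[ℚ] Lambda V} (hD : IsDer k D)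
    (h : Even k ↔ Even l) : IsDer l D :=
  ⟨hD.one, fun n v a => by
    rw [hD.gen_mul, neg_one_pow_eq_of_parity (a := k * (n + 1)) (b := l * (n + 1))]
    rw [Nat.even_mul, Nat.even_mul, h], fun a => by
    rw [hD.parity, neg_one_pow_eq_of_parity h]⟩

theorem IsDer.algebraMap {k : ℕ} {D : Lambda V →ₗ[ℚ] Lambda V} (hD : IsDer k D) (c : ℚ) :
    D (algebraMap ℚ (Lambda V) c) = 0 := by
  rw [Algebra.algebraMap_eq_smul_one, map_smul, hD.one, smul_zero]

/-- `parityPow k a` replaces the sign (-1)^{k |a|}, so that no homogeneity of a is needed. -/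
theorem IsDer.leibniz {k : ℕ} {D : Lambda V →ₗ[ℚ] Lambda V} (hD : IsDer k D) (a b : Lambda V) :
    D (a * b) = D a * b + parityPow k a * D b := by
  induction a using Lambda.induction with
  | one => simp [hD.one, parityPow_one]
  | add a a' ha hb => rw [add_mul, map_add, map_add, map_add, ha, hb]; noncomm_ring
  | smul r a ha =>
    rw [smul_mul_assoc, map_smul, map_smul, map_smul, ha, smul_mul_assoc, smul_mul_assoc, smul_add]
  | mul n v a ha =>
    rw [mul_assoc, hD.gen_mul, ha, hD.gen_mul, parityPow_gen_mul]
    simp only [mul_add, add_mul, smul_add, smul_mul_assoc, mul_assoc]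
    abel

theorem IsDer.leibniz_of_parity {k e : ℕ} {D : Lambda V →ₗ[ℚ] Lambda V} (hD : IsDer k D)
    {a : Lambda V} (ha : Lambda.parity a = (-1 : ℚ) ^ e • a) (b : Lambda V) :
    D (a * b) = D a * b + (-1 : ℚ) ^ (k * e) • (a * D b) := by
  rw [hD.leibniz, parityPow_eq_of_parity ha, smul_mul_assoc]

theorem IsDer.parityPow_comm {k : ℕ} {D : Lambda V →ₗ[ℚ] Lambda V} (hD : IsDer k D) (l : ℕ)
    (a : Lambda V) : parityPow l (D a) = (-1 : ℚ) ^ (k * l) • D (parityPow l a) := by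
  induction l with
  | zero => simp [parityPow_zero]
  | succ l ih =>
    rw [parityPow_succ, ih, map_smul, hD.parity, smul_smul, parityPow_succ, ← pow_add]
    congr 2

theorem IsDer.parity_gen {k : ℕ} {D : Lambda V →ₗ[ℚ] Lambda V} (hD : IsDer k D) (n : ℕ)
    (v : V n) : Lambda.parity (D (gen n v)) = (-1 : ℚ) ^ (n + 1 + k) • D (gen n v) := by
  rw [hD.parity, EnrichedLie.parity_gen, map_smul, smul_smul, ← pow_add]
  congr 2; ring

/-- The graded commutator of derivations is a derivation. -/
theorem IsDer.comm {k l : ℕ} {D E : Lambda V →ₗ[ℚ] Lambda V} (hD : IsDer k D) (hE : IsDer l E) :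
    IsDer (k + l) (D ∘ₗ E - (-1 : ℚ) ^ (k * l) • (E ∘ₗ D)) where
  one := by simp [hD.one, hE.one]
  gen_mul n v a := by
    simp only [LinearMap.sub_apply, LinearMap.smul_apply, LinearMap.comp_apply]
    rw [hD.gen_mul, hE.gen_mul, map_add, map_add, map_smul, map_smul, hD.gen_mul, hE.gen_mul,
      hD.leibniz_of_parity (hE.parity_gen n v), hE.leibniz_of_parity (hD.parity_gen n v)]
    have e1 : (-1 : ℚ) ^ (k * (n + 1 + l)) = (-1) ^ (k * l) * (-1) ^ (k * (n + 1)) := by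
      rw [← pow_add]; congr 1; ring
    have e2 : (-1 : ℚ) ^ (l * (n + 1 + k)) = (-1) ^ (k * l) * (-1) ^ (l * (n + 1)) := by
      rw [← pow_add]; congr 1; ring
    have e3 : (-1 : ℚ) ^ ((k + l) * (n + 1)) = (-1) ^ (k * (n + 1)) * (-1) ^ (l * (n + 1)) := by
      rw [← pow_add]; congr 1; ring
    have e4 : (-1 : ℚ) ^ (k * l) * (-1) ^ (k * l) = 1 := by
      rw [← pow_add]; exact Even.neg_one_pow ⟨_, rfl⟩
    rw [e1, e2, e3]
    generalize (-1 : ℚ) ^ (k * l) = s at e4 ⊢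
    simp only [sub_mul, mul_sub, smul_sub, smul_add, smul_smul, smul_mul_assoc, mul_smul_comm]
    have e5 : s * (s * (-1) ^ (l * (n + 1))) = (-1 : ℚ) ^ (l * (n + 1)) := by
      rw [← mul_assoc, e4, one_mul]
    rw [e5]
    module
  parity a := by
    simp only [LinearMap.sub_apply, LinearMap.smul_apply, LinearMap.comp_apply, map_sub, map_smul]
    rw [hD.parity, hE.parity, hE.parity, hD.parity, map_smul, map_smul, smul_smul, smul_sub, ← pow_add,
      smul_smul, smul_smul, smul_smul, ← pow_add, ← pow_add, ← pow_add]
    congr 3; ring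

/-- Derivations with prescribed values on the generators. -/
theorem IsDer.exists_of_gen (k : ℕ) (f : ∀ n, V n →ₗ[ℚ] Lambda V)
    (hf : ∀ m n (v : V m) (w : V n),
      f m v * gen n w = (-1 : ℚ) ^ ((m + 1 + k) * (n + 1)) • (gen n w * f m v))
    (hp : ∀ n (v : V n), Lambda.parity (f n v) = (-1 : ℚ) ^ (n + 1 + k) • f n v) :
    ∃ D : Lambda V →ₗ[ℚ] Lambda V, IsDer k D ∧ ∀ n v, D (gen n v) = f n v := by
  obtain ⟨D, h1, h2⟩ := Lambda.exists_signOp k (fun n => (LinearMap.mul ℚ (Lambda V)) ∘ₗ f n)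
    (fun m n v w a => by
      simp only [LinearMap.comp_apply, LinearMap.mul_apply', ← mul_assoc]
      have h1 := hf m n v w
      have h2 := hf n m w v
      have h3 : gen m v * f n w = (-1 : ℚ) ^ ((m + 1) * (n + 1 + k)) • (f n w * gen m v) := by
        rw [h2, smul_smul, ← pow_add, mul_comm (m + 1), Even.neg_one_pow ⟨_, rfl⟩, one_smul]
      rw [h1, h3]
      simp only [smul_mul_assoc, smul_add, smul_smul, ← pow_add]
      rw [add_comm]
      congr 2
      · apply neg_one_pow_eq_of_parity; simp only [Nat.even_add, Nat.even_mul, Nat.not_even_one]; tauto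
      · congr 1; ring) 0
  have h3 : ∀ n v, D (gen n v) = f n v := fun n v => by
    have := h2 n v 1
    simpa [h1] using this
  refine ⟨D, ⟨h1, fun n v a => ?_, fun a => ?_⟩, h3⟩
  · rw [h2, h3]; rfl
  · refine LinearMap.congr_fun (f := Lambda.parity ∘ₗ D) (g := (-1 : ℚ) ^ k • (D ∘ₗ Lambda.parity))
      (Lambda.ext ?_ fun n v a h => ?_) a
    · simp [h1, parity_one]
    · simp only [LinearMap.comp_apply, LinearMap.smul_apply] at h ⊢
      rw [h2, parity_gen_mul, map_smul, h2, map_add, map_smul, parity_gen_mul, h]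
      simp only [LinearMap.comp_apply, LinearMap.mul_apply', parity_mul, hp, smul_add, smul_smul, smul_mul_assoc, mul_smul_comm, ← pow_add]
      congr 2
      · congr 1; ring
      · congr 1; ring

end LambdaCalculus
end EnrichedLie
end

/-! ### Word length in ΛV, and contractions as a test for vanishing. -/

noncomputable section
namespace EnrichedLie

section WordLength

variable {V : ℕ → Type u} [∀ n, AddCommGroup (V n)] [∀ n, Module ℚ (V n)]

/-! ## Word length, augmentation and contractions -/

theorem Lambda.exists_augmentation : ∃ D : Lambda V →ₗ[ℚ] ℚ, D 1 = 1 ∧ ∀ n (v : V n) a,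
    D (gen n v * a) = 0 := by
  obtain ⟨D, h1, h2⟩ := Lambda.exists_op (V := V) (P := ℚ) 0 0 (by intros; simp) (by intros; simp) 1
  exact ⟨D, h1, fun n v a => by simpa using h2 n v a⟩

/-- The augmentation `ΛV → ℚ`. -/
def Lambda.aug : Lambda V →ₗ[ℚ] ℚ := Lambda.exists_augmentation.choose

theorem aug_one : Lambda.aug (1 : Lambda V) = 1 := Lambda.exists_augmentation.choose_spec.1

theorem aug_gen_mul (n : ℕ) (v : V n) (a : Lambda V) : Lambda.aug (gen n v * a) = 0 :=
  Lambda.exists_augmentation.choose_spec.2 n v a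

theorem aug_algebraMap (c : ℚ) : Lambda.aug (algebraMap ℚ (Lambda V) c) = c := by
  rw [Algebra.algebraMap_eq_smul_one, map_smul, aug_one, smul_eq_mul, mul_one]

theorem aug_parityPow (k : ℕ) (a : Lambda V) : Lambda.aug (parityPow k a) = Lambda.aug a := by
  refine LinearMap.congr_fun (f := Lambda.aug ∘ₗ parityPow k) (g := Lambda.aug)
    (Lambda.ext ?_ fun n v a _ => ?_) a
  · simp [parityPow_one]
  · simp [parityPow_gen_mul, aug_gen_mul]

/-- `Λ^k V`. -/
def wordLength (V : ℕ → Type u) [∀ n, AddCommGroup (V n)] [∀ n, Module ℚ (V n)] :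
    ℕ → Submodule ℚ (Lambda V)
  | 0 => Submodule.span ℚ {1}
  | k + 1 => Submodule.span ℚ {b | ∃ n, ∃ v : V n, ∃ a ∈ wordLength V k, b = gen n v * a}

theorem gen_mul_mem_wordLength {k n : ℕ} (v : V n) {a : Lambda V} (ha : a ∈ wordLength V k) :
    gen n v * a ∈ wordLength V (k + 1) := Submodule.subset_span ⟨n, v, a, ha, rfl⟩

theorem one_mem_wordLength : (1 : Lambda V) ∈ wordLength V 0 := Submodule.subset_span rfl

theorem gen_mem_wordLength {n : ℕ} (v : V n) : gen n v ∈ wordLength V 1 := by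
  simpa using gen_mul_mem_wordLength v one_mem_wordLength

theorem gen_mul_gen_mem_wordLength {m n : ℕ} (v : V m) (w : V n) :
    gen m v * gen n w ∈ wordLength V 2 := gen_mul_mem_wordLength v (gen_mem_wordLength w)

theorem mem_wordLength_zero {a : Lambda V} (ha : a ∈ wordLength V 0) :
    a = algebraMap ℚ (Lambda V) (Lambda.aug a) := by
  obtain ⟨c, rfl⟩ := Submodule.mem_span_singleton.1 ha
  rw [map_smul, aug_one, smul_eq_mul, mul_one, Algebra.algebraMap_eq_smul_one]

theorem wordLength_succ_induction {k : ℕ} {p : Lambda V → Prop}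
    (mul : ∀ n (v : V n) a, a ∈ wordLength V k → p (gen n v * a)) (zero : p 0)
    (add : ∀ a b, p a → p b → p (a + b)) (smul : ∀ (c : ℚ) a, p a → p (c • a))
    {a : Lambda V} (ha : a ∈ wordLength V (k + 1)) : p a := by
  refine Submodule.span_induction (p := fun a _ => p a) ?_ zero (fun a b _ _ => add a b)
    (fun c a _ => smul c a) ha
  rintro _ ⟨n, v, a, ha, rfl⟩
  exact mul n v a ha

theorem wordLength_one_induction {p : Lambda V → Prop}
    (gen : ∀ n (v : V n), p (gen n v)) (zero : p 0)
    (add : ∀ a b, p a → p b → p (a + b)) (smul : ∀ (c : ℚ) a, p a → p (c • a))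
    {a : Lambda V} (ha : a ∈ wordLength V 1) : p a := by
  refine wordLength_succ_induction (fun n v a ha => ?_) zero add smul ha
  obtain ⟨c, rfl⟩ := Submodule.mem_span_singleton.1 ha
  rw [mul_smul_comm, mul_one]
  exact smul c _ (gen n v)

theorem eq_of_mem_wordLength_one {P : Type w} [AddCommGroup P] [Module ℚ P]
    {f g : Lambda V →ₗ[ℚ] P} (h : ∀ n (v : V n), f (gen n v) = g (gen n v))
    {a : Lambda V} (ha : a ∈ wordLength V 1) : f a = g a :=
  wordLength_one_induction (p := fun a => f a = g a) h (by simp)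
    (fun a b ha hb => by rw [map_add, map_add, ha, hb])
    (fun c a ha => by rw [map_smul, map_smul, ha]) ha

theorem eq_of_mem_wordLength_two {P : Type w} [AddCommGroup P] [Module ℚ P]
    {f g : Lambda V →ₗ[ℚ] P}
    (h : ∀ m n (v : V m) (w : V n), f (gen m v * gen n w) = g (gen m v * gen n w))
    {a : Lambda V} (ha : a ∈ wordLength V 2) : f a = g a :=
  wordLength_succ_induction (p := fun a => f a = g a)
    (fun m v a ha => eq_of_mem_wordLength_one (f := f ∘ₗ LinearMap.mulLeft ℚ (gen m v))
      (g := g ∘ₗ LinearMap.mulLeft ℚ (gen m v)) (fun n w => h m n v w) ha)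
    (by simp) (fun a b ha hb => by rw [map_add, map_add, ha, hb])
    (fun c a ha => by rw [map_smul, map_smul, ha]) ha

/-- All components are built at once, as a map to sequences on which a generator acts by
multiplication followed by a shift. -/
theorem Lambda.exists_components : ∃ D : Lambda V →ₗ[ℚ] (ℕ → Lambda V), D 1 = Pi.single 0 1 ∧
    (∀ n (v : V n) a, D (gen n v * a) 0 = 0) ∧ ∀ n (v : V n) a k, D (gen n v * a) (k + 1) = gen n v * D a k := by
  let S : ∀ n, V n →ₗ[ℚ] Module.End ℚ (ℕ → Lambda V) := fun n => LinearMap.mk₂ ℚ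
    (fun v x k => Nat.casesOn k 0 fun k => gen n v * x k)
    (fun v w x => by ext k; cases k <;> simp [add_mul])
    (fun c v x => by ext k; cases k <;> simp)
    (fun v x y => by ext k; cases k <;> simp [mul_add])
    (fun c v x => by ext k; cases k <;> simp)
  have hS0 : ∀ n v x, S n v x 0 = 0 := fun _ _ _ => rfl
  have hS1 : ∀ n v x k, S n v x (k + 1) = gen n v * x k := fun _ _ _ _ => rfl
  obtain ⟨D, h1, h2⟩ := Lambda.exists_op (V := V) S 0 (fun m n v w x => by
    funext k
    rw [Pi.smul_apply]
    rcases k with _ | _ | k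
    · rw [hS0, hS0, smul_zero]
    · rw [hS1, hS1, hS0, hS0]; simp
    · rw [hS1, hS1, hS1, hS1, ← mul_assoc, gen_comm, smul_mul_assoc, mul_assoc]) (by intros; simp) (Pi.single 0 1)
  refine ⟨D, h1, fun n v a => ?_, fun n v a k => ?_⟩ <;> rw [h2] <;> simp [S]

/-- The component of word length `k`. -/
def component (k : ℕ) : Lambda V →ₗ[ℚ] Lambda V :=
  LinearMap.proj k ∘ₗ Lambda.exists_components.choose

theorem component_zero_one : component 0 (1 : Lambda V) = 1 := by
  rw [component, LinearMap.comp_apply, Lambda.exists_components.choose_spec.1]; simp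

theorem component_succ_one (k : ℕ) : component (k + 1) (1 : Lambda V) = 0 := by
  rw [component, LinearMap.comp_apply, Lambda.exists_components.choose_spec.1]; simp

theorem component_zero_gen_mul (n : ℕ) (v : V n) (a : Lambda V) :
    component 0 (gen n v * a) = 0 := Lambda.exists_components.choose_spec.2.1 n v a

theorem component_succ_gen_mul (k n : ℕ) (v : V n) (a : Lambda V) :
    component (k + 1) (gen n v * a) = gen n v * component k a :=
  Lambda.exists_components.choose_spec.2.2 n v a k

theorem component_mem (k : ℕ) (a : Lambda V) : component k a ∈ wordLength V k := by
  induction a using Lambda.induction generalizing k with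
  | one =>
    cases k
    · rw [component_zero_one]; exact one_mem_wordLength
    · rw [component_succ_one]; exact zero_mem _
  | add a b ha hb => rw [map_add]; exact add_mem (ha k) (hb k)
  | smul c a ha => rw [map_smul]; exact Submodule.smul_mem _ _ (ha k)
  | mul n v a ha =>
    cases k
    · rw [component_zero_gen_mul]; exact zero_mem _
    · rw [component_succ_gen_mul]; exact gen_mul_mem_wordLength v (ha _)

theorem component_of_mem (k : ℕ) : ∀ {l : ℕ} {a : Lambda V}, a ∈ wordLength V l →
    component k a = if k = l then a else 0 := by
  induction k with
  | zero =>
    intro l a ha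
    cases l with
    | zero =>
      obtain ⟨c, rfl⟩ := Submodule.mem_span_singleton.1 ha
      simp [component_zero_one]
    | succ l =>
      refine wordLength_succ_induction (p := fun a => component 0 a = if 0 = l + 1 then a else 0)
        (fun n v a _ => ?_) ?_ (fun a b ha hb => ?_) (fun c a ha => ?_) ha
      · simp [component_zero_gen_mul]
      · simp
      · simp_all
      · simp_all
  | succ k ih =>
    intro l a ha
    cases l with
    | zero =>
      obtain ⟨c, rfl⟩ := Submodule.mem_span_singleton.1 ha
      simp [component_succ_one]
    | succ l =>
      refine wordLength_succ_induction (p := fun a => component (k + 1) a = if k + 1 = l + 1 then a else 0)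
        (fun n v a ha => ?_) ?_ (fun a b ha hb => ?_) (fun c a ha => ?_) ha
      · rw [component_succ_gen_mul, ih ha]
        simp only [Nat.add_right_cancel_iff]
        split_ifs <;> simp
      · simp
      · rw [map_add, ha, hb]; split_ifs <;> simp
      · rw [map_smul, ha]; split_ifs <;> simp

theorem exists_sum_component (a : Lambda V) : ∃ N, ∀ M, N ≤ M →
    a = ∑ k ∈ Finset.range M, component k a := by
  induction a using Lambda.induction with
  | one =>
    refine ⟨1, fun M hM => ?_⟩
    obtain ⟨M, rfl⟩ := Nat.exists_eq_add_of_le' hM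
    rw [Finset.sum_range_succ']
    simp [component_zero_one, component_succ_one]
  | add a b ha hb =>
    obtain ⟨N, hN⟩ := ha
    obtain ⟨N', hN'⟩ := hb
    refine ⟨max N N', fun M hM => ?_⟩
    simp only [map_add, Finset.sum_add_distrib]
    rw [← hN M (le_trans (le_max_left _ _) hM), ← hN' M (le_trans (le_max_right _ _) hM)]
  | smul c a ha =>
    obtain ⟨N, hN⟩ := ha
    refine ⟨N, fun M hM => ?_⟩
    simp only [map_smul, ← Finset.smul_sum]
    rw [← hN M hM]
  | mul n v a ha =>
    obtain ⟨N, hN⟩ := ha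
    refine ⟨N + 1, fun M hM => ?_⟩
    obtain ⟨M, rfl⟩ := Nat.exists_eq_add_of_le' (le_trans (Nat.le_add_left 1 N) hM)
    rw [Finset.sum_range_succ']
    simp only [component_succ_gen_mul, component_zero_gen_mul, add_zero, ← Finset.mul_sum]
    rw [← hN M (by omega)]

theorem component_two_mul_left (k : ℕ) {z : Lambda V} (hz : z ∈ wordLength V 2) (a : Lambda V) :
    component (k + 2) (z * a) = z * component k a := by
  refine eq_of_mem_wordLength_two (f := component (k + 2) ∘ₗ LinearMap.mulRight ℚ a)
    (g := LinearMap.mulRight ℚ (component k a)) (fun m n v w => ?_) hz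
  simp only [LinearMap.comp_apply, LinearMap.mulRight_apply, mul_assoc]
  rw [component_succ_gen_mul, component_succ_gen_mul]

theorem component_one_two_mul_left {z : Lambda V} (hz : z ∈ wordLength V 2) (a : Lambda V) :
    component 1 (z * a) = 0 := by
  refine eq_of_mem_wordLength_two (f := component 1 ∘ₗ LinearMap.mulRight ℚ a)
    (g := 0) (fun m n v w => ?_) hz
  simp only [LinearMap.comp_apply, LinearMap.mulRight_apply, mul_assoc]
  rw [component_succ_gen_mul, component_zero_gen_mul, mul_zero, LinearMap.zero_apply]

theorem component_zero_two_mul_left {z : Lambda V} (hz : z ∈ wordLength V 2) (a : Lambda V) :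
    component 0 (z * a) = 0 := by
  refine eq_of_mem_wordLength_two (f := component 0 ∘ₗ LinearMap.mulRight ℚ a)
    (g := 0) (fun m n v w => ?_) hz
  simp only [LinearMap.comp_apply, LinearMap.mulRight_apply, mul_assoc]
  rw [component_zero_gen_mul, LinearMap.zero_apply]

/-- A quadratic derivation raises the word length by one. -/
theorem IsDer.component_comm {k : ℕ} {d : Lambda V →ₗ[ℚ] Lambda V} (hd : IsDer k d)
    (hd2 : ∀ n (v : V n), d (gen n v) ∈ wordLength V 2) (a : Lambda V) :
    component 0 (d a) = 0 ∧ ∀ l, component (l + 1) (d a) = d (component l a) := by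
  induction a using Lambda.induction with
  | one =>
    refine ⟨by rw [hd.one, map_zero], fun l => ?_⟩
    cases l
    · rw [component_zero_one, hd.one, map_zero]
    · rw [component_succ_one, hd.one, map_zero, map_zero]
  | add a b ha hb =>
    exact ⟨by rw [map_add, map_add, ha.1, hb.1, add_zero], fun l => by
      rw [map_add, map_add, map_add, map_add, ha.2, hb.2]⟩
  | smul c a ha =>
    exact ⟨by rw [map_smul, map_smul, ha.1, smul_zero], fun l => by
      rw [map_smul, map_smul, map_smul, map_smul, ha.2]⟩
  | mul n v a ha =>
    rw [hd.gen_mul]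
    refine ⟨?_, fun l => ?_⟩
    · rw [map_add, map_smul, component_zero_gen_mul, component_zero_two_mul_left (hd2 n v)]; simp
    · rw [map_add, map_smul, component_succ_gen_mul]
      cases l with
      | zero => rw [component_one_two_mul_left (hd2 n v), ha.1, component_zero_gen_mul]; simp
      | succ l =>
        rw [component_two_mul_left _ (hd2 n v), ha.2, component_succ_gen_mul, hd.gen_mul]

theorem IsDer.mem_wordLength {k : ℕ} {d : Lambda V →ₗ[ℚ] Lambda V} (hd : IsDer k d)
    (hd2 : ∀ n (v : V n), d (gen n v) ∈ wordLength V 2) {l : ℕ} {a : Lambda V}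
    (ha : a ∈ wordLength V l) : d a ∈ wordLength V (l + 1) := by
  have h1 : component l a = a := by rw [component_of_mem l ha, if_pos rfl]
  rw [← h1, ← (hd.component_comm hd2 a).2 l]
  exact component_mem _ _

/-- A derivation with values of word length one on generators preserves the word length. -/
theorem IsDer.mem_wordLength_of_one {k : ℕ} {d : Lambda V →ₗ[ℚ] Lambda V} (hd : IsDer k d)
    (hd1 : ∀ n (v : V n), d (gen n v) ∈ wordLength V 1) {l : ℕ} {a : Lambda V}
    (ha : a ∈ wordLength V l) : d a ∈ wordLength V l := by
  induction l generalizing a with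
  | zero =>
    rw [mem_wordLength_zero ha, hd.algebraMap]; exact zero_mem _
  | succ l ih =>
    refine wordLength_succ_induction (p := fun a => d a ∈ wordLength V (l + 1))
      (fun n v a ha => ?_) (by simp) (fun a b ha hb => by rw [map_add]; exact add_mem ha hb)
      (fun c a ha => by rw [map_smul]; exact Submodule.smul_mem _ _ ha) ha
    rw [hd.gen_mul]
    refine add_mem ?_ (Submodule.smul_mem _ _ (gen_mul_mem_wordLength v (ih ha)))
    refine wordLength_one_induction (p := fun b => b * a ∈ wordLength V (l + 1))
      (fun n v => gen_mul_mem_wordLength v ha) (by simp)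
      (fun a b ha hb => by rw [add_mul]; exact add_mem ha hb)
      (fun c a ha => by rw [smul_mul_assoc]; exact Submodule.smul_mem _ _ ha) (hd1 n v)

theorem exists_contraction (p : ℕ) (ξ : Module.Dual ℚ (V p)) :
    ∃ D : Lambda V →ₗ[ℚ] Lambda V, IsDer (p + 1) D ∧ ∀ n v, D (gen n v) =
      algebraMap ℚ (Lambda V) (Pi.single (M := fun n => Module.Dual ℚ (V n)) p ξ n v) := by
  obtain ⟨D, h, h'⟩ := IsDer.exists_of_gen (p + 1)
    (fun n => Algebra.linearMap ℚ (Lambda V) ∘ₗ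
      Pi.single (M := fun n => Module.Dual ℚ (V n)) p ξ n)
    (fun m n v w => by
      simp only [LinearMap.comp_apply, Algebra.linearMap_apply]
      by_cases h : m = p
      · subst h
        rw [Algebra.commutes, Even.neg_one_pow, one_smul]
        simp
      · rw [Pi.single_eq_of_ne h]; simp)
    (fun n v => by
      simp only [LinearMap.comp_apply, Algebra.linearMap_apply]
      by_cases h : n = p
      · subst h
        rw [Even.neg_one_pow ⟨n + 1, rfl⟩, one_smul, Algebra.algebraMap_eq_smul_one, map_smul,
          parity_one]
      · rw [Pi.single_eq_of_ne h]; simp)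
  exact ⟨D, h, h'⟩

/-- The contraction by a linear form on `V p`. -/
def contraction (p : ℕ) : Module.Dual ℚ (V p) →ₗ[ℚ] Module.End ℚ (Lambda V) where
  toFun := fun ξ => (exists_contraction p ξ).choose
  map_add' := fun ξ η => by
    refine IsDer.ext (exists_contraction p (ξ + η)).choose_spec.1
      ((exists_contraction p ξ).choose_spec.1.add (exists_contraction p η).choose_spec.1)
      fun n v => ?_
    rw [LinearMap.add_apply, (exists_contraction p (ξ + η)).choose_spec.2,
      (exists_contraction p ξ).choose_spec.2, (exists_contraction p η).choose_spec.2, ← map_add,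
      Pi.single_add]
    rfl
  map_smul' := fun c ξ => by
    refine IsDer.ext (exists_contraction p (c • ξ)).choose_spec.1
      ((exists_contraction p ξ).choose_spec.1.smul c) fun n v => ?_
    rw [LinearMap.smul_apply, (exists_contraction p (c • ξ)).choose_spec.2,
      (exists_contraction p ξ).choose_spec.2, Pi.single_smul, Pi.smul_apply, LinearMap.smul_apply,
      smul_eq_mul, map_mul, Algebra.smul_def]
    rfl

theorem contraction_isDer (p : ℕ) (ξ : Module.Dual ℚ (V p)) : IsDer (p + 1) (contraction p ξ) :=
  (exists_contraction p ξ).choose_spec.1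

theorem contraction_gen (p : ℕ) (ξ : Module.Dual ℚ (V p)) (n : ℕ) (v : V n) :
    contraction p ξ (gen n v) =
      algebraMap ℚ (Lambda V) (Pi.single (M := fun n => Module.Dual ℚ (V n)) p ξ n v) :=
  (exists_contraction p ξ).choose_spec.2 n v

theorem contraction_gen_self (p : ℕ) (ξ : Module.Dual ℚ (V p)) (v : V p) :
    contraction p ξ (gen p v) = algebraMap ℚ (Lambda V) (ξ v) := by
  rw [contraction_gen, Pi.single_eq_same]

theorem contraction_gen_ne {p n : ℕ} (h : n ≠ p) (ξ : Module.Dual ℚ (V p)) (v : V n) :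
    contraction p ξ (gen n v) = 0 := by
  rw [contraction_gen, Pi.single_eq_of_ne h]; simp

theorem contraction_mem {p k : ℕ} (ξ : Module.Dual ℚ (V p)) {a : Lambda V}
    (ha : a ∈ wordLength V (k + 1)) : contraction p ξ a ∈ wordLength V k := by
  induction k generalizing a with
  | zero =>
    refine wordLength_one_induction (p := fun a => contraction p ξ a ∈ wordLength V 0)
      (fun n v => ?_) (by simp) (fun a b ha hb => by rw [map_add]; exact add_mem ha hb)
      (fun c a ha => by rw [map_smul]; exact Submodule.smul_mem _ _ ha) ha
    rw [contraction_gen, Algebra.algebraMap_eq_smul_one]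
    exact Submodule.smul_mem _ _ one_mem_wordLength
  | succ k ih =>
    refine wordLength_succ_induction (p := fun a => contraction p ξ a ∈ wordLength V (k + 1))
      (fun n v a ha => ?_) (by simp) (fun a b ha hb => by rw [map_add]; exact add_mem ha hb)
      (fun c a ha => by rw [map_smul]; exact Submodule.smul_mem _ _ ha) ha
    rw [(contraction_isDer p ξ).gen_mul, contraction_gen, ← Algebra.smul_def]
    exact add_mem (Submodule.smul_mem _ _ ha)
      (Submodule.smul_mem _ _ (gen_mul_mem_wordLength v (ih ha)))

/-- The graded commutator of two contractions is a derivation, and it kills generators because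
contractions send them to scalars. -/
theorem contraction_comm (p q : ℕ) (ξ : Module.Dual ℚ (V p)) (η : Module.Dual ℚ (V q))
    (a : Lambda V) : contraction p ξ (contraction q η a) =
      (-1 : ℚ) ^ ((p + 1) * (q + 1)) • contraction q η (contraction p ξ a) := by
  have h := IsDer.ext ((contraction_isDer p ξ).comm (contraction_isDer q η)) (IsDer.zero _)
    fun n v => by
      simp only [LinearMap.sub_apply, LinearMap.smul_apply, LinearMap.comp_apply, contraction_gen,
        (contraction_isDer _ _).algebraMap]
      simp
  have h2 := LinearMap.congr_fun h a
  simpa [sub_eq_zero] using h2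

theorem exists_wordLengthDer : ∃ D : Lambda V →ₗ[ℚ] Lambda V, IsDer 0 D ∧
    ∀ n v, D (gen n v) = gen n v :=
  IsDer.exists_of_gen 0 gen (fun m n v w => by rw [gen_comm]) (fun n v => parity_gen n v)

theorem IsDer.eq_natCast_smul {D : Lambda V →ₗ[ℚ] Lambda V} (hD : IsDer 0 D)
    (h : ∀ n v, D (gen n v) = gen n v) {k : ℕ} {a : Lambda V} (ha : a ∈ wordLength V k) :
    D a = (k : ℚ) • a := by
  induction k generalizing a with
  | zero => rw [mem_wordLength_zero ha, hD.algebraMap, Nat.cast_zero, zero_smul]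
  | succ k ih =>
    refine wordLength_succ_induction (p := fun a => D a = ((k + 1 : ℕ) : ℚ) • a)
      (fun n v a ha => ?_) (by simp) (fun a b ha hb => by rw [map_add, ha, hb, smul_add])
      (fun c a ha => by rw [map_smul, ha, smul_comm]) ha
    rw [hD.gen_mul, h, ih ha]
    push_cast
    simp only [zero_mul, pow_zero, one_smul, mul_smul_comm]
    module

/-- Euler's formula. -/
theorem exists_euler {D : Lambda V →ₗ[ℚ] Lambda V} (hD : IsDer 0 D)
    (h : ∀ n v, D (gen n v) = gen n v) {ι : ℕ → Type w} (b : ∀ n, Module.Basis (ι n) ℚ (V n))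
    (a : Lambda V) : ∃ s₀ : Finset (Σ n, ι n), ∀ s, s₀ ⊆ s →
      ∑ r ∈ s, gen r.1 (b r.1 r.2) * contraction r.1 ((b r.1).coord r.2) a = D a := by
  classical
  induction a using Lambda.induction with
  | one => exact ⟨∅, fun s _ => by simp [(contraction_isDer _ _).one, hD.one]⟩
  | add a a' ha ha' =>
    obtain ⟨s, hs⟩ := ha
    obtain ⟨s', hs'⟩ := ha'
    refine ⟨s ∪ s', fun t ht => ?_⟩
    simp only [map_add, mul_add, Finset.sum_add_distrib]
    rw [hs t (Finset.union_subset_left ht), hs' t (Finset.union_subset_right ht)]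
  | smul c a ha =>
    obtain ⟨s, hs⟩ := ha
    refine ⟨s, fun t ht => ?_⟩
    simp only [map_smul, mul_smul_comm, ← Finset.smul_sum]
    rw [hs t ht]
  | mul n v a ha =>
    obtain ⟨s, hs⟩ := ha
    -- The Euler sum over an infinite basis is eventually constant: it must contain the terms needed
    -- for a and the basis vectors that occur in v.
    refine ⟨s ∪ ((b n).repr v).support.map ⟨Sigma.mk n, sigma_mk_injective⟩, fun t ht => ?_⟩
    have h1 : ∑ r ∈ t, gen r.1 (b r.1 r.2) * contraction r.1 ((b r.1).coord r.2) (gen n v) =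
        gen n v := by
      rw [← Finset.sum_subset (Finset.union_subset_right ht), Finset.sum_map]
      · conv_rhs => rw [← (b n).linearCombination_repr v, Finsupp.linearCombination_apply,
          Finsupp.sum, map_sum]
        refine Finset.sum_congr rfl fun i _ => ?_
        change gen n (b n i) * contraction n ((b n).coord i) (gen n v) = _
        rw [contraction_gen_self, ← Algebra.commutes, ← Algebra.smul_def, map_smul]
        rfl
      · rintro ⟨m, i⟩ _ hr
        by_cases hm : n = m
        · subst hm
          have : (b n).coord i v = 0 := by
            by_contra hne
            exact hr (Finset.mem_map.2 ⟨i, Finsupp.mem_support_iff.2 hne, rfl⟩)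
          simp only
          rw [contraction_gen_self, this, map_zero, mul_zero]
        · simp only
          rw [contraction_gen_ne hm, mul_zero]
    rw [hD.gen_mul, h, ← hs t (Finset.union_subset_left ht), Finset.mul_sum]
    nth_rw 2 [← h1]
    rw [Finset.sum_mul, Finset.smul_sum, ← Finset.sum_add_distrib]
    refine Finset.sum_congr rfl fun r _ => ?_
    rw [(contraction_isDer _ _).gen_mul, mul_add, mul_assoc, mul_smul_comm, ← mul_assoc,
      ← mul_assoc (gen n v), gen_comm n, smul_mul_assoc]
    simp [mul_comm, mul_assoc]

/-- An element of positive word length is zero if its contractions by a separating family vanish. -/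
theorem eq_zero_of_contraction {X : ∀ n, Set (Module.Dual ℚ (V n))}
    (hX : ∀ n (v : V n), (∀ ξ ∈ X n, ξ v = 0) → v = 0) {k : ℕ} {a : Lambda V}
    (ha : a ∈ wordLength V (k + 1)) (h : ∀ p, ∀ ξ ∈ X p, contraction p ξ a = 0) : a = 0 := by
  induction k generalizing a with
  | zero =>
    obtain ⟨x, rfl⟩ : ∃ x : ⨁ n, V n, DirectSum.toModule ℚ ℕ (Lambda V) gen x = a := by
      refine wordLength_one_induction (p := fun a => ∃ x : ⨁ n, V n,
        DirectSum.toModule ℚ ℕ (Lambda V) gen x = a) (fun n v => ?_) ⟨0, map_zero _⟩ ?_ ?_ ha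
      · exact ⟨DirectSum.lof ℚ ℕ V n v, DirectSum.toModule_lof ..⟩
      · rintro _ _ ⟨x, rfl⟩ ⟨y, rfl⟩; exact ⟨x + y, map_add ..⟩
      · rintro c _ ⟨x, rfl⟩; exact ⟨c • x, map_smul ..⟩
    have key : ∀ (x : ⨁ n, V n) p (ξ : Module.Dual ℚ (V p)),
        contraction p ξ (DirectSum.toModule ℚ ℕ (Lambda V) gen x) =
          algebraMap ℚ (Lambda V) (ξ (x p)) := by
      intro x p ξ
      induction x using DirectSum.induction_on with
      | zero => simp
      | of n v =>
        rw [← DirectSum.lof_eq_of ℚ, DirectSum.toModule_lof]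
        by_cases hn : n = p
        · subst hn; rw [contraction_gen_self, DirectSum.lof_apply]
        · rw [contraction_gen_ne hn, DirectSum.lof_eq_of, DirectSum.of_eq_of_ne _ _ _ (Ne.symm hn)]; simp
      | add x y hx hy =>
        rw [map_add, map_add, DirectSum.add_apply, map_add, map_add, hx, hy]
    have : x = 0 := by
      ext n
      refine hX n (x n) fun ξ hξ => ?_
      have := h n ξ hξ
      rw [key] at this
      simpa [aug_algebraMap] using congrArg Lambda.aug this
    rw [this, map_zero]
  | succ k ih =>
    obtain ⟨D, hD, hD'⟩ := exists_wordLengthDer (V := V)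
    -- Contractions commute up to sign, so for arbitrary ξ the element i_ξ a again satisfies the
    -- hypothesis, in length k + 1. Thus all contractions of a vanish, not only those of the
    -- separating family, and Euler's formula gives (k + 2) a = 0.
    have h0 : ∀ p (ξ : Module.Dual ℚ (V p)), contraction p ξ a = 0 := fun p ξ =>
      ih (contraction_mem ξ ha) fun q η hη => by
        rw [contraction_comm, h q η hη, map_zero, smul_zero]
    obtain ⟨s, hs⟩ := exists_euler hD hD' (fun n => Module.Basis.ofVectorSpace ℚ (V n)) a
    have h1 := hs s subset_rfl
    rw [hD.eq_natCast_smul hD' ha, Finset.sum_eq_zero fun r _ => by rw [h0, mul_zero]] at h1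
    exact (smul_eq_zero.1 h1.symm).resolve_left (Nat.cast_ne_zero.2 (Nat.succ_ne_zero _))

end WordLength
end EnrichedLie
end

/-! ### Cartan formulas for a quadratic differential dual to a Lie bracket. -/

noncomputable section
namespace EnrichedLie

section CartanCalculus

open GradedLie

variable {V : ℕ → Type u} [∀ n, AddCommGroup (V n)] [∀ n, Module ℚ (V n)]
variable {F : ℕ → Type w} [∀ n, AddCommGroup (F n)] [∀ n, Module ℚ (F n)]

/-! ## Cartan calculus on `ΛV` -/

/-- The contraction by an element of `F p`, for a pairing `e` of `F` with `V`. -/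
abbrev ctr (e : ∀ n, F n →ₗ[ℚ] Module.Dual ℚ (V n)) {p : ℕ} (x : F p) : Lambda V →ₗ[ℚ] Lambda V :=
  contraction p (e p x)

theorem ctr_add (e : ∀ n, F n →ₗ[ℚ] Module.Dual ℚ (V n)) {p : ℕ} (x y : F p) :
    ctr e (x + y) = ctr e x + ctr e y := by rw [ctr, map_add, map_add]

theorem ctr_smul (e : ∀ n, F n →ₗ[ℚ] Module.Dual ℚ (V n)) {p : ℕ} (c : ℚ) (x : F p) :
    ctr e (c • x) = c • ctr e x := by rw [ctr, map_smul, map_smul]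

/-- The Lie derivative along an element of `F p`. -/
def lieDer (e : ∀ n, F n →ₗ[ℚ] Module.Dual ℚ (V n)) (d : Lambda V →ₗ[ℚ] Lambda V) {p : ℕ}
    (x : F p) : Lambda V →ₗ[ℚ] Lambda V := d ∘ₗ ctr e x + (-1 : ℚ) ^ p • (ctr e x ∘ₗ d)

theorem lieDer_apply (e : ∀ n, F n →ₗ[ℚ] Module.Dual ℚ (V n)) (d : Lambda V →ₗ[ℚ] Lambda V) {p : ℕ}
    (x : F p) (a : Lambda V) : lieDer e d x a = d (ctr e x a) + (-1 : ℚ) ^ p • ctr e x (d a) := rfl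

theorem lieDer_add (e : ∀ n, F n →ₗ[ℚ] Module.Dual ℚ (V n)) (d : Lambda V →ₗ[ℚ] Lambda V) {p : ℕ}
    (x y : F p) : lieDer e d (x + y) = lieDer e d x + lieDer e d y := by
  ext a; simp only [lieDer_apply, ctr_add, map_add, LinearMap.add_apply]; module

theorem lieDer_smul (e : ∀ n, F n →ₗ[ℚ] Module.Dual ℚ (V n)) (d : Lambda V →ₗ[ℚ] Lambda V) {p : ℕ}
    (c : ℚ) (x : F p) : lieDer e d (c • x) = c • lieDer e d x := by
  ext a; simp only [lieDer_apply, ctr_smul, map_smul, LinearMap.smul_apply]; module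

variable [GradedLie F]

/-- `d` is a quadratic differential on `ΛV` dual to the bracket of `F`, for a pairing `e` of `F` with
`V` that separates the elements of `V`. -/
structure IsCE (e : ∀ n, F n →ₗ[ℚ] Module.Dual ℚ (V n)) (d : Lambda V →ₗ[ℚ] Lambda V) : Prop where
  der : IsDer 1 d
  quadratic : ∀ n (v : V n), d (gen n v) ∈ wordLength V 2
  separating : ∀ n (v : V n), (∀ x, e n x v = 0) → v = 0
  bracket : ∀ {p q n} (h : p + q = n) (x : F p) (y : F q) (v : V n),
    Lambda.aug (ctr e y (ctr e x (d (gen n v)))) = (-1 : ℚ) ^ (p * q + p) * e n (br h x y) v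
  bracket_ne : ∀ {p q n} (_ : p + q ≠ n) (x : F p) (y : F q) (v : V n),
    Lambda.aug (ctr e y (ctr e x (d (gen n v)))) = 0

namespace IsCE

variable {e : ∀ n, F n →ₗ[ℚ] Module.Dual ℚ (V n)} {d : Lambda V →ₗ[ℚ] Lambda V}

theorem eq_of_ctr (hd : IsCE e d) {k : ℕ} {a b : Lambda V} (ha : a ∈ wordLength V (k + 1))
    (hb : b ∈ wordLength V (k + 1)) (h : ∀ p (x : F p), ctr e x a = ctr e x b) : a = b := by
  rw [← sub_eq_zero]
  refine eq_zero_of_contraction (X := fun n => Set.range (e n))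
    (fun n v hv => hd.separating n v fun x => hv _ ⟨x, rfl⟩) (sub_mem ha hb) ?_
  rintro p _ ⟨x, rfl⟩
  rw [map_sub, sub_eq_zero]
  exact h p x

theorem eq_of_one (hd : IsCE e d) {a b : Lambda V} (ha : a ∈ wordLength V 1)
    (hb : b ∈ wordLength V 1)
    (h : ∀ p (x : F p), Lambda.aug (ctr e x a) = Lambda.aug (ctr e x b)) : a = b :=
  hd.eq_of_ctr ha hb fun p x => by
    rw [mem_wordLength_zero (contraction_mem _ ha), mem_wordLength_zero (contraction_mem _ hb), h]

theorem eq_of_two (hd : IsCE e d) {a b : Lambda V} (ha : a ∈ wordLength V 2)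
    (hb : b ∈ wordLength V 2) (h : ∀ p q (x : F p) (y : F q),
      Lambda.aug (ctr e y (ctr e x a)) = Lambda.aug (ctr e y (ctr e x b))) : a = b :=
  hd.eq_of_ctr ha hb fun p x => hd.eq_of_one (contraction_mem _ ha) (contraction_mem _ hb)
    fun q y => h p q x y

theorem lieDer_isDer (hd : IsCE e d) {p : ℕ} (x : F p) : IsDer p (lieDer e d x) := by
  have h := (hd.der.comm (contraction_isDer p (e p x))).congr_parity (l := p) (by
    simp [Nat.even_add, Nat.even_add_one])
  convert h using 1
  ext a
  rw [lieDer_apply, one_mul, pow_succ]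
  simp

theorem lieDer_mem (hd : IsCE e d) {p k : ℕ} (x : F p) {a : Lambda V} (ha : a ∈ wordLength V k) :
    lieDer e d x a ∈ wordLength V k := by
  refine (hd.lieDer_isDer x).mem_wordLength_of_one (fun n v => ?_) ha
  rw [lieDer_apply, contraction_gen, hd.der.algebraMap, zero_add]
  exact Submodule.smul_mem _ _ (contraction_mem _ (hd.quadratic n v))

theorem aug_der_one {k : ℕ} {D : Lambda V →ₗ[ℚ] Lambda V} (hD : IsDer k D)
    (h1 : ∀ n (v : V n), D (gen n v) ∈ wordLength V 1) (a : Lambda V) : Lambda.aug (D a) = 0 := by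
  induction a using Lambda.induction with
  | one => rw [hD.one, map_zero]
  | add a b ha hb => rw [map_add, map_add, ha, hb, add_zero]
  | smul c a ha => rw [map_smul, map_smul, ha, smul_zero]
  | mul n v a ha =>
    rw [hD.gen_mul, map_add, map_smul, aug_gen_mul, smul_zero, add_zero]
    exact eq_of_mem_wordLength_one (f := Lambda.aug ∘ₗ LinearMap.mulRight ℚ a) (g := 0)
      (fun m w => by simp [aug_gen_mul]) (h1 n v)

theorem aug_lieDer (hd : IsCE e d) {p : ℕ} (x : F p) (a : Lambda V) :
    Lambda.aug (lieDer e d x a) = 0 :=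
  aug_der_one (hd.lieDer_isDer x) (fun _ v => hd.lieDer_mem x (gen_mem_wordLength v)) a

theorem lieDer_gen (hd : IsCE e d) {p n : ℕ} (x : F p) (v : V n) :
    lieDer e d x (gen n v) = (-1 : ℚ) ^ p • ctr e x (d (gen n v)) := by
  rw [lieDer_apply, contraction_gen, hd.der.algebraMap, zero_add]

/-- Both sides of the Cartan formula for [L_x, i_y] come from derivations, so generators suffice;
there it is the duality of d and the bracket. -/
theorem lieDer_ctr (hd : IsCE e d) {p q n : ℕ} (h : p + q = n) (x : F p) (y : F q)
    (a : Lambda V) : lieDer e d x (ctr e y a) =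
      (-1 : ℚ) ^ (p * (q + 1)) • ctr e y (lieDer e d x a) -
        (-1 : ℚ) ^ p • ctr e (br h x y) a := by
  have key := IsDer.ext ((hd.lieDer_isDer x).comm (contraction_isDer q (e q y)))
    (((contraction_isDer n (e n (br h x y))).congr_parity (l := p + (q + 1))
      (by rw [← h, add_assoc])).smul (-(-1 : ℚ) ^ p)) fun m v => by
    simp only [LinearMap.sub_apply, LinearMap.smul_apply, LinearMap.comp_apply, contraction_gen,
      (hd.lieDer_isDer x).algebraMap, hd.lieDer_gen, zero_sub, map_smul]
    rw [mem_wordLength_zero (contraction_mem (e q y) (contraction_mem (e p x) (hd.quadratic m v)))]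
    by_cases hm : n = m
    · subst hm
      rw [hd.bracket h, Pi.single_eq_same, smul_smul, Algebra.algebraMap_eq_smul_one,
        Algebra.algebraMap_eq_smul_one, smul_smul, smul_smul, ← neg_smul]
      congr 1
      rcases neg_one_pow_eq_or ℚ p with hp | hp <;> rcases neg_one_pow_eq_or ℚ q with hq | hq <;>
        simp [pow_add, pow_mul, hp, hq]
    · rw [hd.bracket_ne (by omega), Pi.single_eq_of_ne (Ne.symm hm)]
      simp
  have := LinearMap.congr_fun key a
  simp only [LinearMap.sub_apply, LinearMap.smul_apply, LinearMap.comp_apply] at this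
  rw [sub_eq_iff_eq_add] at this
  rw [this, neg_smul]
  abel

/-- Apply the augmentation to the Cartan formula and use that it kills the image of L_x. For a in V
this says that L_x is the coadjoint action. -/
theorem aug_ctr_lieDer (hd : IsCE e d) {p q n : ℕ} (h : p + q = n) (x : F p) (y : F q)
    (a : Lambda V) : Lambda.aug (ctr e y (lieDer e d x a)) =
      (-1 : ℚ) ^ (p * q) * Lambda.aug (ctr e (br h x y) a) := by
  have h1 := congrArg Lambda.aug (hd.lieDer_ctr h x y a)
  rw [hd.aug_lieDer, map_sub, map_smul, map_smul, smul_eq_mul, smul_eq_mul] at h1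
  rcases neg_one_pow_eq_or ℚ p with hp | hp <;> rcases neg_one_pow_eq_or ℚ q with hq | hq <;>
    simp [pow_add, pow_mul, hp, hq] at h1 ⊢ <;> linarith

/-- The commutator and L_{[x,y]} are derivations preserving V, so it is enough to pair their values
on generators with elements t of F; there the claim is the Jacobi identity for x, y, t. -/
theorem lieDer_lieDer (hd : IsCE e d) {p q n : ℕ} (h : p + q = n) (x : F p) (y : F q)
    (a : Lambda V) : lieDer e d x (lieDer e d y a) =
      (-1 : ℚ) ^ (p * q) • lieDer e d y (lieDer e d x a) - lieDer e d (br h x y) a := by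
  have key := IsDer.ext ((hd.lieDer_isDer x).comm (hd.lieDer_isDer y))
    (((hd.lieDer_isDer (br h x y)).congr_parity (l := p + q) (by rw [← h])).smul (-1))
    fun m v => by
    simp only [LinearMap.sub_apply, LinearMap.smul_apply, LinearMap.comp_apply]
    have hv := gen_mem_wordLength v
    refine hd.eq_of_one (sub_mem (hd.lieDer_mem _ (hd.lieDer_mem _ hv)) (Submodule.smul_mem _ _
      (hd.lieDer_mem _ (hd.lieDer_mem _ hv)))) (Submodule.smul_mem _ _ (hd.lieDer_mem _ hv))
      fun r t => ?_
    rw [map_sub, map_sub, map_smul, map_smul, map_smul, map_smul,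
      hd.aug_ctr_lieDer (rfl : p + r = p + r) x t _,
      hd.aug_ctr_lieDer (rfl : q + r = q + r) y t _,
      hd.aug_ctr_lieDer (by omega : p + (q + r) = n + r) _ _ _,
      hd.aug_ctr_lieDer (by omega : q + (p + r) = n + r) _ _ _,
      hd.aug_ctr_lieDer (rfl : n + r = n + r) _ _ _,
      jacobi h rfl rfl (by omega) rfl (by omega) x y t]
    have hn : (-1 : ℚ) ^ (n * r) = (-1) ^ (p * r) * (-1) ^ (q * r) := by
      rw [← h, add_mul, pow_add]
    simp only [ctr_add, ctr_smul, map_add, map_smul, smul_eq_mul, LinearMap.add_apply,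
      LinearMap.smul_apply, hn]
    rcases neg_one_pow_eq_or ℚ p with hp | hp <;> rcases neg_one_pow_eq_or ℚ q with hq | hq <;>
      rcases neg_one_pow_eq_or ℚ r with hr | hr <;>
      simp [pow_add, pow_mul, mul_add, hp, hq, hr]
  have := LinearMap.congr_fun key a
  simp only [LinearMap.sub_apply, LinearMap.smul_apply, LinearMap.comp_apply] at this
  rw [sub_eq_iff_eq_add] at this
  rw [this, neg_smul, one_smul]
  abel

/-- Contraction with y turns d on V into ± L_y, which reduces the claim to the commutator of L_x and
L_y. The equation d² = 0 is not part of `IsCE`, so it is not available for this. -/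
theorem d_lieDer_of_one (hd : IsCE e d) {p : ℕ} (x : F p) {a : Lambda V}
    (ha : a ∈ wordLength V 1) : d (lieDer e d x a) = (-1 : ℚ) ^ p • lieDer e d x (d a) := by
  refine hd.eq_of_ctr (k := 1) (hd.der.mem_wordLength hd.quadratic (hd.lieDer_mem x ha))
    (Submodule.smul_mem _ _ (hd.lieDer_mem x (hd.der.mem_wordLength hd.quadratic ha))) fun q y => ?_
  have hdctr : ∀ b ∈ wordLength V 1, ctr e y (d b) = (-1 : ℚ) ^ q • lieDer e d y b := by
    intro b hb
    rw [lieDer_apply, mem_wordLength_zero (contraction_mem _ hb), hd.der.algebraMap, zero_add,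
      smul_smul, ← pow_add, Even.neg_one_pow ⟨q, rfl⟩, one_smul]
  have hdctr' : ctr e (br rfl x y) (d a) = (-1 : ℚ) ^ (p + q) • lieDer e d (br rfl x y) a := by
    rw [lieDer_apply, mem_wordLength_zero (contraction_mem _ ha), hd.der.algebraMap, zero_add,
      smul_smul, ← pow_add, Even.neg_one_pow ⟨p + q, rfl⟩, one_smul]
  have h1 := hd.lieDer_ctr rfl x y (d a)
  rw [hdctr a ha, hdctr', map_smul, hd.lieDer_lieDer rfl x y a] at h1
  rw [hdctr _ (hd.lieDer_mem x ha), map_smul]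
  have h2 : ctr e y (lieDer e d x (d a)) = (-1 : ℚ) ^ (p * (q + 1)) •
      ((-1 : ℚ) ^ (p * (q + 1)) • ctr e y (lieDer e d x (d a))) := by
    rw [smul_smul, ← pow_add, Even.neg_one_pow ⟨_, rfl⟩, one_smul]
  rw [h2, sub_eq_iff_eq_add.1 h1.symm]
  rcases neg_one_pow_eq_or ℚ p with hp | hp <;> rcases neg_one_pow_eq_or ℚ q with hq | hq <;>
      (simp [pow_add, pow_mul, mul_add, hp, hq]; try abel)

theorem d_lieDer (hd : IsCE e d) {p : ℕ} (x : F p) (a : Lambda V) :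
    d (lieDer e d x a) = (-1 : ℚ) ^ p • lieDer e d x (d a) := by
  have key := IsDer.ext (hd.der.comm (hd.lieDer_isDer x)) (IsDer.zero _) fun m v => by
    simp only [LinearMap.sub_apply, LinearMap.smul_apply, LinearMap.comp_apply]
    rw [hd.d_lieDer_of_one x (gen_mem_wordLength v), one_mul, sub_self]
    rfl
  have := LinearMap.congr_fun key a
  simpa [sub_eq_zero] using this

end IsCE

end CartanCalculus
end EnrichedLie
end

/-! ### Free graded Lie algebras: twisted derivations, the Euler derivation, lower central series.
-/

noncomputable section
namespace EnrichedLie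

section FreeLieAlgebras

open GradedLie

/-! ## Abelian extensions and twisted derivations of free Lie algebras -/

section Extension

variable {L : ℕ → Type u} [∀ n, AddCommGroup (L n)] [∀ n, Module ℚ (L n)] [GradedLie L]
variable {M : ℕ → Type w} [∀ n, AddCommGroup (M n)] [∀ n, Module ℚ (M n)]

/-- The extension of `L` by the `L`-module `M` with cocycle `c`. -/
abbrev extensionLie (act : ∀ {i j k : ℕ}, i + j = k → (L i →ₗ[ℚ] M j →ₗ[ℚ] M k))
    (act_br : ∀ {i j k ij jk ik m : ℕ} (hij : i + j = ij) (hjk : j + k = jk) (hik : i + k = ik)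
      (h₁ : i + jk = m) (h₂ : ij + k = m) (h₃ : j + ik = m) (x : L i) (y : L j) (a : M k),
      act h₂ (br hij x y) a = act h₁ x (act hjk y a) - (-1 : ℚ) ^ (i * j) • act h₃ y (act hik x a))
    (c : ∀ {i j k : ℕ}, i + j = k → (L i →ₗ[ℚ] L j →ₗ[ℚ] M k))
    (c_skew : ∀ {i j k : ℕ} (h : i + j = k) (h' : j + i = k) (x : L i) (y : L j),
      c h x y + (-1 : ℚ) ^ (i * j) • c h' y x = 0)
    (c_cocycle : ∀ {i j k ij jk ik m : ℕ} (hij : i + j = ij) (hjk : j + k = jk) (hik : i + k = ik)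
      (h₁ : i + jk = m) (h₂ : ij + k = m) (h₃ : j + ik = m) (h₄ : k + ij = m) (x : L i) (y : L j)
      (z : L k),
      act h₁ x (c hjk y z) + c h₁ x (br hjk y z) =
        c h₂ (br hij x y) z - (-1 : ℚ) ^ (ij * k) • act h₄ z (c hij x y) +
          (-1 : ℚ) ^ (i * j) • (act h₃ y (c hik x z) + c h₃ y (br hik x z))) :
    GradedLie (fun n => L n × M n) where
  br := fun {i j k} h => LinearMap.mk₂ ℚ
    (fun X Y => (br h X.1 Y.1, act h X.1 Y.2 -
      (-1 : ℚ) ^ (i * j) • act ((Nat.add_comm j i).trans h) Y.1 X.2 + c h X.1 Y.1))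
    (fun X X' Y => by
      refine Prod.ext (by simp) ?_
      simp only [Prod.fst_add, Prod.snd_add, map_add, LinearMap.add_apply]; module)
    (fun r X Y => by
      refine Prod.ext (by simp) ?_
      simp only [Prod.smul_fst, Prod.smul_snd, map_smul, LinearMap.smul_apply]; module)
    (fun X Y Y' => by
      refine Prod.ext (by simp) ?_
      simp only [Prod.fst_add, Prod.snd_add, map_add, LinearMap.add_apply]; module)
    (fun r X Y => by
      refine Prod.ext (by simp) ?_
      simp only [Prod.smul_fst, Prod.smul_snd, map_smul, LinearMap.smul_apply]; module)
  skew := fun {i j k} h h' X Y => by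
    refine Prod.ext (skew h h' X.1 Y.1) ?_
    change (act h X.1 Y.2 - (-1 : ℚ) ^ (i * j) • act _ Y.1 X.2 + c h X.1 Y.1) +
      (-1 : ℚ) ^ (i * j) • (act h' Y.1 X.2 - (-1 : ℚ) ^ (j * i) • act _ X.1 Y.2 + c h' Y.1 X.1) = 0
    have h1 := c_skew h h' X.1 Y.1
    rw [← h1, mul_comm j i]
    rcases neg_one_pow_eq_or ℚ (i * j) with hs | hs <;> rw [hs] <;> module
  jacobi := fun {i j k ij jk ik m} hij hjk hik h₁ h₂ h₃ X Y Z => by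
    refine Prod.ext (jacobi hij hjk hik h₁ h₂ h₃ X.1 Y.1 Z.1) ?_
    have h₄ : k + ij = m := by omega
    have h₅ : jk + i = m := by omega
    have h₆ : ik + j = m := by omega
    have hkj : k + j = jk := by omega
    have hki : k + i = ik := by omega
    have hji : j + i = ij := by omega
    change act h₁ X.1 (act hjk Y.1 Z.2 - (-1 : ℚ) ^ (j * k) • act hkj Z.1 Y.2 + c hjk Y.1 Z.1) -
        (-1 : ℚ) ^ (i * jk) • act h₅ (br hjk Y.1 Z.1) X.2 + c h₁ X.1 (br hjk Y.1 Z.1) =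
      (act h₂ (br hij X.1 Y.1) Z.2 - (-1 : ℚ) ^ (ij * k) • act h₄ Z.1
        (act hij X.1 Y.2 - (-1 : ℚ) ^ (i * j) • act hji Y.1 X.2 + c hij X.1 Y.1) +
          c h₂ (br hij X.1 Y.1) Z.1) +
      (-1 : ℚ) ^ (i * j) • (act h₃ Y.1 (act hik X.1 Z.2 - (-1 : ℚ) ^ (i * k) • act hki Z.1 X.2 +
        c hik X.1 Z.1) - (-1 : ℚ) ^ (j * ik) • act h₆ (br hik X.1 Z.1) Y.2 +
          c h₃ Y.1 (br hik X.1 Z.1))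
    have e1 := act_br hij hjk hik h₁ h₂ h₃ X.1 Y.1 Z.2
    have e2 := act_br hjk hki hji h₃ h₅ h₄ Y.1 Z.1 X.2
    have e3 := act_br hik hkj hij h₁ h₆ h₄ X.1 Z.1 Y.2
    have e4 := c_cocycle hij hjk hik h₁ h₂ h₃ h₄ X.1 Y.1 Z.1
    have e5 : act h₁ X.1 (c hjk Y.1 Z.1) = c h₂ (br hij X.1 Y.1) Z.1 -
        (-1 : ℚ) ^ (ij * k) • act h₄ Z.1 (c hij X.1 Y.1) + (-1 : ℚ) ^ (i * j) •
          (act h₃ Y.1 (c hik X.1 Z.1) + c h₃ Y.1 (br hik X.1 Z.1)) - c h₁ X.1 (br hjk Y.1 Z.1) := by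
      rw [← e4]; abel
    simp only [map_add, map_sub, map_smul]
    rw [e1, e2, e3, e5]
    have s1 : (-1 : ℚ) ^ (i * jk) = (-1) ^ (i * j) * (-1) ^ (i * k) := by
      rw [← hjk, mul_add, pow_add]
    have s2 : (-1 : ℚ) ^ (j * ik) = (-1) ^ (i * j) * (-1) ^ (j * k) := by
      rw [← hik, mul_add, pow_add, mul_comm j i]
    have s3 : (-1 : ℚ) ^ (ij * k) = (-1) ^ (i * k) * (-1) ^ (j * k) := by
      rw [← hij, add_mul, pow_add]
    rw [s1, s2, s3]
    rcases neg_one_pow_eq_or ℚ (i * j) with h1 | h1 <;>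
      rcases neg_one_pow_eq_or ℚ (i * k) with h2 | h2 <;>
      rcases neg_one_pow_eq_or ℚ (j * k) with h3 | h3 <;> rw [h1, h2, h3] <;> module

end Extension

variable {T : ℕ → Type u} [∀ n, AddCommGroup (T n)] [∀ n, Module ℚ (T n)]

theorem FreeLie.induction {P : ∀ n, FreeLie T n → Prop} (of : ∀ n (t : T n), P n (FreeLie.of n t))
    (zero : ∀ n, P n 0) (add : ∀ n x y, P n x → P n y → P n (x + y))
    (smul : ∀ n (c : ℚ) x, P n x → P n (c • x))
    (br : ∀ {i j k} (h : i + j = k) x y, P i x → P j y → P k (br h x y)) {n : ℕ}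
    (x : FreeLie T n) : P n x := by
  induction x using FreeLie.ind with | _ a => ?_
  induction a with
  | of t => exact of _ t
  | zero n => exact zero n
  | add a b ha hb => exact add _ _ _ ha hb
  | smul c a ha => exact smul _ c _ ha
  | br h a b ha hb => exact br h _ _ ha hb

theorem FreeLie.lift_of {M : ℕ → Type w} [∀ n, AddCommGroup (M n)] [∀ n, Module ℚ (M n)]
    [GradedLie M] (f : ∀ n, T n →ₗ[ℚ] M n) (n : ℕ) (t : T n) :
    FreeLie.lift f n (FreeLie.of n t) = f n t := rfl

/-- Twisted derivations of a free Lie algebra with prescribed values on the generators. -/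
theorem FreeLie.exists_twistedDerivation {M : ℕ → Type w} [∀ n, AddCommGroup (M n)]
    [∀ n, Module ℚ (M n)]
    (act : ∀ {i j k : ℕ}, i + j = k → (FreeLie T i →ₗ[ℚ] M j →ₗ[ℚ] M k))
    (act_br : ∀ {i j k ij jk ik m : ℕ} (hij : i + j = ij) (hjk : j + k = jk) (hik : i + k = ik)
      (h₁ : i + jk = m) (h₂ : ij + k = m) (h₃ : j + ik = m) (x : FreeLie T i) (y : FreeLie T j)
      (a : M k),
      act h₂ (br hij x y) a = act h₁ x (act hjk y a) - (-1 : ℚ) ^ (i * j) • act h₃ y (act hik x a))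
    (c : ∀ {i j k : ℕ}, i + j = k → (FreeLie T i →ₗ[ℚ] FreeLie T j →ₗ[ℚ] M k))
    (c_skew : ∀ {i j k : ℕ} (h : i + j = k) (h' : j + i = k) (x : FreeLie T i) (y : FreeLie T j),
      c h x y + (-1 : ℚ) ^ (i * j) • c h' y x = 0)
    (c_cocycle : ∀ {i j k ij jk ik m : ℕ} (hij : i + j = ij) (hjk : j + k = jk) (hik : i + k = ik)
      (h₁ : i + jk = m) (h₂ : ij + k = m) (h₃ : j + ik = m) (h₄ : k + ij = m) (x : FreeLie T i)
      (y : FreeLie T j) (z : FreeLie T k),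
      act h₁ x (c hjk y z) + c h₁ x (br hjk y z) =
        c h₂ (br hij x y) z - (-1 : ℚ) ^ (ij * k) • act h₄ z (c hij x y) +
          (-1 : ℚ) ^ (i * j) • (act h₃ y (c hik x z) + c h₃ y (br hik x z)))
    (f : ∀ n, T n →ₗ[ℚ] M n) :
    ∃ η : ∀ n, FreeLie T n →ₗ[ℚ] M n, (∀ n t, η n (FreeLie.of n t) = f n t) ∧
      ∀ {i j k} (h : i + j = k) (h' : j + i = k) x y, η k (br h x y) =
        act h x (η j y) - (-1 : ℚ) ^ (i * j) • act h' y (η i x) + c h x y := by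
  -- A twisted derivation η is the same as a splitting x ↦ (x, η x) of the extension by M, and a
  -- free Lie algebra has a splitting for each choice of values on T.
  let _ := extensionLie act act_br c c_skew c_cocycle
  let φ := FreeLie.lift (M := fun n => FreeLie T n × M n) fun n => (FreeLie.of n).prod (f n)
  have h1 : ∀ n (x : FreeLie T n), (φ n x).1 = x := by
    intro n x
    induction x using FreeLie.induction with
    | of n t => rfl
    | zero n => rw [map_zero]; rfl
    | add n x y hx hy => rw [map_add, Prod.fst_add, hx, hy]
    | smul n c x hx => rw [map_smul, Prod.smul_fst, hx]
    | br h x y hx hy =>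
      rw [FreeLie.lift_br]
      change br h (φ _ x).1 (φ _ y).1 = _
      rw [hx, hy]
  refine ⟨fun n => LinearMap.snd ℚ _ _ ∘ₗ φ n, fun n t => rfl, fun {i j k} h h' x y => ?_⟩
  simp only [LinearMap.comp_apply, LinearMap.snd_apply]
  rw [FreeLie.lift_br]
  change act h (φ i x).1 (φ j y).2 - (-1 : ℚ) ^ (i * j) • act _ (φ j y).1 (φ i x).2 + c h (φ i x).1 (φ j y).1 = _
  rw [h1, h1]

/-- The case of the adjoint module with zero cocycle; skewness turns the twisted rule into the usual
Leibniz rule. -/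
theorem FreeLie.exists_euler : ∃ θ : ∀ n, FreeLie T n →ₗ[ℚ] FreeLie T n,
    (∀ n t, θ n (FreeLie.of n t) = FreeLie.of n t) ∧
      ∀ {i j k} (h : i + j = k) x y, θ k (br h x y) = br h (θ i x) y + br h x (θ j y) := by
  obtain ⟨θ, h1, h2⟩ := FreeLie.exists_twistedDerivation (T := T) (M := FreeLie T) br
    (fun hij hjk hik h₁ h₂ h₃ x y a => by
      rw [jacobi hij hjk hik h₁ h₂ h₃, add_sub_cancel_right]) (fun _ => 0) (by simp) (by simp) FreeLie.of
  refine ⟨θ, h1, fun {i j k} h x y => ?_⟩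
  have h' : j + i = k := by omega
  rw [h2 h h', add_comm (br h (θ i x) y), eq_neg_of_add_eq_zero_left (skew h h' (θ i x) y)]
  simp [sub_eq_add_neg]

/-- The derivation of `𝕃_T` that is the identity on `T`. -/
def FreeLie.euler (n : ℕ) : FreeLie T n →ₗ[ℚ] FreeLie T n := FreeLie.exists_euler.choose n

theorem FreeLie.euler_of (n : ℕ) (t : T n) : FreeLie.euler n (FreeLie.of n t) = FreeLie.of n t :=
  FreeLie.exists_euler.choose_spec.1 n t

theorem FreeLie.euler_br {i j k : ℕ} (h : i + j = k) (x : FreeLie T i) (y : FreeLie T j) :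
    FreeLie.euler k (br h x y) = br h (FreeLie.euler i x) y + br h x (FreeLie.euler j y) :=
  FreeLie.exists_euler.choose_spec.2 h x y

/-! ## The lower central series -/

section Lcs

variable {L : ℕ → Type u} [∀ n, AddCommGroup (L n)] [∀ n, Module ℚ (L n)] [GradedLie L]

theorem br_mem_lcs_succ {k i j n : ℕ} (h : i + j = n) (x : L i) {y : L j} (hy : y ∈ lcs L k j) :
    br h x y ∈ lcs L (k + 1) n := Submodule.subset_span ⟨i, j, h, x, y, hy, rfl⟩

theorem lcs_succ_induction {k n : ℕ} {P : L n → Prop}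
    (mem : ∀ i j (h : i + j = n) (x : L i) (y : L j), y ∈ lcs L k j → P (br h x y)) (zero : P 0)
    (add : ∀ x y, P x → P y → P (x + y)) (smul : ∀ (c : ℚ) x, P x → P (c • x)) {x : L n}
    (hx : x ∈ lcs L (k + 1) n) : P x := by
  refine Submodule.span_induction (p := fun x _ => P x) ?_ zero (fun x y _ _ => add x y)
    (fun c x _ => smul c x) hx
  rintro _ ⟨i, j, h, x, y, hy, rfl⟩
  exact mem i j h x y hy

theorem lcs_antitone {k l : ℕ} (hkl : k ≤ l) (n : ℕ) : lcs L l n ≤ lcs L k n := by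
  induction hkl with
  | refl => exact le_rfl
  | @step l _ ih =>
    refine le_trans (fun x hx => ?_) ih
    refine lcs_succ_induction (P := fun x => x ∈ lcs L l n) (fun i j h x y hy => ?_) (zero_mem _)
      (fun x y => add_mem) (fun c x => Submodule.smul_mem _ c) hx
    exact lcs_br_mem l h x y hy

/-- Induction on a by the Jacobi identity. The + 1 comes from the shift `lcs L k` = L^{k+1}. -/
theorem br_mem_lcs_add {a : ℕ} : ∀ {b i j n : ℕ} (h : i + j = n) {x : L i} {y : L j},
    x ∈ lcs L a i → y ∈ lcs L b j → br h x y ∈ lcs L (a + b + 1) n := by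
  induction a with
  | zero => intro b i j n h x y _ hy; rw [zero_add]; exact br_mem_lcs_succ h x hy
  | succ a ih =>
    intro b i j n h x y hx hy
    refine lcs_succ_induction (P := fun x => br h x y ∈ lcs L (a + 1 + b + 1) n)
      (fun p q hpq s t ht => ?_) (by simp)
      (fun x y hx hy => by rw [map_add, LinearMap.add_apply]; exact add_mem hx hy)
      (fun c x hx => by rw [map_smul, LinearMap.smul_apply]; exact Submodule.smul_mem _ c hx) hx
    have h1 := jacobi hpq (rfl : q + j = q + j) (rfl : p + j = p + j) (by omega) h (by omega) s t y
    rw [← sub_eq_iff_eq_add] at h1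
    rw [← h1]
    refine sub_mem ?_ (Submodule.smul_mem _ _ ?_)
    · have := br_mem_lcs_succ (k := a + b + 1) (by omega : p + (q + j) = n) s (ih rfl ht hy)
      rwa [show a + b + 1 + 1 = a + 1 + b + 1 by ring] at this
    · have := ih (b := b + 1) (by omega : q + (p + j) = n) ht (br_mem_lcs_succ rfl s hy)
      rwa [show a + (b + 1) + 1 = a + 1 + b + 1 by ring] at this

theorem br_mem_lcs_succ_left {k i j n : ℕ} (h : i + j = n) {x : L i} (y : L j)
    (hx : x ∈ lcs L k i) : br h x y ∈ lcs L (k + 1) n :=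
  br_mem_lcs_add (b := 0) h hx trivial

theorem map_mem_lcs {M : ℕ → Type w} [∀ n, AddCommGroup (M n)] [∀ n, Module ℚ (M n)] [GradedLie M]
    (f : ∀ n, L n →ₗ[ℚ] M n) (hf : ∀ {i j k} (h : i + j = k) x y, f k (br h x y) = br h (f i x) (f j y))
    {k : ℕ} : ∀ {n : ℕ} {x : L n}, x ∈ lcs L k n → f n x ∈ lcs M k n := by
  induction k with
  | zero => intros; trivial
  | succ k ih =>
    intro n x hx
    refine lcs_succ_induction (P := fun x => f n x ∈ lcs M (k + 1) n) (fun i j h x y hy => ?_)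
      (by simp) (fun x y hx hy => by rw [map_add]; exact add_mem hx hy)
      (fun c x hx => by rw [map_smul]; exact Submodule.smul_mem _ c hx) hx
    rw [hf]
    exact br_mem_lcs_succ h _ (ih hy)

theorem exists_mem_lcs_of_surjective {M : ℕ → Type w} [∀ n, AddCommGroup (M n)]
    [∀ n, Module ℚ (M n)] [GradedLie M] (f : ∀ n, L n →ₗ[ℚ] M n)
    (hf : ∀ {i j k} (h : i + j = k) x y, f k (br h x y) = br h (f i x) (f j y))
    (hs : ∀ n, Function.Surjective (f n)) {k : ℕ} : ∀ {n : ℕ} {y : M n}, y ∈ lcs M k n →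
      ∃ x ∈ lcs L k n, f n x = y := by
  induction k with
  | zero =>
    intro n y _
    obtain ⟨x, rfl⟩ := hs n y
    exact ⟨x, trivial, rfl⟩
  | succ k ih =>
    intro n y hy
    refine lcs_succ_induction (P := fun y => ∃ x ∈ lcs L (k + 1) n, f n x = y)
      (fun i j h x y hy => ?_) ⟨0, zero_mem _, map_zero _⟩ ?_ ?_ hy
    · obtain ⟨x, rfl⟩ := hs i x
      obtain ⟨y', hy', rfl⟩ := ih hy
      exact ⟨br h x y', br_mem_lcs_succ h x hy', hf h x y'⟩
    · rintro _ _ ⟨x, hx, rfl⟩ ⟨y, hy, rfl⟩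
      exact ⟨x + y, add_mem hx hy, map_add _ _ _⟩
    · rintro c _ ⟨x, hx, rfl⟩
      exact ⟨c • x, Submodule.smul_mem _ c hx, map_smul _ _ _⟩

end Lcs

/-! ## Quotients of free Lie algebras -/

theorem FreeLie.toQuot_of (K : GSub T) (n : ℕ) (t : T n) :
    FreeLie.toQuot K n (FreeLie.of n t) = FreeLie.of n (Submodule.Quotient.mk t) := rfl

theorem FreeLie.toQuot_br (K : GSub T) {i j k : ℕ} (h : i + j = k) (x : FreeLie T i)
    (y : FreeLie T j) : FreeLie.toQuot K k (br h x y) =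
      br h (FreeLie.toQuot K i x) (FreeLie.toQuot K j y) := FreeLie.lift_br _ h x y

theorem FreeLie.toQuot_surjective (K : GSub T) (n : ℕ) :
    Function.Surjective (FreeLie.toQuot K n) := by
  intro x
  induction x using FreeLie.induction with
  | of n t =>
    obtain ⟨t, rfl⟩ := Submodule.Quotient.mk_surjective _ t
    exact ⟨FreeLie.of n t, rfl⟩
  | zero n => exact ⟨0, map_zero _⟩
  | add n x y hx hy =>
    obtain ⟨x, rfl⟩ := hx
    obtain ⟨y, rfl⟩ := hy
    exact ⟨x + y, map_add ..⟩
  | smul n c x hx =>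
    obtain ⟨x, rfl⟩ := hx
    exact ⟨c • x, map_smul ..⟩
  | br h x y hx hy =>
    obtain ⟨x, rfl⟩ := hx
    obtain ⟨y, rfl⟩ := hy
    exact ⟨br h x y, FreeLie.toQuot_br K h x y⟩

/-- The kernel of `𝕃_T → 𝕃_{T/K}` is the ideal generated by `K`. -/
theorem FreeLie.mem_of_toQuot_eq_zero (K : GSub T) (J : GradedIdeal (FreeLie T))
    (hJ : ∀ n, ∀ t ∈ K n, FreeLie.of n t ∈ J.sub n) {n : ℕ} {x : FreeLie T n}
    (hx : FreeLie.toQuot K n x = 0) : x ∈ J.sub n := by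
  -- Since K is mapped into J, the map T → 𝕃_T / J factors through T / K and extends to 𝕃_{T/K}; so
  -- 𝕃_T → 𝕃_T / J factors through `toQuot`.
  let g : ∀ n, FreeLie (GQuot K) n →ₗ[ℚ] GQuot J.sub n := FreeLie.lift fun n =>
    Submodule.mapQ (K n) (J.sub n) (FreeLie.of n) fun t ht => hJ n t ht
  have h1 : ∀ n (x : FreeLie T n), g n (FreeLie.toQuot K n x) = Submodule.Quotient.mk x := by
    intro n x
    induction x using FreeLie.induction with
    | of n t => rfl
    | zero n => rw [map_zero, map_zero]; rfl
    | add n x y hx hy => rw [map_add, map_add, hx, hy]; rfl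
    | smul n c x hx => rw [map_smul, map_smul, hx]; rfl
    | br h x y hx hy =>
      rw [FreeLie.toQuot_br, FreeLie.lift_br, hx, hy]
      rfl
  rw [← Submodule.Quotient.mk_eq_zero, ← h1, hx, map_zero]

theorem FreeLie.toQuot_eq_zero_of_mem (K : GSub T) {n : ℕ} {t : T n} (ht : t ∈ K n) :
    FreeLie.toQuot K n (FreeLie.of n t) = 0 := by
  rw [FreeLie.toQuot_of, (Submodule.Quotient.mk_eq_zero _).2 ht, map_zero]

theorem FreeLie.euler_toQuot (K : GSub T) {n : ℕ} (x : FreeLie T n) :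
    FreeLie.euler n (FreeLie.toQuot K n x) = FreeLie.toQuot K n (FreeLie.euler n x) := by
  induction x using FreeLie.induction with
  | of n t => rw [FreeLie.euler_of, FreeLie.toQuot_of, FreeLie.euler_of]
  | zero n => simp only [map_zero]
  | add n x y hx hy => simp only [map_add, hx, hy]
  | smul n c x hx => simp only [map_smul, hx]
  | br h x y hx hy =>
    simp only [FreeLie.euler_br, FreeLie.toQuot_br, map_add, hx, hy]

/-- The Euler derivation is the identity modulo brackets; by the Leibniz rule it is then
multiplication by k + 1 on the successive quotient L^{k+1} / L^{k+2}. -/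
theorem FreeLie.euler_sub_mem_lcs {k : ℕ} : ∀ {n : ℕ} {x : FreeLie T n}, x ∈ lcs (FreeLie T) k n →
    FreeLie.euler n x - ((k : ℚ) + 1) • x ∈ lcs (FreeLie T) (k + 1) n := by
  have h0 : ∀ {n} (x : FreeLie T n), FreeLie.euler n x - x ∈ lcs (FreeLie T) 1 n := by
    intro n x
    induction x using FreeLie.induction with
    | of n t => rw [FreeLie.euler_of, sub_self]; exact zero_mem _
    | zero n => simp
    | add n x y hx hy =>
      have := add_mem hx hy
      convert this using 1
      rw [map_add]; module
    | smul n c x hx =>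
      have := Submodule.smul_mem _ c hx
      convert this using 1
      rw [map_smul]; module
    | br h x y _ _ =>
      refine sub_mem ?_ (br_mem_lcs_succ h x trivial)
      rw [FreeLie.euler_br]
      exact add_mem (br_mem_lcs_succ h _ trivial) (br_mem_lcs_succ h _ trivial)
  induction k with
  | zero =>
    intro n x _
    simpa using h0 x
  | succ k ih =>
    intro n x hx
    refine lcs_succ_induction (P := fun x => FreeLie.euler n x - (((k + 1 : ℕ) : ℚ) + 1) • x ∈
      lcs (FreeLie T) (k + 1 + 1) n) (fun i j h x y hy => ?_) (by simp) (fun x y hx hy => ?_)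
      (fun c x hx => ?_) hx
    · have h1 := br_mem_lcs_add h (h0 x) hy
      have h2 := br_mem_lcs_succ h x (ih hy)
      rw [show 1 + k + 1 = k + 1 + 1 by ring] at h1
      have := add_mem h1 h2
      convert this using 1
      rw [FreeLie.euler_br, map_sub, map_sub, LinearMap.sub_apply, map_smul]
      push_cast
      module
    · have := add_mem hx hy
      convert this using 1
      rw [map_add]; module
    · have := Submodule.smul_mem _ c hx
      convert this using 1
      rw [map_smul]; module

theorem FreeLie.euler_mem_lcs {k n : ℕ} {x : FreeLie T n} (hx : x ∈ lcs (FreeLie T) k n) :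
    FreeLie.euler n x ∈ lcs (FreeLie T) k n := by
  have h1 := lcs_antitone (Nat.le_succ k) n (FreeLie.euler_sub_mem_lcs hx)
  have := add_mem h1 (Submodule.smul_mem _ ((k : ℚ) + 1) hx)
  rwa [sub_add_cancel] at this

/-- `𝕃_T = T + [𝕃_T, 𝕃_T]`. -/
theorem FreeLie.exists_sub_of_mem {n : ℕ} (x : FreeLie T n) :
    ∃ t, x - FreeLie.of n t ∈ lcs (FreeLie T) 1 n := by
  induction x using FreeLie.induction with
  | of n t => exact ⟨t, by simp⟩
  | zero n => exact ⟨0, by simp⟩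
  | add n x y hx hy =>
    obtain ⟨s, hs⟩ := hx
    obtain ⟨t, ht⟩ := hy
    refine ⟨s + t, ?_⟩
    convert add_mem hs ht using 1
    rw [map_add]; abel
  | smul n c x hx =>
    obtain ⟨s, hs⟩ := hx
    refine ⟨c • s, ?_⟩
    convert Submodule.smul_mem _ c hs using 1
    rw [map_smul, smul_sub]
  | br h x y _ _ => exact ⟨0, by simpa using br_mem_lcs_succ (k := 0) h x trivial⟩

end FreeLieAlgebras
end EnrichedLie
end

/-! ### Second order operators on ΛV and a criterion for homotopies. -/

noncomputable section
namespace EnrichedLie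

section Homotopy

variable {V : ℕ → Type u} [∀ n, AddCommGroup (V n)] [∀ n, Module ℚ (V n)]

/-! ## Second order operators -/

theorem mul_gen_eq (a : Lambda V) (n : ℕ) (w : V n) :
    a * gen n w = gen n w * parityPow (n + 1) a := by
  induction a using Lambda.induction with
  | one => rw [parityPow_one, one_mul, mul_one]
  | add a b ha hb => rw [add_mul, map_add, ha, hb, mul_add]
  | smul c a ha => rw [smul_mul_assoc, map_smul, ha, mul_smul_comm]
  | mul m v a ha =>
    rw [mul_assoc, ha, ← mul_assoc, gen_comm, parityPow_gen_mul, smul_mul_assoc, mul_assoc,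
      mul_smul_comm, mul_comm (m + 1)]

theorem mul_gen_of_parity {a : Lambda V} {e : ℕ} (ha : Lambda.parity a = (-1 : ℚ) ^ e • a) (n : ℕ)
    (w : V n) : a * gen n w = (-1 : ℚ) ^ (e * (n + 1)) • (gen n w * a) := by
  rw [mul_gen_eq, parityPow_eq_of_parity ha, mul_smul_comm, mul_comm e]

theorem exists_weightDer (f : ∀ n, V n →ₗ[ℚ] V n) : ∃ D : Lambda V →ₗ[ℚ] Lambda V, IsDer 0 D ∧
    ∀ n v, D (gen n v) = gen n (f n v) :=
  IsDer.exists_of_gen 0 (fun n => gen n ∘ₗ f n)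
    (fun m n v w => by simp only [LinearMap.comp_apply]; rw [gen_comm, add_zero])
    (fun n v => by simp only [LinearMap.comp_apply]; rw [parity_gen, add_zero])

/-- As V m has degree m + 1, the product B has degree −1 and D_v has parity m. Linearity in v holds
because derivations are determined on generators. -/
theorem exists_derFamily (B : ∀ m n, V m →ₗ[ℚ] V n →ₗ[ℚ] V (m + n)) :
    ∃ D : ∀ m, V m →ₗ[ℚ] Module.End ℚ (Lambda V), (∀ m v, IsDer m (D m v)) ∧
      ∀ m v n w, D m v (gen n w) = gen (m + n) (B m n v w) := by
  have h : ∀ m (v : V m), ∃ D : Lambda V →ₗ[ℚ] Lambda V, IsDer m D ∧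
      ∀ n w, D (gen n w) = gen (m + n) (B m n v w) := fun m v =>
    IsDer.exists_of_gen m (fun n => gen (m + n) ∘ₗ B m n v)
      (fun n l w u => by
        simp only [LinearMap.comp_apply]
        rw [gen_comm, show m + n + 1 = n + 1 + m by ring])
      (fun n w => by
        simp only [LinearMap.comp_apply]; rw [parity_gen, show m + n + 1 = n + 1 + m by ring])
  choose D hD hD' using h
  refine ⟨fun m => { toFun := D m, map_add' := fun v w => ?_, map_smul' := fun c v => ?_ }, hD, hD'⟩
  · refine IsDer.ext (hD m _) ((hD m v).add (hD m w)) fun n u => ?_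
    rw [hD', LinearMap.add_apply, hD', hD', map_add, LinearMap.add_apply, map_add]
  · refine IsDer.ext (hD m _) ((hD m v).smul c) fun n u => ?_
    rw [hD', LinearMap.smul_apply, hD', map_smul, LinearMap.smul_apply, map_smul]; rfl

/-- The second order operator `H` with `H (v w) = B v w`. -/
theorem exists_secondOrder (D : ∀ m, V m →ₗ[ℚ] Module.End ℚ (Lambda V))
    (hD : ∀ m v, IsDer m (D m v))
    (hsymm : ∀ m n v w, D m v (gen n w) = (-1 : ℚ) ^ ((m + 1) * (n + 1)) • D n w (gen m v)) :
    ∃ H : Lambda V →ₗ[ℚ] Lambda V, H 1 = 0 ∧ ∀ n v a,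
      H (gen n v * a) = D n v a + (-1 : ℚ) ^ (n + 1) • (gen n v * H a) := by
  obtain ⟨H, h1, h2⟩ := Lambda.exists_signOp 1 D (fun m n v w a => by
    rw [(hD m v).gen_mul, (hD n w).gen_mul, hsymm m n v w]
    rcases neg_one_pow_eq_or ℚ m with hm | hm <;> rcases neg_one_pow_eq_or ℚ n with hn | hn <;>
      simp only [pow_add, pow_mul, mul_add, add_mul, mul_one, one_mul, hm, hn, pow_one, one_pow,
        smul_mul_assoc] <;> module) 0
  exact ⟨H, h1, fun n v a => by simpa using h2 n v a⟩

/-- The commutator of a second order operator with a derivation of parity one is determined by its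
values on products of at most two generators. -/
theorem secondOrder_homotopy {D : ∀ m, V m →ₗ[ℚ] Module.End ℚ (Lambda V)}
    (hD : ∀ m v, IsDer m (D m v)) {H d W : Lambda V →ₗ[ℚ] Lambda V} (hH1 : H 1 = 0)
    (hH : ∀ n v a, H (gen n v * a) = D n v a + (-1 : ℚ) ^ (n + 1) • (gen n v * H a))
    (hd : IsDer 1 d) (hW : IsDer 0 W)
    (h1 : ∀ n (v : V n), H (d (gen n v)) = W (W (gen n v)) - W (gen n v))
    (h2 : ∀ m n (v : V m) (w : V n), d (D m v (gen n w)) + (-1 : ℚ) ^ (m + 1) • D m v (d (gen n w)) +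
      (-1 : ℚ) ^ (m * (n + 1)) • D n w (d (gen m v)) = (2 : ℚ) • (W (gen m v) * W (gen n w)))
    (a : Lambda V) : d (H a) + H (d a) = W (W a) - W a := by
  have hW' : ∀ n (v : V n) a, W (gen n v * a) = W (gen n v) * a + gen n v * W a := fun n v a => by
    rw [hW.gen_mul, zero_mul, pow_zero, one_smul]
  have hd' : ∀ n (v : V n) a, d (gen n v * a) = d (gen n v) * a + (-1 : ℚ) ^ (n + 1) • (gen n v * d a) :=
    fun n v a => by rw [hd.gen_mul, one_mul]
  have hpar : ∀ m (v : V m), Lambda.parity (d (gen m v)) = (-1 : ℚ) ^ m • d (gen m v) := fun m v => by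
    rw [hd.parity_gen, pow_add, pow_succ]; simp
  have hWpar : ∀ m (v : V m), Lambda.parity (W (gen m v)) = (-1 : ℚ) ^ (m + 1) • W (gen m v) :=
    fun m v => hW.parity_gen m v
  -- Carry w in front of dv and apply the recursion for H. This relates the defect H(dv · b) − ± dv
  -- · H b for b = w a to the defect for b = a.
  have hG : ∀ m (v : V m) n (w : V n) a, H (d (gen m v) * (gen n w * a)) =
      (-1 : ℚ) ^ m • (d (gen m v) * H (gen n w * a)) + (-1 : ℚ) ^ (m * (n + 1)) • (D n w (d (gen m v)) * a) +
      (-1 : ℚ) ^ ((m + 1) * (n + 1)) •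
        (gen n w * (H (d (gen m v) * a) - (-1 : ℚ) ^ m • (d (gen m v) * H a))) := by
    intro m v n w a
    have hz := mul_gen_of_parity (hpar m v) n w
    have hz' : d (gen m v) * (gen n w * H a) =
        (-1 : ℚ) ^ (m * (n + 1)) • (gen n w * (d (gen m v) * H a)) := by
      rw [← mul_assoc, hz, smul_mul_assoc, mul_assoc]
    rw [← mul_assoc, hz, smul_mul_assoc, mul_assoc, map_smul, hH,
      (hD n w).leibniz_of_parity (hpar m v), hH, mul_add (d (gen m v)), mul_smul_comm, hz',
      mul_sub (gen n w), mul_smul_comm]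
    rcases neg_one_pow_eq_or ℚ m with hm | hm <;> rcases neg_one_pow_eq_or ℚ n with hn | hn <;>
      simp only [pow_add, pow_mul, mul_add, add_mul, mul_one, one_mul, hm, hn, pow_one, one_pow,
        mul_comm n m] <;> module
  -- The left side is the commutator of dH + Hd with left multiplication by v; the right side is the
  -- same commutator for W² − W, whose second order nature shows in the cross term. In the induction
  -- on a, h1 is the case a = 1 and h2 gives the new terms that appear for w a.
  have hC : ∀ m (v : V m) a, H (d (gen m v) * a) - (-1 : ℚ) ^ m • (d (gen m v) * H a) +
      d (D m v a) + (-1 : ℚ) ^ (m + 1) • D m v (d a) =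
      (W (W (gen m v)) - W (gen m v)) * a + (2 : ℚ) • (W (gen m v) * W a) := by
    intro m v a
    induction a using Lambda.induction with
    | one => simp [hH1, (hD m v).one, hd.one, hW.one, h1]
    | add a b ha hb =>
      simp only [mul_add _ a b, map_add, mul_add _ (H a), mul_add _ (W a)]
      linear_combination (norm := module) ha + hb
    | smul c a ha =>
      simp only [mul_smul_comm, map_smul]
      linear_combination (norm := module) c • ha
    | mul n w a ha =>
      rw [hG, (hD m v).gen_mul, hd', map_add, map_add, map_smul, map_smul, hd',
        hd.leibniz_of_parity (e := m + (n + 1)) (a := (D m v) (gen n w))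
          (by rw [(hD m v).parity_gen]; congr 2; ring),
        (hD m v).gen_mul n w, hW', (hD m v).leibniz_of_parity (hpar n w)]
      have e1 : W (gen m v) * (gen n w * W a) =
          (-1 : ℚ) ^ ((m + 1) * (n + 1)) • (gen n w * (W (gen m v) * W a)) := by
        rw [← mul_assoc, mul_gen_of_parity (hWpar m v), smul_mul_assoc, mul_assoc]
      have e2 : (W (W (gen m v)) - W (gen m v)) * (gen n w * a) =
          (-1 : ℚ) ^ ((m + 1) * (n + 1)) • (gen n w * ((W (W (gen m v)) - W (gen m v)) * a)) := by
        rw [← mul_assoc, mul_gen_of_parity (e := m + 1), smul_mul_assoc, mul_assoc]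
        rw [map_sub, hWpar, hW.parity, hWpar, map_smul, smul_sub]; simp
      have e3 := congrArg (gen n w * ·) ha
      have e4 := congrArg (· * a) (h2 m n v w)
      simp only [smul_mul_assoc, mul_assoc] at e4
      rw [mul_add (W (gen m v)), e1, e2]
      simp only [mul_add, mul_sub, add_mul, smul_add, smul_sub, smul_smul, mul_smul_comm, smul_mul_assoc] at e3 e4 ⊢
      rcases neg_one_pow_eq_or ℚ m with hm | hm <;> rcases neg_one_pow_eq_or ℚ n with hn | hn <;>
      simp only [pow_add, pow_mul, mul_one, one_mul, hm, hn, pow_one, one_pow] at e3 e4 ⊢ <;>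
      first
        | linear_combination (norm := module) e4 + e3
        | linear_combination (norm := module) e4 - e3
  induction a using Lambda.induction with
  | one => simp [hH1, hd.one, hW.one]
  | add a b ha hb =>
    simp only [map_add]
    rw [add_add_add_comm, ha, hb]; abel
  | smul c a ha =>
    simp only [map_smul]
    rw [← smul_add, ha, smul_sub]
  | mul m v a ha =>
    have h3 := hC m v a
    have h4 := congrArg (gen m v * ·) ha
    simp only [mul_add, mul_sub] at h4
    have h3 := hC m v a
    have h5 : W (W (gen m v) * a) = W (W (gen m v)) * a + W (gen m v) * W a := by
      rw [hW.leibniz, parityPow_zero]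
    rw [hH, hd', map_add, map_add, map_smul, map_smul, hd', hH, hW', map_add, hW', h5]
    simp only [sub_mul] at h3
    rcases neg_one_pow_eq_or ℚ m with hm | hm <;>
      simp only [pow_add, hm, pow_one] at h3 ⊢ <;>
      linear_combination (norm := module) h3 + h4

end Homotopy
end EnrichedLie
end

/-! ### The twisted derivation η of a free Lie algebra with values in the coadjoint module. -/

noncomputable section
namespace EnrichedLie

section FreeHomotopy

open GradedLie

variable {V : ℕ → Type u} [∀ n, AddCommGroup (V n)] [∀ n, Module ℚ (V n)]

section Cocycle

variable {F : ℕ → Type w} [∀ n, AddCommGroup (F n)] [∀ n, Module ℚ (F n)]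

/-! ## The coadjoint module `(ΛV)^∨` and its canonical invariant form -/

/-- The action of `F` on the dual of `ΛV`. -/
def coact (e : ∀ n, F n →ₗ[ℚ] Module.Dual ℚ (V n)) (d : Lambda V →ₗ[ℚ] Lambda V) (p : ℕ) :
    F p →ₗ[ℚ] Module.Dual ℚ (Lambda V) →ₗ[ℚ] Module.Dual ℚ (Lambda V) :=
  LinearMap.mk₂ ℚ (fun x φ => φ ∘ₗ parityPow p ∘ₗ lieDer e d x)
    (fun x y φ => by ext a; simp [lieDer_add])
    (fun c x φ => by ext a; simp [lieDer_smul])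
    (fun x φ ψ => by ext a; simp)
    (fun c x φ => by ext a; simp)

theorem coact_apply (e : ∀ n, F n →ₗ[ℚ] Module.Dual ℚ (V n)) (d : Lambda V →ₗ[ℚ] Lambda V) {p : ℕ}
    (x : F p) (φ : Module.Dual ℚ (Lambda V)) (a : Lambda V) :
    coact e d p x φ a = φ (parityPow p (lieDer e d x a)) := rfl

/-- The linear forms `a ↦ ± ε (i_y i_x a)` on `ΛV`. -/
def pairForm (e : ∀ n, F n →ₗ[ℚ] Module.Dual ℚ (V n)) (p q : ℕ) :
    F p →ₗ[ℚ] F q →ₗ[ℚ] Module.Dual ℚ (Lambda V) :=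
  LinearMap.mk₂ ℚ (fun x y => (-1 : ℚ) ^ (p * q + q) • (Lambda.aug ∘ₗ ctr e y ∘ₗ ctr e x))
    (fun x x' y => by ext a; simp only [ctr_add, LinearMap.smul_apply, LinearMap.comp_apply, LinearMap.add_apply, map_add, smul_add])
    (fun c x y => by ext a; simp only [ctr_smul, LinearMap.smul_apply, LinearMap.comp_apply, map_smul, smul_comm c])
    (fun x y y' => by ext a; simp only [ctr_add, LinearMap.smul_apply, LinearMap.comp_apply, LinearMap.add_apply, map_add, smul_add])
    (fun c x y => by ext a; simp only [ctr_smul, LinearMap.smul_apply, LinearMap.comp_apply, map_smul, smul_comm c])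

theorem pairForm_apply (e : ∀ n, F n →ₗ[ℚ] Module.Dual ℚ (V n)) {p q : ℕ} (x : F p) (y : F q)
    (a : Lambda V) :
    pairForm e p q x y a = (-1 : ℚ) ^ (p * q + q) * Lambda.aug (ctr e y (ctr e x a)) := rfl

theorem pairForm_skew (e : ∀ n, F n →ₗ[ℚ] Module.Dual ℚ (V n)) {p q : ℕ} (x : F p) (y : F q) :
    pairForm e p q x y + (-1 : ℚ) ^ (p * q) • pairForm e q p y x = 0 := by
  ext a
  rw [LinearMap.add_apply, LinearMap.smul_apply, pairForm_apply, pairForm_apply, contraction_comm,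
    map_smul, smul_eq_mul, smul_eq_mul]
  rcases neg_one_pow_eq_or ℚ p with hp | hp <;> rcases neg_one_pow_eq_or ℚ q with hq | hq <;>
    simp [pow_add, pow_mul, mul_add, add_mul, hp, hq]

variable {e : ∀ n, F n →ₗ[ℚ] Module.Dual ℚ (V n)}

/-- E weights V^{n+1} by n, the degree in the Lie algebra, and a contraction with x removes the
weight p. It is enough to compare derivations on generators. -/
theorem IsDer.comm_ctr_of_degree {E : Lambda V →ₗ[ℚ] Lambda V} (hE : IsDer 0 E)
    (hE' : ∀ n (v : V n), E (gen n v) = (n : ℚ) • gen n v) {p : ℕ} (x : F p) (a : Lambda V) :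
    ctr e x (E a) = E (ctr e x a) + (p : ℚ) • ctr e x a := by
  have key := IsDer.ext ((contraction_isDer p (e p x)).comm hE)
    (((contraction_isDer p (e p x)).congr_parity (l := p + 1 + 0) (by simp)).smul (p : ℚ))
    fun n v => by
      simp only [LinearMap.sub_apply, LinearMap.smul_apply, LinearMap.comp_apply, hE', map_smul,
        contraction_gen, hE.algebraMap, smul_zero, sub_zero]
      by_cases hn : n = p
      · subst hn; rfl
      · rw [Pi.single_eq_of_ne hn]; simp
  have := LinearMap.congr_fun key a
  simp only [LinearMap.sub_apply, LinearMap.smul_apply, LinearMap.comp_apply, mul_zero, pow_zero,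
    one_smul] at this
  rw [← this]; abel

theorem IsDer.aug_of_degree {E : Lambda V →ₗ[ℚ] Lambda V} (hE : IsDer 0 E)
    (hE' : ∀ n (v : V n), E (gen n v) = (n : ℚ) • gen n v) (a : Lambda V) : Lambda.aug (E a) = 0 :=
  IsCE.aug_der_one hE (fun n v => by
    rw [hE']; exact Submodule.smul_mem _ _ (gen_mem_wordLength v)) a

theorem IsDer.aug_ctr_ctr_of_degree {E : Lambda V →ₗ[ℚ] Lambda V} (hE : IsDer 0 E)
    (hE' : ∀ n (v : V n), E (gen n v) = (n : ℚ) • gen n v) {p q : ℕ} (x : F p) (y : F q)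
    (a : Lambda V) : Lambda.aug (ctr e y (ctr e x (E a))) =
      ((p : ℚ) + q) * Lambda.aug (ctr e y (ctr e x a)) := by
  rw [hE.comm_ctr_of_degree hE', map_add, hE.comm_ctr_of_degree hE', map_add, map_add,
    hE.aug_of_degree hE', map_smul, map_smul, map_smul, smul_eq_mul, smul_eq_mul]
  ring

variable [GradedLie F] {d : Lambda V →ₗ[ℚ] Lambda V}

/-- Transposition of the commutator formula for L_x and L_y; the parity twist in `coact` supplies
the signs that make this a left action. -/
theorem IsCE.coact_br (hd : IsCE e d) {p q n : ℕ} (h : p + q = n) (x : F p) (y : F q)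
    (φ : Module.Dual ℚ (Lambda V)) : coact e d n (br h x y) φ =
      coact e d p x (coact e d q y φ) - (-1 : ℚ) ^ (p * q) • coact e d q y (coact e d p x φ) := by
  ext a
  rw [LinearMap.sub_apply, LinearMap.smul_apply]
  simp only [coact_apply]
  have h1 := hd.lieDer_lieDer h x y a
  have h2 : lieDer e d (br h x y) a = (-1 : ℚ) ^ (p * q) • lieDer e d y (lieDer e d x a) -
      lieDer e d x (lieDer e d y a) := by rw [h1]; abel
  have h3 : ∀ {k : ℕ} (l : ℕ) {D : Lambda V →ₗ[ℚ] Lambda V}, IsDer k D → ∀ a,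
      D (parityPow l a) = (-1 : ℚ) ^ (k * l) • parityPow l (D a) := by
    intro k l D hD a
    rw [hD.parityPow_comm, smul_smul, ← pow_add, Even.neg_one_pow ⟨_, rfl⟩, one_smul]
  rw [h2, h3 _ (hd.lieDer_isDer x), h3 _ (hd.lieDer_isDer y), map_smul, map_smul, map_smul, map_smul,
    ← parityPow_add, ← parityPow_add, add_comm q p, h, map_sub, map_sub, map_smul, map_smul,
    smul_smul, ← pow_add, Even.neg_one_pow ⟨_, rfl⟩, one_smul, mul_comm q p]

/-- Invariance of the form: carry L_x past i_y and then past i_z by the Cartan formula, after which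
the augmentation kills the remaining term. -/
theorem IsCE.coact_pairForm (hd : IsCE e d) {p q r n m : ℕ} (h : p + q = n) (h' : p + r = m)
    (x : F p) (y : F q) (z : F r) : coact e d p x (pairForm e q r y z) =
      pairForm e n r (br h x y) z + (-1 : ℚ) ^ (p * q) • pairForm e q m y (br h' x z) := by
  ext a
  rw [LinearMap.add_apply, LinearMap.smul_apply, coact_apply, pairForm_apply, pairForm_apply, pairForm_apply]
  have h0 : Lambda.aug (ctr e z (ctr e y (parityPow p (lieDer e d x a)))) =
      (-1 : ℚ) ^ (p * (q + r)) * Lambda.aug (ctr e z (ctr e y (lieDer e d x a))) := by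
    have h1 := (contraction_isDer q (e q y)).parityPow_comm p (lieDer e d x a)
    have h2 := (contraction_isDer r (e r z)).parityPow_comm p (ctr e y (lieDer e d x a))
    have h3 := congrArg Lambda.aug h2
    rw [h1] at h3
    rw [aug_parityPow, map_smul, map_smul, map_smul, smul_eq_mul, smul_eq_mul] at h3
    rw [h3]
    rcases neg_one_pow_eq_or ℚ p with hp | hp <;> rcases neg_one_pow_eq_or ℚ q with hq | hq <;>
      rcases neg_one_pow_eq_or ℚ r with hr | hr <;>
      simp [pow_add, pow_mul', mul_add, add_mul, hp, hq, hr]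
  have h1 := congrArg (fun b => Lambda.aug (ctr e z b)) (hd.lieDer_ctr h x y a)
  have h2 := congrArg Lambda.aug (hd.lieDer_ctr h' x z (ctr e y a))
  simp only [map_sub, map_smul, smul_eq_mul, hd.aug_lieDer] at h1 h2
  rw [h0]
  rw [h1] at h2
  have hm : (-1 : ℚ) ^ m = (-1) ^ p * (-1) ^ r := by rw [← h', pow_add]
  have hn : (-1 : ℚ) ^ n = (-1) ^ p * (-1) ^ q := by rw [← h, pow_add]
  rcases neg_one_pow_eq_or ℚ p with hp | hp <;> rcases neg_one_pow_eq_or ℚ q with hq | hq <;>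
      rcases neg_one_pow_eq_or ℚ r with hr | hr <;>
      simp [pow_add, pow_mul, mul_add, hp, hq, hr, hm, hn] at h2 ⊢ <;> linarith

theorem parityPow_mem {k l : ℕ} {a : Lambda V} (ha : a ∈ wordLength V l) :
    parityPow k a ∈ wordLength V l := by
  induction l generalizing a with
  | zero =>
    rw [mem_wordLength_zero ha, Algebra.algebraMap_eq_smul_one, map_smul, parityPow_one]
    exact Submodule.smul_mem _ _ one_mem_wordLength
  | succ l ih =>
    refine wordLength_succ_induction (p := fun a => parityPow k a ∈ wordLength V (l + 1))
      (fun n v a ha => ?_) (by simp) (fun a b ha hb => by rw [map_add]; exact add_mem ha hb)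
      (fun c a ha => by rw [map_smul]; exact Submodule.smul_mem _ _ ha) ha
    rw [parityPow_gen_mul]
    exact Submodule.smul_mem _ _ (gen_mul_mem_wordLength v (ih ha))

theorem IsDer.map_parityPow {k : ℕ} (l : ℕ) {D : Lambda V →ₗ[ℚ] Lambda V} (hD : IsDer k D)
    (a : Lambda V) : D (parityPow l a) = (-1 : ℚ) ^ (k * l) • parityPow l (D a) := by
  rw [hD.parityPow_comm, smul_smul, ← pow_add, Even.neg_one_pow ⟨_, rfl⟩, one_smul]

theorem IsCE.ctr_d (hd : IsCE e d) {p : ℕ} (x : F p) {a : Lambda V} (ha : a ∈ wordLength V 1) :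
    ctr e x (d a) = (-1 : ℚ) ^ p • lieDer e d x a := by
  rw [lieDer_apply, mem_wordLength_zero (contraction_mem _ ha), hd.der.algebraMap, zero_add,
    smul_smul, ← pow_add, Even.neg_one_pow ⟨p, rfl⟩, one_smul]

theorem IsCE.aug_ctr_ctr_d (hd : IsCE e d) {p q n : ℕ} (h : p + q = n) (x : F p) (y : F q)
    {a : Lambda V} (ha : a ∈ wordLength V 1) : Lambda.aug (ctr e y (ctr e x (d a))) =
      (-1 : ℚ) ^ (p * q + p) * Lambda.aug (ctr e (br h x y) a) := by
  rw [hd.ctr_d x ha, map_smul, map_smul, hd.aug_ctr_lieDer h, smul_eq_mul, ← mul_assoc, ← pow_add,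
    add_comm p]

/-! ## The degree derivation -/

/-- Homogeneous elements of `Λ²V` are determined by the contractions of complementary degrees. -/
theorem IsCE.eq_of_two_of_degree (hd : IsCE e d) {E : Lambda V →ₗ[ℚ] Lambda V} (hE : IsDer 0 E)
    (hE' : ∀ n (v : V n), E (gen n v) = (n : ℚ) • gen n v) {N : ℕ} {a b : Lambda V}
    (ha : a ∈ wordLength V 2) (hb : b ∈ wordLength V 2) (ha' : E a = (N : ℚ) • a)
    (hb' : E b = (N : ℚ) • b) (h : ∀ p q (_ : p + q = N) (x : F p) (y : F q),
      Lambda.aug (ctr e y (ctr e x a)) = Lambda.aug (ctr e y (ctr e x b))) : a = b := by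
  refine hd.eq_of_two ha hb fun p q x y => ?_
  by_cases hpq : p + q = N
  · exact h p q hpq x y
  · have key : ∀ c : Lambda V, E c = (N : ℚ) • c → Lambda.aug (ctr e y (ctr e x c)) = 0 := by
      intro c hc
      have h1 := hE.aug_ctr_ctr_of_degree hE' (e := e) x y c
      rw [hc, map_smul, map_smul, map_smul, smul_eq_mul] at h1
      have h2 : ((p : ℚ) + q - N) ≠ 0 := by
        rw [sub_ne_zero]; exact_mod_cast hpq
      refine (mul_eq_zero.1 ?_).resolve_left h2
      linarith
    rw [key a ha', key b hb']

theorem IsCE.degree_d (hd : IsCE e d) {E : Lambda V →ₗ[ℚ] Lambda V} (hE : IsDer 0 E)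
    (hE' : ∀ n (v : V n), E (gen n v) = (n : ℚ) • gen n v) (a : Lambda V) :
    E (d a) = d (E a) := by
  have key := IsDer.ext (hE.comm hd.der) (IsDer.zero _) fun n v => by
    simp only [LinearMap.sub_apply, LinearMap.comp_apply, hE', map_smul,
      zero_mul, pow_zero, one_smul, LinearMap.zero_apply, sub_eq_zero]
    have h1 := hd.quadratic n v
    refine hd.eq_of_two (hE.mem_wordLength_of_one (fun n v => by
      rw [hE']; exact Submodule.smul_mem _ _ (gen_mem_wordLength v)) h1) (Submodule.smul_mem _ _ h1)
      fun p q x y => ?_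
    rw [hE.aug_ctr_ctr_of_degree hE', map_smul, map_smul, map_smul, smul_eq_mul]
    by_cases hpq : p + q = n
    · have h2 : (p : ℚ) + q = n := by exact_mod_cast hpq
      rw [h2]
    · rw [hd.bracket_ne hpq]; simp
  have := LinearMap.congr_fun key a
  simpa [sub_eq_zero] using this

theorem IsCE.lieDer_degree (hd : IsCE e d) {E : Lambda V →ₗ[ℚ] Lambda V} (hE : IsDer 0 E)
    (hE' : ∀ n (v : V n), E (gen n v) = (n : ℚ) • gen n v) {p : ℕ} (x : F p) (a : Lambda V) :
    lieDer e d x (E a) = E (lieDer e d x a) + (p : ℚ) • lieDer e d x a := by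
  rw [lieDer_apply, lieDer_apply, ← hd.degree_d hE hE', hE.comm_ctr_of_degree hE', hE.comm_ctr_of_degree hE', map_add, map_add,
    hd.degree_d hE hE', map_smul, map_smul]
  module

end Cocycle

section Free

variable {T : ℕ → Type w} [∀ n, AddCommGroup (T n)] [∀ n, Module ℚ (T n)]
variable {e : ∀ n, FreeLie T n →ₗ[ℚ] Module.Dual ℚ (V n)} {d : Lambda V →ₗ[ℚ] Lambda V}

/-! ## The homotopy for a free Lie algebra -/

/-- `η` is the twisted derivation with values in `(ΛV)^∨` that vanishes on the generators, for the
cocycle defined by the square of the Euler derivation. -/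
structure IsTwist (e : ∀ n, FreeLie T n →ₗ[ℚ] Module.Dual ℚ (V n)) (d : Lambda V →ₗ[ℚ] Lambda V)
    (η : ∀ n, FreeLie T n →ₗ[ℚ] Module.Dual ℚ (Lambda V)) : Prop where
  of : ∀ n t, η n (FreeLie.of n t) = 0
  br : ∀ {p q n} (h : p + q = n) (x : FreeLie T p) (y : FreeLie T q) a,
    η n (br h x y) a = η q y (parityPow p (lieDer e d x a)) -
      (-1 : ℚ) ^ (p * q) * η p x (parityPow q (lieDer e d y a)) +
      2 * ((-1 : ℚ) ^ (p * q + q) *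
        Lambda.aug (ctr e (FreeLie.euler q y) (ctr e (FreeLie.euler p x) a)))

/-- The cocycle is twice the invariant skew form at (θx, θy); it is a cocycle because θ is a
derivation. It mirrors the failure of θ² to be one: θ²[x,y] = [θ²x, y] + 2 [θx, θy] + [x, θ²y]. -/
theorem IsCE.exists_isTwist (hd : IsCE e d) : ∃ η, IsTwist e d η := by
  obtain ⟨η, h1, h2⟩ := FreeLie.exists_twistedDerivation (T := T)
    (M := fun _ => Module.Dual ℚ (Lambda V)) (fun {i _ _} _ => coact e d i)
    (fun hij _ _ _ _ _ x y a => hd.coact_br hij x y a)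
    (fun {i j _} _ => (2 : ℚ) • (pairForm e i j).compl₁₂ (FreeLie.euler i) (FreeLie.euler j))
    (fun {i j _} _ _ x y => by
      simp only [LinearMap.smul_apply, LinearMap.compl₁₂_apply]
      rw [smul_comm _ (2 : ℚ), ← smul_add, pairForm_skew, smul_zero])
    (fun {i j k ij jk ik m} hij hjk hik _ _ _ _ x y z => by
      have hkj : k + j = jk := by omega
      have hki : k + i = ik := by omega
      have hji : j + i = ij := by omega
      simp only [LinearMap.smul_apply, LinearMap.compl₁₂_apply, map_smul, FreeLie.euler_br]
      rw [hd.coact_pairForm hij hik x, hd.coact_pairForm hki hkj z, hd.coact_pairForm hji hjk y]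
      simp only [map_add, LinearMap.add_apply, smul_add]
      rw [eq_neg_of_add_eq_zero_left (skew hki hik z (FreeLie.euler i x)),
        eq_neg_of_add_eq_zero_left (skew hkj hjk z (FreeLie.euler j y)),
        eq_neg_of_add_eq_zero_left (skew hji hij y (FreeLie.euler i x))]
      simp only [map_neg, map_smul, LinearMap.neg_apply, LinearMap.smul_apply]
      rw [eq_neg_of_add_eq_zero_left (pairForm_skew e (br hik (FreeLie.euler i x) z)
        (FreeLie.euler j y))]
      have e1 : (-1 : ℚ) ^ (ij * k) = (-1) ^ (i * k) * (-1) ^ (j * k) := by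
        rw [← hij, add_mul, pow_add]
      have e2 : (-1 : ℚ) ^ (ik * j) = (-1) ^ (i * j) * (-1) ^ (j * k) := by
        rw [← hik, add_mul, pow_add, mul_comm k j]
      rw [e1, e2, mul_comm k i, mul_comm k j, mul_comm j i]
      rcases neg_one_pow_eq_or ℚ (i * j) with h1 | h1 <;>
        rcases neg_one_pow_eq_or ℚ (i * k) with h2 | h2 <;>
        rcases neg_one_pow_eq_or ℚ (j * k) with h3 | h3 <;> rw [h1, h2, h3] <;> module)
    (fun _ => 0)
  refine ⟨η, fun n t => h1 n t, fun {p q n} h x y a => ?_⟩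
  rw [h2 h (by omega)]
  rfl

end Free

end FreeHomotopy
end EnrichedLie
end

/-! ### The homotopy dH + Hd = W² − W. -/

noncomputable section
namespace EnrichedLie

section FreeHomotopy

open GradedLie

variable {V : ℕ → Type u} [∀ n, AddCommGroup (V n)] [∀ n, Module ℚ (V n)]
variable {T : ℕ → Type w} [∀ n, AddCommGroup (T n)] [∀ n, Module ℚ (T n)]
variable {e : ∀ n, FreeLie T n →ₗ[ℚ] Module.Dual ℚ (V n)} {d : Lambda V →ₗ[ℚ] Lambda V}
variable {η : ∀ n, FreeLie T n →ₗ[ℚ] Module.Dual ℚ (Lambda V)}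

theorem exists_degreeDer : ∃ E : Lambda V →ₗ[ℚ] Lambda V, IsDer 0 E ∧
    ∀ n (v : V n), E (gen n v) = (n : ℚ) • gen n v := by
  obtain ⟨E, hE, hE'⟩ := exists_weightDer (V := V) fun n => (n : ℚ) • LinearMap.id
  exact ⟨E, hE, fun n v => by rw [hE', LinearMap.smul_apply, map_smul]; rfl⟩

/-- The coadjoint module is ungraded, with all of (ΛV)^∨ placed in every degree. Homogeneity of η is
recovered here through E: η vanishes on generators, and its recursion involves only homogeneous
operations. -/
theorem IsTwist.degree (hd : IsCE e d) (hη : IsTwist e d η) {E : Lambda V →ₗ[ℚ] Lambda V}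
    (hE : IsDer 0 E) (hE' : ∀ n (v : V n), E (gen n v) = (n : ℚ) • gen n v) {p : ℕ}
    (x : FreeLie T p) : ∀ a, η p x (E a) = (p : ℚ) * η p x a := by
  have hpar : ∀ l a, parityPow l (E a) = E (parityPow l a) := fun l a => by
    rw [hE.map_parityPow, zero_mul, pow_zero, one_smul]
  induction x using FreeLie.induction with
  | of n t => intro a; simp [hη.of]
  | zero n => intro a; simp
  | add n x y hx hy => intro a; rw [map_add, LinearMap.add_apply, hx, hy, LinearMap.add_apply, mul_add]
  | smul n c x hx => intro a; rw [map_smul, LinearMap.smul_apply, hx, LinearMap.smul_apply, smul_eq_mul, smul_eq_mul]; ring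
  | @br p q n h x y hx hy =>
    intro a
    have hn : (n : ℚ) = p + q := by rw [← h]; push_cast; rfl
    rw [hη.br, hη.br, hd.lieDer_degree hE hE', hd.lieDer_degree hE hE',
      hE.aug_ctr_ctr_of_degree hE', map_add (parityPow p), map_add (parityPow q), hpar, hpar,
      map_add, map_add, hx, hy, map_smul, map_smul, map_smul, map_smul, hn, smul_eq_mul,
      smul_eq_mul]
    ring

theorem IsTwist.apply_eq_zero (hd : IsCE e d) (hη : IsTwist e d η) {p m n : ℕ} (h : p ≠ m + n)
    (x : FreeLie T p) (v : V m) (w : V n) : η p x (gen m v * gen n w) = 0 := by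
  obtain ⟨E, hE, hE'⟩ := exists_degreeDer (V := V)
  have h1 := hη.degree hd hE hE' x (gen m v * gen n w)
  rw [hE.gen_mul, hE', hE', zero_mul, pow_zero, one_smul, smul_mul_assoc, mul_smul_comm, ← add_smul,
    map_smul, smul_eq_mul] at h1
  have h2 : ((m : ℚ) + n - p) ≠ 0 := by
    rw [sub_ne_zero]; exact_mod_cast h.symm
  refine (mul_eq_zero.1 ?_).resolve_left h2
  linarith

/-- The transpose of the identity Hd = W² − W on V. As functions of x both sides vanish on T and
obey the same rule on brackets, the cocycle accounting for the cross term 2 [θx, θy]. -/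
theorem IsTwist.apply_d (hd : IsCE e d) (hη : IsTwist e d η) {p : ℕ} (x : FreeLie T p) :
    ∀ {u : Lambda V}, u ∈ wordLength V 1 → η p x (d u) = (-1 : ℚ) ^ p *
      Lambda.aug (ctr e (FreeLie.euler p (FreeLie.euler p x) - FreeLie.euler p x) u) := by
  induction x using FreeLie.induction with
  | of n t => intro u hu; rw [hη.of, FreeLie.euler_of, FreeLie.euler_of, sub_self]; simp [ctr]
  | zero n => intro u hu; simp [ctr]
  | add n x y hx hy =>
    intro u hu
    rw [map_add, LinearMap.add_apply, hx hu, hy hu, map_add, map_add, add_sub_add_comm, ctr_add,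
      LinearMap.add_apply, map_add, mul_add]
  | smul n c x hx =>
    intro u hu
    rw [map_smul, LinearMap.smul_apply, hx hu, map_smul, map_smul, ← smul_sub, ctr_smul,
      LinearMap.smul_apply, map_smul, smul_eq_mul, smul_eq_mul]
    ring
  | @br p q n h x y hx hy =>
    intro u hu
    have h' : q + p = n := by omega
    -- The action of x on η y can be evaluated at d u because L_x commutes with d up to sign; the
    -- induction hypothesis then applies to L_x u in V.
    have key : ∀ {p q n : ℕ} (h : p + q = n) (x : FreeLie T p) (y : FreeLie T q),
        (∀ {u : Lambda V}, u ∈ wordLength V 1 → η q y (d u) = (-1 : ℚ) ^ q *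
          Lambda.aug (ctr e (FreeLie.euler q (FreeLie.euler q y) - FreeLie.euler q y) u)) →
        η q y (parityPow p (lieDer e d x (d u))) = (-1 : ℚ) ^ (p + q) * Lambda.aug (ctr e
          (GradedLie.br h x (FreeLie.euler q (FreeLie.euler q y) - FreeLie.euler q y)) u) := by
      intro p q n h x y hy
      have h1 : parityPow p (lieDer e d x (d u)) = d (parityPow p (lieDer e d x u)) := by
        rw [hd.der.map_parityPow, hd.d_lieDer, map_smul, smul_smul, one_mul, ← pow_add,
          Even.neg_one_pow ⟨_, rfl⟩, one_smul]
      have h2 : ∀ z : FreeLie T q, Lambda.aug (ctr e z (parityPow p (lieDer e d x u))) =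
          (-1 : ℚ) ^ ((q + 1) * p) * Lambda.aug (ctr e z (lieDer e d x u)) := fun z => by
        rw [ctr, (contraction_isDer q (e q z)).map_parityPow, map_smul, aug_parityPow, smul_eq_mul]
      rw [h1, hy (parityPow_mem (hd.lieDer_mem x hu)), h2, hd.aug_ctr_lieDer h]
      rcases neg_one_pow_eq_or ℚ p with hp | hp <;> rcases neg_one_pow_eq_or ℚ q with hq | hq <;>
        simp [pow_add, pow_mul, add_mul, hp, hq]
    have h3 : GradedLie.br h' y (FreeLie.euler p (FreeLie.euler p x) - FreeLie.euler p x) =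
        -((-1 : ℚ) ^ (q * p) • GradedLie.br h (FreeLie.euler p (FreeLie.euler p x) - FreeLie.euler p x) y) :=
      eq_neg_of_add_eq_zero_left (skew h' h _ _)
    have h4 : ∀ {n : ℕ} (x : FreeLie T n), ctr e (-x) = -ctr e x := fun x => by
      rw [ctr, map_neg, map_neg]
    rw [hη.br, key h x y hy, key h' y x hx, hd.aug_ctr_ctr_d h _ _ hu, h3, h4, ctr_smul]
    simp only [FreeLie.euler_br, map_add, sub_eq_add_neg, ctr_add, h4, LinearMap.add_apply, LinearMap.neg_apply,
      map_neg, LinearMap.smul_apply, map_smul, smul_eq_mul]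
    have hn : (-1 : ℚ) ^ n = (-1) ^ p * (-1) ^ q := by rw [← h, pow_add]
    rcases neg_one_pow_eq_or ℚ p with hp | hp <;> rcases neg_one_pow_eq_or ℚ q with hq | hq <;>
        simp [hn, pow_add, pow_mul, hp, hq] <;> ring

theorem aug_ctr_ctr_gen_mul_gen {F : ℕ → Type w} [∀ n, AddCommGroup (F n)] [∀ n, Module ℚ (F n)]
    (e : ∀ n, F n →ₗ[ℚ] Module.Dual ℚ (V n)) {p q m n : ℕ} (x : F p) (y : F q) (v : V m) (w : V n) :
    Lambda.aug (ctr e y (ctr e x (gen m v * gen n w))) =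
      Lambda.aug (ctr e x (gen m v)) * Lambda.aug (ctr e y (gen n w)) +
        (-1 : ℚ) ^ ((p + 1) * (m + 1)) *
          (Lambda.aug (ctr e y (gen m v)) * Lambda.aug (ctr e x (gen n w))) := by
  have h : ∀ {r k : ℕ} (z : F r) (u : V k), ctr e z (gen k u) =
      algebraMap ℚ _ (Lambda.aug (ctr e z (gen k u))) := fun {r k} z u => by
    rw [ctr, contraction_gen, aug_algebraMap]
  rw [ctr, ctr, (contraction_isDer p (e p x)).gen_mul, map_add, map_smul, map_add, map_smul]
  change Lambda.aug (ctr e y (ctr e x (gen m v) * gen n w)) + _ •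
    Lambda.aug (ctr e y (gen m v * ctr e x (gen n w))) = _
  rw [h x v, h x w, ← Algebra.smul_def, ← Algebra.commutes, ← Algebra.smul_def, map_smul, map_smul,
    map_smul, map_smul, smul_eq_mul, smul_eq_mul, smul_eq_mul, aug_algebraMap, aug_algebraMap]
  ring

section Operators

variable {B : ∀ m n, V m →ₗ[ℚ] V n →ₗ[ℚ] V (m + n)}

theorem IsTwist.aug_ctr (hd : IsCE e d) (hη : IsTwist e d η)
    (hB : ∀ m n v w x, e (m + n) x (B m n v w) = (-1 : ℚ) ^ (m + n) * η (m + n) x (gen m v * gen n w))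
    {p m n : ℕ} (x : FreeLie T p) (v : V m) (w : V n) :
    Lambda.aug (ctr e x (gen (m + n) (B m n v w))) = (-1 : ℚ) ^ p * η p x (gen m v * gen n w) := by
  by_cases h : p = m + n
  · subst h
    rw [ctr, contraction_gen_self, aug_algebraMap, hB]
  · rw [ctr, contraction_gen_ne (Ne.symm h), hη.apply_eq_zero hd h]; simp

variable {D : ∀ m, V m →ₗ[ℚ] Module.End ℚ (Lambda V)}

theorem IsTwist.aug_ctr_der (hd : IsCE e d) (hη : IsTwist e d η)
    (hB : ∀ m n v w x, e (m + n) x (B m n v w) = (-1 : ℚ) ^ (m + n) * η (m + n) x (gen m v * gen n w))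
    (hD' : ∀ m v n w, D m v (gen n w) = gen (m + n) (B m n v w))
    {p m : ℕ} (x : FreeLie T p) (v : V m) {u : Lambda V} (hu : u ∈ wordLength V 1) :
    Lambda.aug (ctr e x (D m v u)) = (-1 : ℚ) ^ p * η p x (gen m v * u) :=
  eq_of_mem_wordLength_one (f := Lambda.aug ∘ₗ ctr e x ∘ₗ D m v)
    (g := (-1 : ℚ) ^ p • (η p x ∘ₗ LinearMap.mulLeft ℚ (gen m v)))
    (fun n w => by
      simp only [LinearMap.comp_apply, LinearMap.smul_apply, LinearMap.mulLeft_apply, hD',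
        smul_eq_mul]
      exact hη.aug_ctr hd hB x v w) hu

/-- The commutator C of i_x and D_v is a derivation with scalar values on V, so it commutes with i_y
up to sign. One term comes from C past i_y, the other from D_v past i_x. -/
theorem IsTwist.aug_ctr_ctr_der (hd : IsCE e d) (hη : IsTwist e d η)
    (hB : ∀ m n v w x, e (m + n) x (B m n v w) = (-1 : ℚ) ^ (m + n) * η (m + n) x (gen m v * gen n w))
    (hD : ∀ m v, IsDer m (D m v)) (hD' : ∀ m v n w, D m v (gen n w) = gen (m + n) (B m n v w))
    {p q m : ℕ} (x : FreeLie T p) (y : FreeLie T q) (v : V m) {b : Lambda V}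
    (hb : b ∈ wordLength V 2) : Lambda.aug (ctr e y (ctr e x (D m v b))) =
      (-1 : ℚ) ^ ((q + 1) * (p + 1 + m) + p) * η p x (gen m v * ctr e y b) +
      (-1 : ℚ) ^ ((p + 1) * m + q) * η q y (gen m v * ctr e x b) := by
  have hC := (contraction_isDer p (e p x)).comm (hD m v)
  set C := contraction p (e p x) ∘ₗ D m v - (-1 : ℚ) ^ ((p + 1) * m) • D m v ∘ₗ contraction p (e p x) with hC'
  have hCa : ∀ a, ctr e x (D m v a) = C a + (-1 : ℚ) ^ ((p + 1) * m) • D m v (ctr e x a) := fun a => by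
    rw [hC']; simp [ctr]
  have hCg : ∀ n w, C (gen n w) = ctr e x (D m v (gen n w)) := fun n w => by
    rw [hCa, ctr, contraction_gen, (hD m v).algebraMap, smul_zero, add_zero]
  have hCs : ∀ n w, ∃ c, C (gen n w) = algebraMap ℚ _ c := fun n w => by
    rw [hCg, hD', ctr, contraction_gen]; exact ⟨_, rfl⟩
  have hC1 : ∀ {u : Lambda V}, u ∈ wordLength V 1 → Lambda.aug (C u) = (-1 : ℚ) ^ p * η p x (gen m v * u) := by
    intro u hu
    rw [← hη.aug_ctr_der hd hB hD' x v hu]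
    refine eq_of_mem_wordLength_one (f := Lambda.aug ∘ₗ C) (g := Lambda.aug ∘ₗ ctr e x ∘ₗ D m v)
      (fun n w => ?_) hu
    simp only [LinearMap.comp_apply, hCg]
  have key := IsDer.ext ((contraction_isDer q (e q y)).comm hC) (IsDer.zero _) fun n w => by
    obtain ⟨c, hc⟩ := hCs n w
    simp only [LinearMap.sub_apply, LinearMap.smul_apply, LinearMap.comp_apply, hc, contraction_gen,
      hC.algebraMap, (contraction_isDer q (e q y)).algebraMap, smul_zero, sub_zero, LinearMap.zero_apply]
  have h1 := LinearMap.congr_fun key b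
  simp only [LinearMap.sub_apply, LinearMap.smul_apply, LinearMap.comp_apply, LinearMap.zero_apply,
    sub_eq_zero] at h1
  rw [hCa, map_add, map_smul, map_add, map_smul, hη.aug_ctr_der hd hB hD' y v (contraction_mem _ hb)]
  change Lambda.aug (contraction q (e q y) (C b)) + _ = _
  rw [h1, map_smul, hC1 (contraction_mem _ hb), smul_eq_mul, smul_eq_mul, pow_add _ _ p, pow_add _ _ q, ctr]
  ring

/-- η x only sees the product v w, which is graded commutative. -/
theorem IsTwist.der_symm (hd : IsCE e d) (hη : IsTwist e d η)
    (hB : ∀ m n v w x, e (m + n) x (B m n v w) = (-1 : ℚ) ^ (m + n) * η (m + n) x (gen m v * gen n w))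
    (hD' : ∀ m v n w, D m v (gen n w) = gen (m + n) (B m n v w)) (m n : ℕ) (v : V m) (w : V n) :
    D m v (gen n w) = (-1 : ℚ) ^ ((m + 1) * (n + 1)) • D n w (gen m v) := by
  refine hd.eq_of_one (by rw [hD']; exact gen_mem_wordLength _)
    (Submodule.smul_mem _ _ (by rw [hD']; exact gen_mem_wordLength _)) fun p x => ?_
  rw [map_smul, map_smul, hD', hD', hη.aug_ctr hd hB, hη.aug_ctr hd hB, gen_comm, map_smul,
    smul_eq_mul, smul_eq_mul]
  ring

/-- Paired with x and y, the first term on the left becomes η[x,y] on v w, the other two become the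
actions of x on η y and of y on η x, and the right side becomes the cocycle: the identity is the
recursion for η. By homogeneity only x, y of total degree m + n matter. -/
theorem IsTwist.d_der (hd : IsCE e d) (hη : IsTwist e d η)
    (hB : ∀ m n v w x, e (m + n) x (B m n v w) = (-1 : ℚ) ^ (m + n) * η (m + n) x (gen m v * gen n w))
    (hD : ∀ m v, IsDer m (D m v)) (hD' : ∀ m v n w, D m v (gen n w) = gen (m + n) (B m n v w))
    {wt : ∀ n, V n →ₗ[ℚ] V n} (hwt : ∀ n v x, e n x (wt n v) = e n (FreeLie.euler n x) v)
    (m n : ℕ) (v : V m) (w : V n) : d (D m v (gen n w)) + (-1 : ℚ) ^ (m + 1) • D m v (d (gen n w)) +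
      (-1 : ℚ) ^ (m * (n + 1)) • D n w (d (gen m v)) =
      (2 : ℚ) • (gen m (wt m v) * gen n (wt n w)) := by
  obtain ⟨E, hE, hE'⟩ := exists_degreeDer (V := V)
  have hD1 : ∀ m v n w, D m v (gen n w) ∈ wordLength V 1 := fun m v n w => by
    rw [hD']; exact gen_mem_wordLength _
  have hED : ∀ m v a, E (D m v a) = D m v (E a) + (m : ℚ) • D m v a := by
    intro m v a
    have key := IsDer.ext (hE.comm (hD m v)) (((hD m v).congr_parity (l := 0 + m) (by simp)).smul (m : ℚ))
      fun n w => by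
        simp only [LinearMap.sub_apply, LinearMap.smul_apply, LinearMap.comp_apply, hE', hD',
          map_smul, zero_mul, pow_zero, one_smul]
        push_cast; module
    have := LinearMap.congr_fun key a
    simp only [LinearMap.sub_apply, LinearMap.smul_apply, LinearMap.comp_apply, zero_mul, pow_zero,
      one_smul] at this
    rw [← this]; abel
  have hdE : ∀ m v n w, E (D m v (d (gen n w))) = ((m : ℚ) + n) • D m v (d (gen n w)) := by
    intro m v n w
    rw [hED, hd.degree_d hE hE', hE', map_smul, map_smul]; module
  have hq := hd.quadratic
  refine hd.eq_of_two_of_degree hE hE' (N := m + n) ?_ ?_ ?_ ?_ fun p q hpq x y => ?_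
  · exact add_mem (add_mem (hd.der.mem_wordLength hq (hD1 m v n w))
      (Submodule.smul_mem _ _ ((hD m v).mem_wordLength_of_one (hD1 m v) (hq n w))))
      (Submodule.smul_mem _ _ ((hD n w).mem_wordLength_of_one (hD1 n w) (hq m v)))
  · exact Submodule.smul_mem _ _ (gen_mul_gen_mem_wordLength _ _)
  · rw [map_add, map_add, map_smul, map_smul, hdE, hdE, hd.degree_d hE hE', hED, hE', map_smul,
      map_add, map_smul, map_smul]
    push_cast; module
  · rw [map_smul, hE.gen_mul, hE', hE', zero_mul, pow_zero, one_smul, smul_mul_assoc, mul_smul_comm]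
    push_cast; module
  · have hc : ∀ {r k : ℕ} (z : FreeLie T r) (u : V k), Lambda.aug (ctr e z (gen k (wt k u))) =
        Lambda.aug (ctr e (FreeLie.euler r z) (gen k u)) := by
      intro r k z u
      by_cases h : k = r
      · subst h
        rw [ctr, ctr, contraction_gen_self, contraction_gen_self, hwt]
      · rw [ctr, ctr, contraction_gen_ne h, contraction_gen_ne h]
    have ht : Lambda.aug (ctr e y (ctr e x (gen m (wt m v) * gen n (wt n w)))) =
        Lambda.aug (ctr e (FreeLie.euler q y) (ctr e (FreeLie.euler p x) (gen m v * gen n w))) := by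
      rw [aug_ctr_ctr_gen_mul_gen, aug_ctr_ctr_gen_mul_gen, hc, hc, hc, hc]
    have hL : ∀ {r : ℕ} (z : FreeLie T r), lieDer e d z (gen m v * gen n w) =
        (-1 : ℚ) ^ ((r + m + 1) * (n + 1) + r) • (gen n w * ctr e z (d (gen m v))) +
        (-1 : ℚ) ^ (r * (m + 1) + r) • (gen m v * ctr e z (d (gen n w))) := by
      intro r z
      rw [(hd.lieDer_isDer z).gen_mul, mul_gen_of_parity (e := r + m + 1)
        (by rw [(hd.lieDer_isDer z).parity_gen, add_right_comm, add_comm m]), hd.lieDer_gen, hd.lieDer_gen,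
        mul_smul_comm, mul_smul_comm, smul_smul, smul_smul, ← pow_add, ← pow_add]
    have hP : ∀ (l : ℕ) {r : ℕ} (z : FreeLie T r), parityPow l (lieDer e d z (gen m v * gen n w)) =
        (-1 : ℚ) ^ (l * (r + m + n)) • lieDer e d z (gen m v * gen n w) := by
      intro l r z
      refine parityPow_eq_of_parity ?_
      rw [(hd.lieDer_isDer z).parity, parity_gen_mul, parity_gen, mul_smul_comm, map_smul,
        map_smul, smul_smul, smul_smul, ← pow_add, ← pow_add]
      exact congrArg (· • _) (neg_one_pow_eq_of_parity (by simp only [Nat.even_add, Nat.even_add_one]; tauto))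
    have h1 : Lambda.aug (ctr e y (ctr e x (d (D m v (gen n w))))) = (-1 : ℚ) ^ (p * q + q) *
        η (p + q) (GradedLie.br rfl x y) (gen m v * gen n w) := by
      rw [hd.aug_ctr_ctr_d rfl x y (hD1 m v n w), hD', hη.aug_ctr hd hB, ← mul_assoc, ← pow_add]
      congr 1
      exact neg_one_pow_eq_of_parity (by simp [Nat.even_add]; tauto)
    simp only [map_add, map_smul]
    rw [h1, hη.aug_ctr_ctr_der hd hB hD hD' x y v (hq n w), hη.aug_ctr_ctr_der hd hB hD hD' x y w (hq m v),
      ht, hη.br, hP, hP, hL, hL]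
    simp only [map_add, map_smul, smul_eq_mul]
    have hs : (-1 : ℚ) ^ p * (-1) ^ q = (-1) ^ m * (-1) ^ n := by rw [← pow_add, ← pow_add, hpq]
    rcases neg_one_pow_eq_or ℚ p with hp | hp <;> rcases neg_one_pow_eq_or ℚ q with hq | hq <;>
      rcases neg_one_pow_eq_or ℚ m with hm | hm <;> rcases neg_one_pow_eq_or ℚ n with hn | hn <;>
      (rw [hp, hq, hm, hn] at hs; norm_num at hs) <;>
      simp only [pow_add, pow_mul, mul_add, add_mul, mul_one, one_mul, hp, hq, hm, hn, pow_one, one_pow] <;> ring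

end Operators

/-- `secondOrder_homotopy` leaves a check on V, which is the transpose of `IsTwist.apply_d`, and one
on pairs of generators, which is `IsTwist.d_der`. -/
theorem IsTwist.exists_homotopy (hd : IsCE e d) (hη : IsTwist e d η)
    {B : ∀ m n, V m →ₗ[ℚ] V n →ₗ[ℚ] V (m + n)}
    (hB : ∀ m n v w x, e (m + n) x (B m n v w) = (-1 : ℚ) ^ (m + n) * η (m + n) x (gen m v * gen n w))
    {wt : ∀ n, V n →ₗ[ℚ] V n} (hwt : ∀ n v x, e n x (wt n v) = e n (FreeLie.euler n x) v) :
    ∃ W H : Lambda V →ₗ[ℚ] Lambda V, IsDer 0 W ∧ (∀ n v, W (gen n v) = gen n (wt n v)) ∧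
      ∀ a, d (H a) + H (d a) = W (W a) - W a := by
  obtain ⟨D, hD, hD'⟩ := exists_derFamily B
  obtain ⟨H, hH1, hH⟩ := exists_secondOrder D hD (hη.der_symm hd hB hD')
  obtain ⟨W, hW, hW'⟩ := exists_weightDer wt
  have hHg : ∀ n (w : V n), H (gen n w) = 0 := fun n w => by
    rw [← mul_one (gen n w), hH, hH1, (hD n w).one]; simp
  refine ⟨W, H, hW, hW', secondOrder_homotopy hD hH1 hH hd.der hW (fun n v => ?_) fun m n v w => ?_⟩
  · have h2 : ∀ {z : Lambda V}, z ∈ wordLength V 2 → H z ∈ wordLength V 1 := by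
      intro z hz
      refine wordLength_succ_induction (p := fun z => H z ∈ wordLength V 1) (fun n v a ha => ?_)
        (by simp) (fun a b ha hb => by rw [map_add]; exact add_mem ha hb)
        (fun c a ha => by rw [map_smul]; exact Submodule.smul_mem _ _ ha) hz
      have : H a = 0 := eq_of_mem_wordLength_one (f := H) (g := 0) (fun n w => hHg n w) ha
      rw [hH, this, mul_zero, smul_zero, add_zero]
      exact (hD n v).mem_wordLength_of_one (fun k w => by rw [hD']; exact gen_mem_wordLength _) ha
    have h3 : ∀ {p : ℕ} (x : FreeLie T p) {z : Lambda V}, z ∈ wordLength V 2 →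
        Lambda.aug (ctr e x (H z)) = (-1 : ℚ) ^ p * η p x z := fun {p} x z hz =>
      eq_of_mem_wordLength_two (f := Lambda.aug ∘ₗ ctr e x ∘ₗ H) (g := (-1 : ℚ) ^ p • η p x)
        (fun m n v w => by
          simp only [LinearMap.comp_apply, LinearMap.smul_apply, hH, hHg, hD', mul_zero, smul_zero, add_zero, smul_eq_mul]
          exact hη.aug_ctr hd hB x v w) hz
    rw [hW', hW', ← map_sub]
    refine hd.eq_of_one (h2 (hd.quadratic n v)) (gen_mem_wordLength _) fun p x => ?_
    rw [h3 x (hd.quadratic n v), hη.apply_d hd x (gen_mem_wordLength v), ← mul_assoc, ← pow_add,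
      Even.neg_one_pow ⟨p, rfl⟩, one_mul]
    by_cases h : n = p
    · subst h
      simp only [ctr]
      rw [contraction_gen_self, contraction_gen_self, aug_algebraMap, aug_algebraMap, map_sub,
        map_sub, hwt, hwt, hwt, LinearMap.sub_apply]
    · simp only [ctr]
      rw [contraction_gen_ne h, contraction_gen_ne h]
  · rw [hW', hW', hη.d_der hd hB hD hD' hwt]

end FreeHomotopy
end EnrichedLie
end

/-! ### Weights: from the homotopy to the vanishing of cohomology. -/

noncomputable section
namespace EnrichedLie

section Weights

open GradedLie

variable {V : ℕ → Type u} [∀ n, AddCommGroup (V n)] [∀ n, Module ℚ (V n)]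

/-! ## Weight decompositions -/

/-- On an eigenvector q(W) is a nonzero scalar. The inverse of q(W) on a given vector is thus a
polynomial in W, so it commutes with everything that commutes with W. -/
theorem Module.End.exists_aeval_mul_eq {M : Type u} [AddCommGroup M] [Module ℚ M] (W : Module.End ℚ M)
    (q : Polynomial ℚ) {a : M}
    (ha : a ∈ Submodule.span ℚ {a | ∃ r : ℚ, q.eval r ≠ 0 ∧ W a = r • a}) :
    ∃ p : Polynomial ℚ, Polynomial.aeval W (q * p) a = a := by
  have hev : ∀ (r : ℚ) a, W a = r • a → ∀ p : Polynomial ℚ,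
      Polynomial.aeval W p a = p.eval r • a := by
    intro r a hra p
    induction p using Polynomial.induction_on with
    | C c => simp
    | add p q hp hq => rw [map_add, LinearMap.add_apply, hp, hq, Polynomial.eval_add, add_smul]
    | monomial n c h =>
      rw [pow_succ, ← mul_assoc, map_mul, Module.End.mul_apply, Polynomial.aeval_X, hra, map_smul, h,
        smul_smul, mul_comm, ← Polynomial.eval_mul_X]
  refine Submodule.span_induction
    (p := fun a _ => ∃ p : Polynomial ℚ, Polynomial.aeval W (q * p) a = a) ?_ ⟨0, by simp⟩ ?_ ?_ ha
  · rintro a ⟨r, hr, hra⟩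
    refine ⟨Polynomial.C (q.eval r)⁻¹, ?_⟩
    rw [hev r a hra, Polynomial.eval_mul, Polynomial.eval_C, mul_inv_cancel₀ hr, one_smul]
  · rintro a b - - ⟨p, hp⟩ ⟨s, hs⟩
    -- Chosen so that 1 − q (p + s − q p s) = (1 − q p)(1 − q s), which kills both a and b.
    refine ⟨p + s - q * p * s, ?_⟩
    have h1 : q * (p + s - q * p * s) = q * p + q * s - (q * p) * (q * s) := by ring
    have h2 : (q * p) * (q * s) = (q * s) * (q * p) := by ring
    have h3 : Polynomial.aeval W ((q * p) * (q * s)) a = Polynomial.aeval W (q * s) a := by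
      rw [h2, map_mul _ (q * s), Module.End.mul_apply, hp]
    have h4 : Polynomial.aeval W ((q * p) * (q * s)) b = Polynomial.aeval W (q * p) b := by
      rw [map_mul _ (q * p), Module.End.mul_apply, hs]
    rw [h1, map_add, map_sub, map_add, LinearMap.sub_apply, LinearMap.sub_apply,
      LinearMap.add_apply, LinearMap.add_apply, hp, hs, h3, h4]
    abel
  · rintro c a - ⟨p, hp⟩
    exact ⟨p, by rw [map_smul, hp]⟩

theorem commute_aeval {M : Type u} [AddCommGroup M] [Module ℚ M] {W d : Module.End ℚ M}
    (h : ∀ a, d (W a) = W (d a)) (p : Polynomial ℚ) (a : M) :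
    d (Polynomial.aeval W p a) = Polynomial.aeval W p (d a) := by
  induction p using Polynomial.induction_on generalizing a with
  | C c => simp
  | add p q hp hq => rw [map_add, LinearMap.add_apply, map_add, hp, hq, LinearMap.add_apply]
  | monomial n c hc =>
    rw [pow_succ, ← mul_assoc, map_mul, Module.End.mul_apply, Module.End.mul_apply, hc,
      Polynomial.aeval_X, h]

/-- Weights add along products because W is a derivation, and each generator has weight at least
one. -/
theorem wordLength_le_weights {W : Lambda V →ₗ[ℚ] Lambda V} (hW : IsDer 0 W)
    {wt : ∀ n, V n →ₗ[ℚ] V n} (hW' : ∀ n v, W (gen n v) = gen n (wt n v))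
    (hwt : ∀ n (v : V n), v ∈ Submodule.span ℚ {u | ∃ k : ℕ, wt n u = ((k : ℚ) + 1) • u}) (l : ℕ) :
    wordLength V l ≤ Submodule.span ℚ {a | ∃ r : ℕ, l ≤ r ∧ W a = (r : ℚ) • a} := by
  induction l with
  | zero =>
    intro a ha
    rw [mem_wordLength_zero ha]
    refine Submodule.subset_span ⟨0, le_rfl, ?_⟩
    rw [hW.algebraMap]; simp
  | succ l ih =>
    intro a ha
    refine wordLength_succ_induction (fun n v a ha => ?_) (zero_mem _) (fun _ _ => add_mem)
      (fun c a => Submodule.smul_mem _ c) ha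
    refine Submodule.span_induction (p := fun v _ => gen n v * a ∈ _) ?_ (by simp)
      (fun v w _ _ hv hw => by rw [map_add, add_mul]; exact add_mem hv hw)
      (fun c v _ hv => by rw [map_smul, smul_mul_assoc]; exact Submodule.smul_mem _ _ hv) (hwt n v)
    rintro v ⟨k, hk⟩
    refine Submodule.span_induction (p := fun a _ => gen n v * a ∈ _) ?_ (by simp)
      (fun a b _ _ ha hb => by rw [mul_add (gen n v)]; exact add_mem ha hb)
      (fun c a _ ha => by rw [mul_smul_comm]; exact Submodule.smul_mem _ _ ha) (ih ha)
    rintro a ⟨r, hr, hra⟩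
    refine Submodule.subset_span ⟨r + k + 1, by omega, ?_⟩
    rw [hW.gen_mul, hW', hk, hra, map_smul, zero_mul, pow_zero, one_smul, smul_mul_assoc,
      mul_smul_comm]
    push_cast; module

/-- A homotopy between `W ∘ W - W` and `0` makes `ΛV` acyclic in word lengths at least two, for a
derivation `W` with positive weights. -/
theorem exists_eq_add_of_homotopy {W H d : Lambda V →ₗ[ℚ] Lambda V} (hd : IsDer 1 d)
    (hd2 : ∀ n (v : V n), d (gen n v) ∈ wordLength V 2) (hW : IsDer 0 W)
    {wt : ∀ n, V n →ₗ[ℚ] V n} (hW' : ∀ n v, W (gen n v) = gen n (wt n v))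
    (hwt : ∀ n (v : V n), v ∈ Submodule.span ℚ {u | ∃ k : ℕ, wt n u = ((k : ℚ) + 1) • u})
    (hdW : ∀ a, d (W a) = W (d a)) (hH : ∀ a, d (H a) + H (d a) = W (W a) - W a)
    {a : Lambda V} (ha : d a = 0) :
    ∃ (c : ℚ) (b y : Lambda V), b ∈ wordLength V 1 ∧ d b = 0 ∧ a = algebraMap ℚ _ c + b + d y := by
  have hcomp : ∀ l, d (component l a) = 0 := fun l => by
    rw [← (hd.component_comm hd2 a).2 l, ha, map_zero]
  obtain ⟨N, hN⟩ := exists_sum_component a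
  have hsum := hN (N + 2) (by omega)
  rw [Finset.sum_range_succ', Finset.sum_range_succ'] at hsum
  set s := ∑ k ∈ Finset.range N, component (k + 1 + 1) a with hs
  have hs0 : d s = 0 := by
    rw [hs, map_sum]; exact Finset.sum_eq_zero fun k _ => hcomp _
  -- Word lengths at least two carry only weights r ≥ 2, where r² − r ≠ 0.
  have hmem : s ∈ Submodule.span ℚ {a | ∃ r : ℚ, (Polynomial.X ^ 2 - Polynomial.X : Polynomial ℚ).eval r ≠ 0 ∧
      W a = r • a} := by
    refine Submodule.sum_mem _ fun k _ => ?_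
    refine Submodule.span_mono ?_ (wordLength_le_weights hW hW' hwt _ (component_mem (k + 1 + 1) a))
    rintro b ⟨r, hr, hrb⟩
    refine ⟨r, ?_, hrb⟩
    have h1 : (2 : ℚ) ≤ r := by exact_mod_cast (by omega : 2 ≤ r)
    simp only [Polynomial.eval_sub, Polynomial.eval_pow, Polynomial.eval_X]
    nlinarith
  obtain ⟨p, hp⟩ := Module.End.exists_aeval_mul_eq W _ hmem
  -- The primitive of s is H (p(W) s): as p(W) s is a cocycle, d of it equals (W² − W) p(W) s = s.
  refine ⟨Lambda.aug (component 0 a), component 1 a, H (Polynomial.aeval W p s), component_mem 1 a, hcomp 1, ?_⟩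
  have h1 := hH (Polynomial.aeval W p s)
  rw [commute_aeval hdW, hs0, map_zero, map_zero, add_zero] at h1
  rw [h1, ← mem_wordLength_zero (component_mem 0 a)]
  rw [map_mul, Module.End.mul_apply, map_sub, map_pow, Polynomial.aeval_X, LinearMap.sub_apply, pow_two,
    Module.End.mul_apply] at hp
  rw [hp]
  refine hsum.trans ?_
  rw [zero_add]
  abel

variable {T : ℕ → Type w} [∀ n, AddCommGroup (T n)] [∀ n, Module ℚ (T n)]
variable {e : ∀ n, FreeLie T n →ₗ[ℚ] Module.Dual ℚ (V n)} {d : Lambda V →ₗ[ℚ] Lambda V}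

/-- The commutator of i_x and W is i_{θx}; hence on generators the claim says that θ is a derivation
of the bracket. -/
theorem IsCE.d_weight (hd : IsCE e d) {wt : ∀ n, V n →ₗ[ℚ] V n}
    (hwt : ∀ n v x, e n x (wt n v) = e n (FreeLie.euler n x) v) {W : Lambda V →ₗ[ℚ] Lambda V}
    (hW : IsDer 0 W) (hW' : ∀ n v, W (gen n v) = gen n (wt n v)) (a : Lambda V) :
    d (W a) = W (d a) := by
  have hc : ∀ {p : ℕ} (x : FreeLie T p) a, ctr e x (W a) = W (ctr e x a) + ctr e (FreeLie.euler p x) a := by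
    intro p x a
    have key := IsDer.ext ((contraction_isDer p (e p x)).comm hW)
      ((contraction_isDer p (e p (FreeLie.euler p x))).congr_parity (l := p + 1 + 0) (by simp)) fun n v => by
        simp only [LinearMap.sub_apply, LinearMap.smul_apply, LinearMap.comp_apply, hW',
          contraction_gen, hW.algebraMap, smul_zero, sub_zero]
        by_cases hn : n = p
        · subst hn; rw [Pi.single_eq_same, Pi.single_eq_same, hwt]
        · rw [Pi.single_eq_of_ne hn, Pi.single_eq_of_ne hn]; simp
    have := LinearMap.congr_fun key a
    simp only [LinearMap.sub_apply, LinearMap.comp_apply, mul_zero, pow_zero,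
      one_smul] at this
    change _ = W (contraction p (e p x) a) + contraction p (e p (FreeLie.euler p x)) a
    rw [← this, ctr]; abel
  have hW1 : ∀ n v, W (gen n v) ∈ wordLength V 1 := fun n v => by
    rw [hW']; exact gen_mem_wordLength _
  have key := IsDer.ext (hd.der.comm hW) (IsDer.zero _) fun n v => by
    simp only [LinearMap.sub_apply, LinearMap.comp_apply, hW', mul_zero, pow_zero, one_smul, LinearMap.zero_apply, sub_eq_zero]
    refine hd.eq_of_two (hd.quadratic _ _) (hW.mem_wordLength_of_one hW1 (hd.quadratic n v)) fun p q x y => ?_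
    rw [hc, map_add, hc, map_add, map_add, IsCE.aug_der_one hW hW1, zero_add]
    by_cases hpq : p + q = n
    · rw [hd.bracket hpq, hd.bracket hpq, hd.bracket hpq, hwt, FreeLie.euler_br, map_add, LinearMap.add_apply]
      ring
    · rw [hd.bracket_ne hpq, hd.bracket_ne hpq, hd.bracket_ne hpq, add_zero]
  have := LinearMap.congr_fun key a
  simpa [sub_eq_zero] using this

/-- If v vanishes on `lcs (m + 1)`, then (wt − (m + 1)) v vanishes on `lcs m`, since θ is
multiplication by m + 1 on the quotient. By induction it is a sum of eigenvectors with eigenvalues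
at most m, on which wt − (m + 1) is invertible; subtracting the preimage leaves an eigenvector for m
+ 1. -/
theorem IsCE.mem_span_weights (hd : IsCE e d) {wt : ∀ n, V n →ₗ[ℚ] V n}
    (hwt : ∀ n v x, e n x (wt n v) = e n (FreeLie.euler n x) v) {n : ℕ} (m : ℕ) :
    ∀ v : V n, (∀ x ∈ lcs (FreeLie T) m n, e n x v = 0) →
      v ∈ Submodule.span ℚ {u | ∃ k : ℕ, k < m ∧ wt n u = ((k : ℚ) + 1) • u} := by
  induction m with
  | zero => intro v hv; rw [hd.separating n v fun x => hv x trivial]; exact zero_mem _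
  | succ m ih =>
    intro v hv
    have h1 := ih (wt n v - ((m : ℚ) + 1) • v) fun x hx => by
      have := hv _ (FreeLie.euler_sub_mem_lcs hx)
      rw [map_sub, map_smul, LinearMap.sub_apply, ← hwt, LinearMap.smul_apply] at this
      rw [map_sub, map_smul, this]
    obtain ⟨v', hv', h2⟩ : ∃ v' ∈ Submodule.span ℚ {u | ∃ k : ℕ, k < m ∧ wt n u = ((k : ℚ) + 1) • u},
        wt n v' - ((m : ℚ) + 1) • v' = wt n v - ((m : ℚ) + 1) • v := by
      refine Submodule.span_induction (p := fun u _ => ∃ v' ∈ Submodule.span ℚ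
        {u | ∃ k : ℕ, k < m ∧ wt n u = ((k : ℚ) + 1) • u}, wt n v' - ((m : ℚ) + 1) • v' = u) ?_
        ⟨0, zero_mem _, by simp⟩ ?_ ?_ h1
      · rintro u ⟨k, hk, hu⟩
        have hk' : (k : ℚ) - m ≠ 0 := by
          rw [sub_ne_zero]; exact_mod_cast hk.ne
        refine ⟨((k : ℚ) - m)⁻¹ • u, Submodule.smul_mem _ _ (Submodule.subset_span ⟨k, hk, hu⟩), ?_⟩
        rw [map_smul, hu, smul_smul, smul_smul, ← sub_smul]
        have : ((k : ℚ) - m)⁻¹ * (k + 1) - (m + 1) * ((k : ℚ) - m)⁻¹ = 1 := by field_simp; ring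
        rw [this, one_smul]
      · rintro u u' - - ⟨v, hv, h⟩ ⟨v', hv', h'⟩
        refine ⟨v + v', add_mem hv hv', ?_⟩
        rw [← h, ← h', map_add]; module
      · rintro c u - ⟨v, hv, h⟩
        refine ⟨c • v, Submodule.smul_mem _ _ hv, ?_⟩
        rw [← h, map_smul]; module
    rw [← sub_add_cancel v v']
    refine add_mem (Submodule.subset_span ⟨m, Nat.lt_succ_self m, ?_⟩)
      (Submodule.span_mono (by rintro u ⟨k, hk, hu⟩; exact ⟨k, by omega, hu⟩) hv')
    rw [map_sub, smul_sub]
    linear_combination (norm := module) -h2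

/-- The cohomology of the cochain algebra dual to a free Lie algebra. -/
theorem IsCE.exists_eq_add (hd : IsCE e d)
    (hnil : ∀ n (v : V n), ∃ m, ∀ x ∈ lcs (FreeLie T) m n, e n x v = 0)
    {η : ∀ n, FreeLie T n →ₗ[ℚ] Module.Dual ℚ (Lambda V)} (hη : IsTwist e d η)
    {B : ∀ m n, V m →ₗ[ℚ] V n →ₗ[ℚ] V (m + n)}
    (hB : ∀ m n v w x, e (m + n) x (B m n v w) = (-1 : ℚ) ^ (m + n) * η (m + n) x (gen m v * gen n w))
    {wt : ∀ n, V n →ₗ[ℚ] V n} (hwt : ∀ n v x, e n x (wt n v) = e n (FreeLie.euler n x) v)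
    {a : Lambda V} (ha : d a = 0) :
    ∃ (c : ℚ) (b y : Lambda V), b ∈ wordLength V 1 ∧ d b = 0 ∧ a = algebraMap ℚ _ c + b + d y := by
  obtain ⟨W, H, hW, hW', hH⟩ := hη.exists_homotopy hd hB hwt
  refine exists_eq_add_of_homotopy hd.der hd.quadratic hW hW' (fun n v => ?_)
    (hd.d_weight hwt hW hW') hH ha
  obtain ⟨m, hm⟩ := hnil n v
  exact Submodule.span_mono (by rintro u ⟨k, -, hu⟩; exact ⟨k, hu⟩) (hd.mem_span_weights hwt m v hm)

end Weights
end EnrichedLie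
end

/-! ### Continuity of η, and vanishing of cohomology on the continuous dual of 𝕃_T. -/

noncomputable section
namespace EnrichedLie

section Continuity

open GradedLie

theorem exists_linearMap_lift {U A B : Type*} [AddCommGroup U] [Module ℚ U] [AddCommGroup A]
    [Module ℚ A] [AddCommGroup B] [Module ℚ B] (i : A →ₗ[ℚ] B) (hi : Function.Injective i)
    (f : U →ₗ[ℚ] B) (h : ∀ u, ∃ a, i a = f u) : ∃ g : U →ₗ[ℚ] A, ∀ u, i (g u) = f u := by
  refine ⟨(LinearEquiv.ofInjective i hi).symm.toLinearMap ∘ₗ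
    LinearMap.codRestrict (LinearMap.range i) f h, fun u => ?_⟩
  exact congrArg Subtype.val ((LinearEquiv.ofInjective i hi).apply_symm_apply
    (LinearMap.codRestrict (LinearMap.range i) f h u))

variable {V : ℕ → Type u} [∀ n, AddCommGroup (V n)] [∀ n, Module ℚ (V n)]
variable {T : ℕ → Type w} [∀ n, AddCommGroup (T n)] [∀ n, Module ℚ (T n)]
variable {e : ∀ n, FreeLie T n →ₗ[ℚ] Module.Dual ℚ (V n)} {d : Lambda V →ₗ[ℚ] Lambda V}
variable {η : ∀ n, FreeLie T n →ₗ[ℚ] Module.Dual ℚ (Lambda V)}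

/-! ## Continuity of the twisted derivation -/

theorem parityPow_gen_mul_gen (k : ℕ) {m n : ℕ} (v : V m) (w : V n) :
    ∃ c : ℚ, parityPow k (gen m v * gen n w) = c • (gen m v * gen n w) := by
  have : parityPow k (gen n w) = (-1 : ℚ) ^ (k * (n + 1)) • gen n w := by
    rw [← mul_one (gen n w), parityPow_gen_mul, parityPow_one]
  exact ⟨_, by rw [parityPow_gen_mul, this, mul_smul_comm, smul_smul]⟩

theorem IsCE.lieDer_gen_eq_zero (hd : IsCE e d) {p k : ℕ} (x : FreeLie T p) (v : V k)
    (h : ∀ {j} (h : p + j = k) (z : FreeLie T j), e k (GradedLie.br h x z) v = 0) :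
    lieDer e d x (gen k v) = 0 := by
  refine hd.eq_of_one (hd.lieDer_mem x (gen_mem_wordLength v)) (zero_mem _) fun q z => ?_
  rw [hd.aug_ctr_lieDer rfl, map_zero, map_zero]
  by_cases hk : p + q = k
  · subst hk
    rw [ctr, contraction_gen_self, aug_algebraMap, h, mul_zero]
  · rw [ctr, contraction_gen_ne (Ne.symm hk), map_zero, mul_zero]

/-- L_x acts on V as v ↦ v ∘ [x, ·] up to sign, and `hs` says that V is stable under this coadjoint
action. The first alternative covers p > k, where there is no room for a value. -/
theorem IsCE.exists_lieDer_gen (hd : IsCE e d)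
    (hs : ∀ {p j k} (h : p + j = k) (x : FreeLie T p) (v : V k),
      ∃ v' : V j, ∀ z, e j z v' = e k (GradedLie.br h x z) v) {p k : ℕ} (x : FreeLie T p) (v : V k) :
    lieDer e d x (gen k v) = 0 ∨ ∃ (j : ℕ) (h : p + j = k) (v' : V j) (c : ℚ),
      lieDer e d x (gen k v) = c • gen j v' ∧ ∀ z, e j z v' = e k (GradedLie.br h x z) v := by
  by_cases hpk : p ≤ k
  · obtain ⟨j, rfl⟩ := Nat.exists_eq_add_of_le hpk
    obtain ⟨v', hv'⟩ := hs rfl x v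
    refine Or.inr ⟨j, rfl, v', (-1) ^ (p * j), ?_, hv'⟩
    refine hd.eq_of_one (hd.lieDer_mem x (gen_mem_wordLength v))
      (Submodule.smul_mem _ _ (gen_mem_wordLength v')) fun q z => ?_
    rw [hd.aug_ctr_lieDer rfl, map_smul, map_smul, smul_eq_mul]
    by_cases hq : q = j
    · subst hq
      rw [ctr, ctr, contraction_gen_self, contraction_gen_self, aug_algebraMap, aug_algebraMap, hv']
    · rw [ctr, ctr, contraction_gen_ne (by omega), contraction_gen_ne (Ne.symm hq)]; simp
  · exact Or.inl (hd.lieDer_gen_eq_zero x v fun h => by omega)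

/-- By the Leibniz rule, the action of x on η y is tested on v w by η y on the products v' w and v
w', where v' and w' are coadjoint translates. -/
theorem IsTwist.apply_lieDer_eq_zero (hd : IsCE e d)
    (hs : ∀ {p j k} (h : p + j = k) (x : FreeLie T p) (v : V k),
      ∃ v' : V j, ∀ z, e j z v' = e k (GradedLie.br h x z) v) {p q m n : ℕ} (x : FreeLie T p)
    (y : FreeLie T q) (v : V m) (w : V n)
    (hv : ∀ j (h : p + j = m) (v' : V j), (∀ z, e j z v' = e m (GradedLie.br h x z) v) →
      η q y (gen j v' * gen n w) = 0)
    (hw : ∀ j (h : p + j = n) (w' : V j), (∀ z, e j z w' = e n (GradedLie.br h x z) w) →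
      η q y (gen m v * gen j w') = 0) :
    η q y (parityPow p (lieDer e d x (gen m v * gen n w))) = 0 := by
  have h1 : η q y (parityPow p (lieDer e d x (gen m v) * gen n w)) = 0 := by
    rcases hd.exists_lieDer_gen hs x v with h | ⟨j, h, v', c, h', h''⟩
    · rw [h, zero_mul, map_zero, map_zero]
    · obtain ⟨c', hc'⟩ := parityPow_gen_mul_gen p v' w
      rw [h', smul_mul_assoc, map_smul, hc', map_smul, map_smul, hv j h v' h'', smul_zero, smul_zero]
  have h2 : η q y (parityPow p (gen m v * lieDer e d x (gen n w))) = 0 := by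
    rcases hd.exists_lieDer_gen hs x w with h | ⟨j, h, w', c, h', h''⟩
    · rw [h, mul_zero, map_zero, map_zero]
    · obtain ⟨c', hc'⟩ := parityPow_gen_mul_gen p v w'
      rw [h', mul_smul_comm, map_smul, hc', map_smul, map_smul, hw j h w' h'', smul_zero, smul_zero]
  rw [(hd.lieDer_isDer x).gen_mul, map_add, map_add, h1, map_smul, map_smul, h2, smul_zero, add_zero]

theorem aug_ctr_gen_eq_zero {p k : ℕ} {x : FreeLie T p} {v : V k}
    (h : p = k → contraction p (e p x) (gen k v) = 0) : Lambda.aug (ctr e x (gen k v)) = 0 := by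
  by_cases hp : p = k
  · rw [ctr, h hp, map_zero]
  · rw [ctr, contraction_gen_ne (Ne.symm hp), map_zero]

/-- The kernel is the ideal generated by K, so it suffices that the x with the property for all v, w
at once form an ideal containing K. For y in the kernel, L_y and i_{θy} kill v and w, so the
recursion for η[x,y] keeps only the action of x on η y; and coadjoint translates of v, w still
vanish on the kernel. -/
theorem IsTwist.apply_eq_zero_of_mem_ker (hd : IsCE e d) (hη : IsTwist e d η)
    (hs : ∀ {p j k} (h : p + j = k) (x : FreeLie T p) (v : V k),
      ∃ v' : V j, ∀ z, e j z v' = e k (GradedLie.br h x z) v) (K : GSub T) {p m n : ℕ}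
    {x : FreeLie T p} (hx : FreeLie.toQuot K p x = 0) {v : V m} {w : V n}
    (hv : ∀ z, FreeLie.toQuot K m z = 0 → e m z v = 0)
    (hw : ∀ z, FreeLie.toQuot K n z = 0 → e n z w = 0) : η p x (gen m v * gen n w) = 0 := by
  let J : GradedIdeal (FreeLie T) :=
    { sub := fun p =>
        { carrier := {x | FreeLie.toQuot K p x = 0 ∧ ∀ m n (v : V m) (w : V n),
            (∀ z, FreeLie.toQuot K m z = 0 → e m z v = 0) →
            (∀ z, FreeLie.toQuot K n z = 0 → e n z w = 0) → η p x (gen m v * gen n w) = 0}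
          add_mem' := fun {x y} hx hy => ⟨by rw [map_add, hx.1, hy.1, add_zero], fun m n v w hv hw => by
            rw [map_add, LinearMap.add_apply, hx.2 m n v w hv hw, hy.2 m n v w hv hw, add_zero]⟩
          zero_mem' := ⟨map_zero _, fun m n v w hv hw => by rw [map_zero]; rfl⟩
          smul_mem' := fun c x hx => ⟨by rw [map_smul, hx.1, smul_zero], fun m n v w hv hw => by
            rw [map_smul, LinearMap.smul_apply, hx.2 m n v w hv hw, smul_zero]⟩ }
      br_mem := by
        rintro p q r h x y ⟨hy, hy'⟩
        refine ⟨by rw [FreeLie.toQuot_br, hy, map_zero], fun m n v w hv hw => ?_⟩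
        have hc : ∀ {k} (v : V k), (∀ z, FreeLie.toQuot K k z = 0 → e k z v = 0) →
            Lambda.aug (ctr e (FreeLie.euler q y) (gen k v)) = 0 := fun {k} v hv => by
          refine aug_ctr_gen_eq_zero ?_
          rintro rfl
          rw [contraction_gen_self, hv _ (by rw [← FreeLie.euler_toQuot, hy, map_zero]), map_zero]
        have hL : ∀ {k} (v : V k), (∀ z, FreeLie.toQuot K k z = 0 → e k z v = 0) →
            lieDer e d y (gen k v) = 0 := fun {k} v hv => hd.lieDer_gen_eq_zero y v fun h z =>
          hv _ (by rw [FreeLie.toQuot_br, hy, map_zero, LinearMap.zero_apply])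
        have hsh : ∀ {j k} (h : p + j = k) (v' : V j) (v : V k),
            (∀ z, FreeLie.toQuot K k z = 0 → e k z v = 0) → (∀ z, e j z v' = e k (GradedLie.br h x z) v) →
            ∀ z, FreeLie.toQuot K j z = 0 → e j z v' = 0 := fun h v' v hv hv' z hz => by
          rw [hv']; exact hv _ (by rw [FreeLie.toQuot_br, hz, map_zero])
        rw [hη.br h, aug_ctr_ctr_gen_mul_gen, hc v hv, hc w hw, (hd.lieDer_isDer y).gen_mul, hL v hv,
          hL w hw, IsTwist.apply_lieDer_eq_zero hd hs x y v w
            (fun j h v' h' => hy' j n v' w (hsh h v' v hv h') hw)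
            (fun j h w' h' => hy' m j v w' hv (hsh h w' w hw h'))]
        simp }
  exact (FreeLie.mem_of_toQuot_eq_zero K J (fun n t ht =>
    ⟨FreeLie.toQuot_eq_zero_of_mem K ht, fun m n v w _ _ => by rw [hη.of]; rfl⟩) hx).2 m n v w hv hw

/-- Induction on N over brackets [x, y] with y in `lcs N`. The coadjoint action of x lowers a or b
by one, matching the drop of N. The terms with L_y and i_{θy} vanish: if a and b are positive, both
are at most N, and if one is zero then v or w is zero. -/
theorem IsTwist.apply_eq_zero_of_mem_lcs (hd : IsCE e d) (hη : IsTwist e d η)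
    (hs : ∀ {p j k} (h : p + j = k) (x : FreeLie T p) (v : V k),
      ∃ v' : V j, ∀ z, e j z v' = e k (GradedLie.br h x z) v) (N : ℕ) : ∀ {p m n a b : ℕ} (_ : a + b ≤ N)
    {x : FreeLie T p} (_ : x ∈ lcs (FreeLie T) N p) {v : V m} {w : V n}
    (_ : ∀ z ∈ lcs (FreeLie T) a m, e m z v = 0) (_ : ∀ z ∈ lcs (FreeLie T) b n, e n z w = 0),
    η p x (gen m v * gen n w) = 0 := by
  have h0 : ∀ {k} {v : V k}, (∀ z ∈ lcs (FreeLie T) 0 k, e k z v = 0) → v = 0 := fun {k v} hv =>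
    hd.separating _ _ fun z => hv z trivial
  induction N with
  | zero =>
    intro p m n a b hab x _ v w hv _
    obtain rfl : a = 0 := by omega
    rw [h0 hv]; simp
  | succ N ih =>
    intro p m n a b hab x hx v w hv hw
    refine lcs_succ_induction (P := fun x => η p x (gen m v * gen n w) = 0) (fun i j h x y hy => ?_)
      (by simp) (fun x y hx hy => by rw [map_add, LinearMap.add_apply, hx, hy, add_zero])
      (fun c x hx => by rw [map_smul, LinearMap.smul_apply, hx, smul_zero]) hx
    rcases a with _ | a
    · rw [h0 hv]; simp
    rcases b with _ | b
    · rw [h0 hw]; simp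
    have hc : ∀ {k c} (v : V k), c ≤ N → (∀ z ∈ lcs (FreeLie T) c k, e k z v = 0) →
        Lambda.aug (ctr e (FreeLie.euler j y) (gen k v)) = 0 := fun {k c} v hc hv => by
      refine aug_ctr_gen_eq_zero ?_
      rintro rfl
      rw [contraction_gen_self, hv _ (lcs_antitone hc _ (FreeLie.euler_mem_lcs hy)), map_zero]
    have hL : ∀ {k c} (v : V k), c ≤ N → (∀ z ∈ lcs (FreeLie T) c k, e k z v = 0) →
        lieDer e d y (gen k v) = 0 := fun {k c} v hc hv => hd.lieDer_gen_eq_zero y v fun h z =>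
      hv _ (lcs_antitone hc _ (lcs_antitone (Nat.le_succ N) _ (br_mem_lcs_succ_left h z hy)))
    have hsh : ∀ {l k c} (h : i + l = k) (v' : V l) (v : V k),
        (∀ z ∈ lcs (FreeLie T) (c + 1) k, e k z v = 0) → (∀ z, e l z v' = e k (GradedLie.br h x z) v) →
        ∀ z ∈ lcs (FreeLie T) c l, e l z v' = 0 := fun h v' v hv hv' z hz => by
      rw [hv']; exact hv _ (br_mem_lcs_succ h x hz)
    rw [hη.br h, aug_ctr_ctr_gen_mul_gen, hc (c := a + 1) v (by omega) hv,
      hc (c := b + 1) w (by omega) hw, (hd.lieDer_isDer y).gen_mul, hL (c := a + 1) v (by omega) hv,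
      hL (c := b + 1) w (by omega) hw, IsTwist.apply_lieDer_eq_zero hd hs x y v w
        (fun l h v' h' => ih (a := a) (b := b + 1) (by omega) hy (hsh h v' v hv h') hw)
        (fun l h w' h' => ih (a := a + 1) (b := b) (by omega) hy hv (hsh h w' w hw h'))]
    simp

variable {κ : Type z} {K : κ → GSub T}

theorem FreeLie.toQuot_mono {K K' : GSub T} (h : K ≤ K') {n : ℕ} {x : FreeLie T n} {k : ℕ}
    (hx : FreeLie.toQuot K n x ∈ lcs (FreeLie (GQuot K)) k n) :
    FreeLie.toQuot K' n x ∈ lcs (FreeLie (GQuot K')) k n := by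
  have key : ∀ {n} (x : FreeLie T n), FreeLie.lift (M := FreeLie (GQuot K')) (fun n => FreeLie.of n ∘ₗ
      Submodule.factor (h n)) n (FreeLie.toQuot K n x) = FreeLie.toQuot K' n x := by
    intro n x
    induction x using FreeLie.induction with
    | of n t => rfl
    | zero n => simp only [map_zero]
    | add n x y hx hy => simp only [map_add, hx, hy]
    | smul n c x hx => simp only [map_smul, hx]
    | br h x y hx hy => rw [FreeLie.toQuot_br, FreeLie.lift_br, hx, hy, FreeLie.toQuot_br]
  rw [← key]
  exact map_mem_lcs _ (fun h x y => FreeLie.lift_br _ h x y) hx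

theorem mem_freeFamily {p : κ × ℕ} {n : ℕ} {x : FreeLie T n} : x ∈ freeFamily K p n ↔
    FreeLie.toQuot (K p.1) n x ∈ lcs (FreeLie (GQuot (K p.1))) p.2 n := Iff.rfl

/-- Splits questions of continuity on 𝕃_T into the kernels of 𝕃_T → 𝕃_{T_α} and the lower central
series. -/
theorem mem_freeFamily_iff {α : κ} {k : ℕ} {n : ℕ} {x : FreeLie T n} : x ∈ freeFamily K (α, k) n ↔
    ∃ y ∈ lcs (FreeLie T) k n, FreeLie.toQuot (K α) n (x - y) = 0 := by
  rw [mem_freeFamily]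
  constructor
  · intro h
    obtain ⟨y, hy, hxy⟩ := exists_mem_lcs_of_surjective (FreeLie.toQuot (K α))
      (FreeLie.toQuot_br (K α)) (FreeLie.toQuot_surjective (K α)) h
    exact ⟨y, hy, by rw [map_sub, hxy, sub_self]⟩
  · rintro ⟨y, hy, hxy⟩
    rw [map_sub, sub_eq_zero] at hxy
    rw [hxy]
    exact map_mem_lcs _ (FreeLie.toQuot_br (K α)) hy

theorem freeFamily_mono {α β : κ} {k l : ℕ} (h : K α ≤ K β) (hkl : l ≤ k) (n : ℕ) :
    freeFamily K (α, k) n ≤ freeFamily K (β, l) n := fun _ hx =>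
  lcs_antitone hkl n (FreeLie.toQuot_mono h hx)

theorem isDirectedFamily_freeFamily (hK : IsDirectedFamily K) : IsDirectedFamily (freeFamily K) := by
  obtain ⟨α⟩ := hK.1
  refine ⟨⟨(α, 0)⟩, fun p q => ?_⟩
  obtain ⟨γ, h1, h2⟩ := hK.2 p.1 q.1
  exact ⟨(γ, max p.2 q.2), fun n => freeFamily_mono h1 (le_max_left _ _) n,
    fun n => freeFamily_mono h2 (le_max_right _ _) n⟩

theorem euler_mem_freeFamily {p : κ × ℕ} {n : ℕ} {x : FreeLie T n} (hx : x ∈ freeFamily K p n) :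
    FreeLie.euler n x ∈ freeFamily K p n := by
  rw [mem_freeFamily, ← FreeLie.euler_toQuot]
  exact FreeLie.euler_mem_lcs hx

/-- The cohomology of the cochain algebra on the continuous dual of a free Lie algebra. -/
theorem IsCE.exists_eq_add_of_dual (hd : IsCE e d) (hK : IsDirectedFamily K)
    (hker : ∀ n (v : V n), ∃ p, ∀ x ∈ freeFamily K p n, e n x v = 0)
    (hsurj : ∀ n (φ : Module.Dual ℚ (FreeLie T n)) p, (∀ x ∈ freeFamily K p n, φ x = 0) →
      ∃ v, ∀ x, e n x v = φ x) {a : Lambda V} (ha : d a = 0) :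
    ∃ (c : ℚ) (b y : Lambda V), b ∈ wordLength V 1 ∧ d b = 0 ∧ a = algebraMap ℚ _ c + b + d y := by
  obtain ⟨η, hη⟩ := hd.exists_isTwist
  have hinj : ∀ n, Function.Injective (e n).flip := fun n => by
    rw [injective_iff_map_eq_zero]
    exact fun v hv => hd.separating n v fun x => LinearMap.congr_fun hv x
  have hs : ∀ {p j k} (h : p + j = k) (x : FreeLie T p) (v : V k),
      ∃ v' : V j, ∀ z, e j z v' = e k (GradedLie.br h x z) v := by
    intro p j k h x v
    obtain ⟨q, hq⟩ := hker k v
    exact hsurj j ((e k).flip v ∘ₗ br h x) q fun z hz => hq _ ((freeIdeal K q).br_mem h x z hz)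
  -- `wt` is the transpose of the Euler derivation, which preserves every member of the family.
  have hwt : ∀ n, ∃ g : V n →ₗ[ℚ] V n, ∀ v, (e n).flip (g v) = (e n).flip v ∘ₗ FreeLie.euler n :=
    fun n => exists_linearMap_lift _ (hinj n) ((FreeLie.euler n).lcomp ℚ ℚ ∘ₗ (e n).flip) fun v => by
      obtain ⟨q, hq⟩ := hker n v
      obtain ⟨v', hv'⟩ := hsurj n ((e n).flip v ∘ₗ FreeLie.euler n) q fun x hx =>
        hq _ (euler_mem_freeFamily hx)
      exact ⟨v', LinearMap.ext hv'⟩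
  choose wt hwt using hwt
  -- B is the transpose of η restricted to products of two generators; it takes values in V only
  -- because η is continuous.
  have hB : ∀ m n, ∃ g : V m ⊗[ℚ] V n →ₗ[ℚ] V (m + n), ∀ t, (e (m + n)).flip (g t) =
      TensorProduct.lift (((LinearMap.mul ℚ (Lambda V)).compl₁₂ (gen m) (gen n)).compr₂
        ((-1 : ℚ) ^ (m + n) • (η (m + n)).flip)) t := by
    intro m n
    refine exists_linearMap_lift _ (hinj _) _ fun t => ?_
    induction t using TensorProduct.induction_on with
    | zero => exact ⟨0, by rw [map_zero, map_zero]⟩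
    | add s t hs ht =>
      obtain ⟨a, ha⟩ := hs
      obtain ⟨b, hb⟩ := ht
      exact ⟨a + b, by rw [map_add, map_add, ha, hb]⟩
    | tmul v w =>
      obtain ⟨⟨α, a⟩, hv⟩ := hker m v
      obtain ⟨⟨β, b⟩, hw⟩ := hker n w
      obtain ⟨γ, hα, hβ⟩ := hK.2 α β
      -- If v vanishes on the member (α, a) and w on (β, b), then η(·)(v w) vanishes on (γ, a + b)
      -- with K γ inside K α and K β.
      obtain ⟨v', hv'⟩ := hsurj (m + n) ((-1 : ℚ) ^ (m + n) • (η (m + n)).flip (gen m v * gen n w)) (γ, a + b)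
        fun x hx => by
          obtain ⟨y, hy, hxy⟩ := mem_freeFamily_iff.1 hx
          have hle : ∀ {α k n} (z : FreeLie T n), K γ ≤ K α → FreeLie.toQuot (K γ) n z = 0 → z ∈ freeFamily K (α, k) n :=
            fun {α k n} z hα hz => freeFamily_mono hα le_rfl n (by rw [mem_freeFamily, hz]; exact zero_mem _)
          have hle' : ∀ {α k n} (z : FreeLie T n), z ∈ lcs (FreeLie T) k n → z ∈ freeFamily K (α, k) n :=
            fun {α k n} z hz => map_mem_lcs _ (FreeLie.toQuot_br (K α)) hz
          have h1 := hη.apply_eq_zero_of_mem_ker hd hs (K γ) hxy (v := v) (w := w)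
            (fun z hz => hv z (hle z hα hz)) (fun z hz => hw z (hle z hβ hz))
          have h2 := hη.apply_eq_zero_of_mem_lcs hd hs (a + b) le_rfl hy (v := v) (w := w)
            (fun z hz => hv z (hle' z hz)) (fun z hz => hw z (hle' z hz))
          rw [map_sub, LinearMap.sub_apply, h2, sub_zero] at h1
          rw [LinearMap.smul_apply, LinearMap.flip_apply, h1, smul_zero]
      exact ⟨v', LinearMap.ext hv'⟩
  choose B hB using hB
  refine hd.exists_eq_add (fun n v => ?_) hη (B := fun m n => TensorProduct.curry (B m n))
    (fun m n v w x => ?_) (wt := wt) (fun n v x => LinearMap.congr_fun (hwt n v) x) ha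
  · obtain ⟨⟨α, k⟩, h⟩ := hker n v
    exact ⟨k, fun x hx => h x (map_mem_lcs _ (FreeLie.toQuot_br (K α)) hx)⟩
  · exact LinearMap.congr_fun (hB m n (v ⊗ₜ w)) x

end Continuity
end EnrichedLie
end

/-! ### The quadratic model satisfies `IsCE`; the canonical map to cohomology. -/

noncomputable section
namespace EnrichedLie

section ModelCE

open GradedLie

/-! ## The differential of the quadratic model -/

section Derivation

variable {V : ℕ → Type u} [∀ n, AddCommGroup (V n)] [∀ n, Module ℚ (V n)]
variable {δ : ∀ {i j n : ℕ}, i + j = n → (V n →ₗ[ℚ] V i ⊗[ℚ] V j)}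

theorem genMul_mem_wordLength (i j : ℕ) (t : V i ⊗[ℚ] V j) : genMul i j t ∈ wordLength V 2 := by
  induction t using TensorProduct.induction_on with
  | zero => rw [map_zero]; exact zero_mem _
  | add s t hs ht => rw [map_add]; exact add_mem hs ht
  | tmul a b => exact gen_mul_gen_mem_wordLength a b

theorem parity_genMul (i j : ℕ) (t : V i ⊗[ℚ] V j) :
    Lambda.parity (genMul i j t) = (-1 : ℚ) ^ (i + j) • genMul i j t := by
  induction t using TensorProduct.induction_on with
  | zero => simp
  | add s t hs ht => rw [map_add, map_add, hs, ht, smul_add]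
  | tmul a b =>
    change Lambda.parity (gen i a * gen j b) = _ • (gen i a * gen j b)
    rw [parity_gen_mul, parity_gen, mul_smul_comm, smul_smul]
    congr 1
    ring

theorem quad_apply (n : ℕ) (v : V n) : quad δ n v =
    ∑ p ∈ (Finset.HasAntidiagonal.antidiagonal n).attach,
      genMul p.1.1 p.1.2 (δ (Finset.HasAntidiagonal.mem_antidiagonal.1 p.2) v) := by
  rw [quad, LinearMap.sum_apply]; rfl

theorem quad_mem_wordLength (n : ℕ) (v : V n) : quad δ n v ∈ wordLength V 2 := by
  rw [quad_apply]
  exact Submodule.sum_mem _ fun p _ => genMul_mem_wordLength _ _ _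

theorem parity_quad (n : ℕ) (v : V n) : Lambda.parity (quad δ n v) = (-1 : ℚ) ^ n • quad δ n v := by
  rw [quad_apply, map_sum, Finset.smul_sum]
  refine Finset.sum_congr rfl fun p _ => (parity_genMul _ _ _).trans (congrArg (· • _) ?_)
  rw [Finset.HasAntidiagonal.mem_antidiagonal.1 p.2]

theorem derivMat_gen (n : ℕ) (v : V n) :
    derivMat δ (gen n v) = !![(-1 : ℚ) ^ (n + 1) • gen n v, quad δ n v; 0, gen n v] := by
  have : derivMat δ (gen n v) = TensorAlgebra.lift ℚ (derivGen δ)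
    (TensorAlgebra.ι ℚ (DirectSum.lof ℚ ℕ V n v)) := rfl
  rw [this, TensorAlgebra.lift_ι_apply, derivGen, DirectSum.toModule_lof]
  rfl

theorem derivExt_gen (n : ℕ) (v : V n) : derivExt δ (gen n v) = quad δ n v := by
  change derivMat δ (gen n v) 0 1 = _
  rw [derivMat_gen]; rfl

theorem derivExt_isDer : IsDer 1 (derivExt δ) := by
  obtain ⟨D, hD, hD'⟩ := IsDer.exists_of_gen 1 (quad δ) (fun m n v w => by
    rw [gen_quad_comm, smul_smul, ← pow_add,
      neg_one_pow_eq_of_parity (b := 0) (by simp only [Nat.even_add, Nat.even_mul, Nat.even_add_one]; simp; tauto),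
      pow_zero, one_smul])
    (fun n v => by rw [parity_quad, add_assoc, pow_add]; simp)
  -- The lower row of the matrix of a is (0, a), so multiplicativity of `derivMat` becomes the
  -- Leibniz rule for the entry (0, 1).
  have h11 : ∀ a : Lambda V, derivMat δ a 1 1 = a ∧ derivMat δ a 1 0 = 0 := by
    intro a
    induction a using Lambda.induction with
    | one => rw [map_one]; simp
    | add a b ha hb => rw [map_add]; simp [ha, hb]
    | smul c a ha => rw [map_smul]; simp [ha]
    | mul n v a ha => rw [map_mul, derivMat_gen, Matrix.mul_apply, Matrix.mul_apply]; simp [ha]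
  have : derivExt δ = D := by
    refine LinearMap.ext fun a => ?_
    induction a using Lambda.induction with
    | one => rw [hD.one]; change derivMat δ 1 0 1 = 0; rw [map_one]; simp
    | add a b ha hb => rw [map_add, map_add, ha, hb]
    | smul c a ha => rw [map_smul, map_smul, ha]
    | mul n v a ha =>
      rw [hD.gen_mul, hD', ← ha, one_mul]
      change derivMat δ (gen n v * a) 0 1 = _ + _ • (_ * derivMat δ a 0 1)
      rw [map_mul, derivMat_gen, Matrix.mul_apply]
      simp [(h11 a).1, add_comm]
  rw [this]; exact hD

/-- The value of the contractions on `Λ²V`. -/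
theorem aug_ctr_ctr_genMul {F : ℕ → Type w} [∀ n, AddCommGroup (F n)] [∀ n, Module ℚ (F n)]
    (e : ∀ n, F n →ₗ[ℚ] Module.Dual ℚ (V n)) {p q : ℕ} (x : F p) (y : F q) (i j : ℕ)
    (t : V i ⊗[ℚ] V j) : Lambda.aug (ctr e y (ctr e x (genMul i j t))) =
      TensorProduct.lift ((LinearMap.mul ℚ ℚ).compl₁₂
        (Pi.single (M := fun n => Module.Dual ℚ (V n)) p (e p x) i)
        (Pi.single (M := fun n => Module.Dual ℚ (V n)) q (e q y) j)) t +
      (-1 : ℚ) ^ ((p + 1) * (i + 1)) * TensorProduct.lift ((LinearMap.mul ℚ ℚ).compl₁₂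
        (Pi.single (M := fun n => Module.Dual ℚ (V n)) q (e q y) i)
        (Pi.single (M := fun n => Module.Dual ℚ (V n)) p (e p x) j)) t := by
  induction t using TensorProduct.induction_on with
  | zero => simp
  | add s t hs ht => rw [map_add, map_add, map_add, map_add, hs, ht, map_add, map_add]; ring
  | tmul a b =>
    change Lambda.aug (ctr e y (ctr e x (gen i a * gen j b))) = _
    rw [aug_ctr_ctr_gen_mul_gen]
    simp only [ctr]
    rw [contraction_gen, contraction_gen, contraction_gen, contraction_gen, aug_algebraMap,
      aug_algebraMap, aug_algebraMap, aug_algebraMap]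
    rfl

theorem lift_single_ne {p q i j : ℕ} (h : ¬(i = p ∧ j = q)) (ξ : Module.Dual ℚ (V p))
    (ζ : Module.Dual ℚ (V q)) (t : V i ⊗[ℚ] V j) :
    TensorProduct.lift ((LinearMap.mul ℚ ℚ).compl₁₂
      (Pi.single (M := fun n => Module.Dual ℚ (V n)) p ξ i)
      (Pi.single (M := fun n => Module.Dual ℚ (V n)) q ζ j)) t = 0 := by
  induction t using TensorProduct.induction_on with
  | zero => simp
  | add s t hs ht => rw [map_add, hs, ht, add_zero]
  | tmul a b =>
    simp only [TensorProduct.lift.tmul, LinearMap.compl₁₂_apply, LinearMap.mul_apply']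
    by_cases hi : i = p
    · rw [Pi.single_eq_of_ne (fun hj => h ⟨hi, hj⟩)]; simp
    · rw [Pi.single_eq_of_ne hi]; simp

theorem sum_lift_single {p q n : ℕ} (h : p + q = n) (ξ : Module.Dual ℚ (V p))
    (ζ : Module.Dual ℚ (V q)) (c : ℕ → ℚ) (t : ∀ {i j : ℕ}, i + j = n → V i ⊗[ℚ] V j) :
    ∑ r ∈ (Finset.HasAntidiagonal.antidiagonal n).attach, c r.1.1 * TensorProduct.lift
      ((LinearMap.mul ℚ ℚ).compl₁₂ (Pi.single (M := fun n => Module.Dual ℚ (V n)) p ξ r.1.1)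
        (Pi.single (M := fun n => Module.Dual ℚ (V n)) q ζ r.1.2))
      (t (Finset.HasAntidiagonal.mem_antidiagonal.1 r.2)) =
    c p * TensorProduct.lift ((LinearMap.mul ℚ ℚ).compl₁₂ ξ ζ) (t h) := by
  rw [Finset.sum_eq_single ⟨(p, q), Finset.HasAntidiagonal.mem_antidiagonal.2 h⟩]
  · rw [Pi.single_eq_same, Pi.single_eq_same]
  · rintro ⟨⟨i, j⟩, hij⟩ - hne
    rw [lift_single_ne, mul_zero]
    rintro ⟨rfl, rfl⟩
    exact hne rfl
  · exact fun h => absurd (Finset.mem_attach _ _) h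

section Sum

variable {F : ℕ → Type w} [∀ n, AddCommGroup (F n)] [∀ n, Module ℚ (F n)]

/-- Contraction by x and y sees only the components (p, q) and (q, p). For a tensor dual to a
bracket they contribute equally by skewness, whence the factor 1/2 in `modelD`. -/
theorem aug_ctr_ctr_sum (e : ∀ n, F n →ₗ[ℚ] Module.Dual ℚ (V n)) {n : ℕ}
    (t : ∀ {i j : ℕ}, i + j = n → V i ⊗[ℚ] V j) {p q : ℕ} (h : p + q = n) (h' : q + p = n)
    (x : F p) (y : F q) :
    Lambda.aug (ctr e y (ctr e x (∑ r ∈ (Finset.HasAntidiagonal.antidiagonal n).attach,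
      genMul r.1.1 r.1.2 (t (Finset.HasAntidiagonal.mem_antidiagonal.1 r.2))))) =
    TensorProduct.lift ((LinearMap.mul ℚ ℚ).compl₁₂ (e p x) (e q y)) (t h) +
      (-1 : ℚ) ^ ((p + 1) * (q + 1)) *
        TensorProduct.lift ((LinearMap.mul ℚ ℚ).compl₁₂ (e q y) (e p x)) (t h') := by
  simp only [map_sum, aug_ctr_ctr_genMul]
  rw [Finset.sum_add_distrib]
  have h1 := sum_lift_single h (e p x) (e q y) (fun _ => 1) t
  have h2 := sum_lift_single h' (e q y) (e p x) (fun i => (-1) ^ ((p + 1) * (i + 1))) t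
  simp only [one_mul] at h1
  exact congrArg₂ (· + ·) h1 h2

theorem aug_ctr_ctr_sum_ne (e : ∀ n, F n →ₗ[ℚ] Module.Dual ℚ (V n)) {n : ℕ}
    (t : ∀ {i j : ℕ}, i + j = n → V i ⊗[ℚ] V j) {p q : ℕ} (h : p + q ≠ n) (x : F p) (y : F q) :
    Lambda.aug (ctr e y (ctr e x (∑ r ∈ (Finset.HasAntidiagonal.antidiagonal n).attach,
      genMul r.1.1 r.1.2 (t (Finset.HasAntidiagonal.mem_antidiagonal.1 r.2))))) = 0 := by
  simp only [map_sum, aug_ctr_ctr_genMul]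
  refine Finset.sum_eq_zero fun r _ => ?_
  have hr := Finset.HasAntidiagonal.mem_antidiagonal.1 r.2
  rw [lift_single_ne (by omega), lift_single_ne (by omega), mul_zero, add_zero]

/-- The element of `Λ²V` with prescribed contractions. -/
theorem exists_mem_wordLength_two (e : ∀ n, F n →ₗ[ℚ] Module.Dual ℚ (V n)) {n : ℕ}
    (b : ∀ {i j : ℕ}, i + j = n → F i → F j → ℚ)
    (hb : ∀ {i j : ℕ} (h : i + j = n) (h' : j + i = n) x y, b h x y = -((-1 : ℚ) ^ (i * j) * b h' y x))
    (t : ∀ {i j : ℕ}, i + j = n → V i ⊗[ℚ] V j)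
    (ht : ∀ {i j : ℕ} (h : i + j = n) x y, TensorProduct.lift ((LinearMap.mul ℚ ℚ).compl₁₂ (e i x) (e j y))
      (t h) = b h x y) :
    ∃ z ∈ wordLength V 2, (∀ {p q : ℕ} (h : p + q = n) (x : F p) (y : F q),
      Lambda.aug (ctr e y (ctr e x z)) = (-1 : ℚ) ^ (p * q + p) * b h x y) ∧
      ∀ {p q : ℕ} (_ : p + q ≠ n) (x : F p) (y : F q), Lambda.aug (ctr e y (ctr e x z)) = 0 := by
  refine ⟨∑ r ∈ (Finset.HasAntidiagonal.antidiagonal n).attach, genMul r.1.1 r.1.2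
    (((1 / 2 : ℚ) * (-1) ^ (r.1.1 * r.1.2 + r.1.1)) • t (Finset.HasAntidiagonal.mem_antidiagonal.1 r.2)),
    Submodule.sum_mem _ fun r _ => genMul_mem_wordLength _ _ _, fun {p q} h x y => ?_,
    fun {p q} h x y => aug_ctr_ctr_sum_ne e (fun {i j} h => ((1 / 2 : ℚ) * (-1) ^ (i * j + i)) • t h) h x y⟩
  have h' : q + p = n := by omega
  refine (aug_ctr_ctr_sum e (fun {i j} h => ((1 / 2 : ℚ) * (-1) ^ (i * j + i)) • t h) h h' x y).trans ?_
  rw [map_smul, map_smul, ht h, ht h', hb h' h y x]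
  simp only [smul_eq_mul]
  rcases neg_one_pow_eq_or ℚ p with hp | hp <;> rcases neg_one_pow_eq_or ℚ q with hq | hq <;>
    simp [pow_add, pow_mul, mul_add, add_mul, hp, hq] <;> ring

end Sum

end Derivation

variable {L : ℕ → Type u} [∀ n, AddCommGroup (L n)] [∀ n, Module ℚ (L n)] [GradedLie L]
variable {ι : Type v} {I : ι → GradedIdeal L}

theorem lift_eq_pairing {i j : ℕ} (t : predual I i ⊗[ℚ] predual I j) (x : L i) (y : L j) :
    TensorProduct.lift ((LinearMap.mul ℚ ℚ).compl₁₂ (duality I i x) (duality I j y)) t =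
      pairing I i j t x y := by
  induction t using TensorProduct.induction_on with
  | zero => simp
  | add s t hs ht => rw [map_add, map_add, hs, ht]; rfl
  | tmul a b => rfl

/-- The generating space of the quadratic model. -/
abbrev ModelGen (I : ι → GradedIdeal L) : ℕ → Type u := fun n => predual I n

/-- The components of the differential of the quadratic model. -/
def modelComponent (hI : IsEnriched I) {i j n : ℕ} (h : i + j = n) :
    ModelGen I n →ₗ[ℚ] ModelGen I i ⊗[ℚ] ModelGen I j :=
  ((1 / 2 : ℚ) * (-1) ^ (i * j + i)) • cobracket hI h

theorem modelD_gen (hI : IsEnriched I) (n : ℕ) (v : ModelGen I n) :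
    modelD hI (gen (V := ModelGen I) n v) =
      quad (V := ModelGen I) (fun h => modelComponent hI h) n v :=
  derivExt_gen (V := ModelGen I) n v

theorem lift_modelComponent (hI : IsEnriched I) {i j n : ℕ} (h : i + j = n) (v : ModelGen I n)
    (x : L i) (y : L j) : TensorProduct.lift ((LinearMap.mul ℚ ℚ).compl₁₂ (duality I i x) (duality I j y))
      (modelComponent hI h v) = (1 / 2 : ℚ) * (-1) ^ (i * j + i) * v.1 (br h x y) := by
  rw [lift_eq_pairing, modelComponent, LinearMap.smul_apply, map_smul, LinearMap.smul_apply,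
    LinearMap.smul_apply, pairing_cobracket, smul_eq_mul]

/-- The quadratic model is a model of every graded Lie algebra with a dense morphism to `L`. -/
theorem isCE_modelD (hI : IsEnriched I) {F : ℕ → Type w} [∀ n, AddCommGroup (F n)]
    [∀ n, Module ℚ (F n)] [GradedLie F] (g : ∀ n, F n →ₗ[ℚ] L n)
    (hg : ∀ {i j k} (h : i + j = k) x y, g k (br h x y) = br h (g i x) (g j y))
    (hdense : ∀ n (v : predual I n), (∀ x, v.1 (g n x) = 0) → v = 0) :
    IsCE (fun n => duality I n ∘ₗ g n) (modelD hI) where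
  der := derivExt_isDer
  quadratic n v := by
    rw [modelD_gen]; exact quad_mem_wordLength (V := ModelGen I) n v
  separating := hdense
  bracket {p q n} h x y v := by
    have h' : q + p = n := by omega
    rw [modelD_gen, quad_apply]
    refine (aug_ctr_ctr_sum (V := ModelGen I) (fun n => duality I n ∘ₗ g n)
      (fun h => modelComponent hI h v) h h' x y).trans ?_
    simp only [LinearMap.comp_apply]
    rw [lift_modelComponent, lift_modelComponent,
      eq_neg_of_add_eq_zero_left (skew h' h (g q y) (g p x))]
    change _ = _ * v.1 (g n (br h x y))
    rw [hg, map_neg, map_smul]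
    simp only [smul_eq_mul]
    rcases neg_one_pow_eq_or ℚ p with hp | hp <;> rcases neg_one_pow_eq_or ℚ q with hq | hq <;>
      simp [pow_add, pow_mul, mul_add, add_mul, hp, hq] <;> ring
  bracket_ne {p q n} h x y v := by
    rw [modelD_gen, quad_apply]
    exact aug_ctr_ctr_sum_ne (V := ModelGen I) (fun n => duality I n ∘ₗ g n)
      (fun h => modelComponent hI h v) h x y

theorem isCE_modelD_id (hI : IsEnriched I) : IsCE (duality I) (modelD hI) :=
  isCE_modelD hI (fun _ => LinearMap.id) (fun _ _ _ => rfl) fun _ _ hv =>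
    Subtype.ext (LinearMap.ext hv)

/-! ## The canonical map to cohomology -/

theorem exists_eq_toModule {V : ℕ → Type u} [∀ n, AddCommGroup (V n)] [∀ n, Module ℚ (V n)]
    {a : Lambda V} (ha : a ∈ wordLength V 1) :
    ∃ b : ⨁ n, V n, a = DirectSum.toModule ℚ ℕ (Lambda V) gen b := by
  refine wordLength_one_induction (p := fun a => ∃ b : ⨁ n, V n, a = DirectSum.toModule ℚ ℕ (Lambda V) gen b)
    (fun n v => ⟨DirectSum.lof ℚ ℕ V n v, by rw [DirectSum.toModule_lof]⟩) ⟨0, by rw [map_zero]⟩ ?_ ?_ ha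
  · rintro _ _ ⟨b, rfl⟩ ⟨c, rfl⟩
    exact ⟨b + c, by rw [map_add]⟩
  · rintro c _ ⟨b, rfl⟩
    exact ⟨c • b, by rw [map_smul]⟩

/-- Pairing with x and y of total degree n isolates the summand `b n`, since d is homogeneous. -/
theorem IsCE.d_gen_eq_zero {V : ℕ → Type u} [∀ n, AddCommGroup (V n)] [∀ n, Module ℚ (V n)]
    {F : ℕ → Type w} [∀ n, AddCommGroup (F n)] [∀ n, Module ℚ (F n)] [GradedLie F]
    {e : ∀ n, F n →ₗ[ℚ] Module.Dual ℚ (V n)} {d : Lambda V →ₗ[ℚ] Lambda V} (hd : IsCE e d)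
    {b : ⨁ n, V n} (hb : d (DirectSum.toModule ℚ ℕ (Lambda V) gen b) = 0) (n : ℕ) :
    d (gen n (b n)) = 0 := by
  refine hd.eq_of_two (hd.quadratic _ _) (zero_mem _) fun p q x y => ?_
  rw [map_zero, map_zero, map_zero]
  by_cases h : p + q = n
  · have key : Lambda.aug ∘ₗ ctr e y ∘ₗ ctr e x ∘ₗ d ∘ₗ DirectSum.toModule ℚ ℕ (Lambda V) gen =
        Lambda.aug ∘ₗ ctr e y ∘ₗ ctr e x ∘ₗ d ∘ₗ gen n ∘ₗ DirectSum.component ℚ ℕ V n := by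
      refine DirectSum.linearMap_ext _ fun m => LinearMap.ext fun v => ?_
      simp only [LinearMap.comp_apply, DirectSum.toModule_lof]
      by_cases hm : m = n
      · subst hm
        rw [DirectSum.component.lof_self]
      · rw [hd.bracket_ne (fun h' => hm (h'.symm.trans h)), DirectSum.component.of, dif_neg hm]
        simp only [map_zero]
    have := LinearMap.congr_fun key b
    simp only [LinearMap.comp_apply, hb, map_zero] at this
    exact this.symm
  · exact hd.bracket_ne h x y _

/-- The sum of the inclusions of the spaces `V ∩ ker d`. -/
def cycleSum (hI : IsEnriched I) : (⨁ n, cycleGen hI n) →ₗ[ℚ] Model I :=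
  DirectSum.toModule ℚ ℕ (Model I) fun n => gen (V := ModelGen I) n ∘ₗ (cycleGen hI n).subtype

theorem cycleSum_mem (hI : IsEnriched I) (b : ⨁ n, cycleGen hI n) :
    cycleSum hI b ∈ wordLength (ModelGen I) 1 := by
  induction b using DirectSum.induction_on with
  | zero => rw [map_zero]; exact zero_mem _
  | add a b ha hb => rw [map_add]; exact add_mem ha hb
  | of n v =>
    rw [← DirectSum.lof_eq_of ℚ, cycleSum, DirectSum.toModule_lof]; exact gen_mem_wordLength (V := ModelGen I) v.1

theorem modelD_cycleSum (hI : IsEnriched I) (b : ⨁ n, cycleGen hI n) :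
    modelD hI (cycleSum hI b) = 0 := by
  induction b using DirectSum.induction_on with
  | zero => rw [map_zero, map_zero]
  | add a b ha hb => rw [map_add, map_add, ha, hb, add_zero]
  | of n v => rw [← DirectSum.lof_eq_of ℚ, cycleSum, DirectSum.toModule_lof]; exact v.2

theorem aug_contraction_cycleSum (hI : IsEnriched I) (b : ⨁ n, cycleGen hI n) (n : ℕ)
    (ξ : Module.Dual ℚ (ModelGen I n)) :
    Lambda.aug (contraction (V := ModelGen I) n ξ (cycleSum hI b)) = ξ (b n).1 := by
  have key : Lambda.aug ∘ₗ contraction (V := ModelGen I) n ξ ∘ₗ cycleSum hI =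
      ξ ∘ₗ (cycleGen hI n).subtype ∘ₗ DirectSum.component ℚ ℕ _ n := by
    refine DirectSum.linearMap_ext _ fun m => LinearMap.ext fun v => ?_
    simp only [LinearMap.comp_apply, cycleSum, DirectSum.toModule_lof]
    by_cases h : m = n
    · subst h
      rw [contraction_gen_self, aug_algebraMap, DirectSum.component.lof_self]
    · rw [contraction_gen_ne h, DirectSum.component.of, dif_neg h, map_zero, map_zero, map_zero]
  exact LinearMap.congr_fun key b

theorem toCohomology_eq_iff (hI : IsEnriched I) (c : ℚ) (b : ⨁ n, cycleGen hI n) (a : Model I)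
    (ha : modelD hI a = 0) : toCohomology hI (c, b) = Submodule.Quotient.mk ⟨a, ha⟩ ↔
      ∃ y, a = algebraMap ℚ _ c + cycleSum hI b + modelD hI y := by
  refine eq_comm.trans ((Submodule.Quotient.eq _).trans ?_)
  change (∃ y, modelD hI y = a - (algebraMap ℚ _ c + cycleSum hI b)) ↔ _
  refine exists_congr fun y => ?_
  rw [eq_sub_iff_add_eq, add_comm, eq_comm]

/-- d raises word length by one and kills scalars, so a boundary has no components of length 0 or 1,
which is where the source lives. -/
theorem toCohomology_injective (hI : IsEnriched I) : Function.Injective (toCohomology hI) := by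
  have hd := isCE_modelD_id hI
  rintro ⟨c, b⟩ ⟨c', b'⟩ h
  have h0 : ∀ c, algebraMap ℚ (Model I) c ∈ wordLength (ModelGen I) 0 := fun c => by
    rw [Algebra.algebraMap_eq_smul_one]; exact Submodule.smul_mem _ _ one_mem_wordLength
  obtain ⟨y, hy⟩ := (toCohomology_eq_iff hI c b (algebraMap ℚ _ c' + cycleSum hI b') (by
    rw [map_add, modelD_algebraMap, modelD_cycleSum, add_zero])).1 h
  obtain ⟨h2, h3⟩ := hd.der.component_comm hd.quadratic y
  have h4 := h3 0
  rw [mem_wordLength_zero (component_mem 0 y), hd.der.algebraMap, zero_add] at h4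
  have h5 := congrArg (component 0) hy
  have h6 := congrArg (component 1) hy
  rw [map_add, map_add, map_add, h2, component_of_mem _ (h0 c), component_of_mem _ (h0 c'),
    component_of_mem _ (cycleSum_mem hI b), component_of_mem _ (cycleSum_mem hI b')] at h5
  rw [map_add, map_add, map_add, h4, component_of_mem _ (h0 c), component_of_mem _ (h0 c'),
    component_of_mem _ (cycleSum_mem hI b), component_of_mem _ (cycleSum_mem hI b')] at h6
  simp only [if_true, zero_ne_one, one_ne_zero, if_false, add_zero, zero_add] at h5 h6
  refine Prod.ext ?_ (DFinsupp.ext fun n => Subtype.ext ?_)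
  · have := congrArg Lambda.aug h5
    rw [aug_algebraMap, aug_algebraMap] at this
    exact this.symm
  · rw [← sub_eq_zero, ← Module.forall_dual_apply_eq_zero_iff ℚ]
    intro ξ
    rw [map_sub, ← aug_contraction_cycleSum, ← aug_contraction_cycleSum, h6, sub_self]

theorem toCohomology_bijective_iff (hI : IsEnriched I) : Function.Bijective (toCohomology hI) ↔
    ∀ a : Model I, modelD hI a = 0 → ∃ (c : ℚ) (b y : Model I),
      b ∈ wordLength (ModelGen I) 1 ∧ modelD hI b = 0 ∧
        a = algebraMap ℚ _ c + b + modelD hI y := by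
  classical
  have hd := isCE_modelD_id hI
  constructor
  · intro h a ha
    obtain ⟨⟨c, b⟩, hb⟩ := h.2 (Submodule.Quotient.mk ⟨a, ha⟩)
    obtain ⟨y, hy⟩ := (toCohomology_eq_iff hI c b a ha).1 hb
    exact ⟨c, cycleSum hI b, y, cycleSum_mem hI b, modelD_cycleSum hI b, hy⟩
  · refine fun h => ⟨toCohomology_injective hI, fun z => ?_⟩
    induction z using Submodule.Quotient.induction_on with | _ a => ?_
    obtain ⟨a, ha⟩ := a
    obtain ⟨c, b, y, hb, hb', hy⟩ := h a ha
    obtain ⟨b, rfl⟩ := exists_eq_toModule hb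
    have hcyc : ∀ n, b n ∈ cycleGen hI n := fun n => hd.d_gen_eq_zero hb' n
    refine ⟨(c, ∑ n ∈ DFinsupp.support b, DirectSum.lof ℚ ℕ _ n ⟨b n, hcyc n⟩),
      (toCohomology_eq_iff hI _ _ a ha).2 ⟨y, ?_⟩⟩
    rw [hy, map_sum]
    congr 2
    nth_rewrite 1 [← DirectSum.sum_support_of b]
    rw [map_sum]
    refine Finset.sum_congr rfl fun n _ => ?_
    rw [cycleSum, DirectSum.toModule_lof, ← DirectSum.lof_eq_of ℚ, DirectSum.toModule_lof]
    rfl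

end ModelCE
end EnrichedLie
end

/-! ### Maps that induce isomorphisms of completions. -/

noncomputable section
namespace EnrichedLie

section DenseMaps

open GradedLie

variable {T : ℕ → Type u} [∀ n, AddCommGroup (T n)] [∀ n, Module ℚ (T n)]
variable {S : ℕ → Type w} [∀ n, AddCommGroup (S n)] [∀ n, Module ℚ (S n)]
variable {ι : Type v} {κ : Type z}

/-! ## Dense maps of enriched spaces -/

/-- A linear map `f` that induces an isomorphism of completions. -/
structure IsDenseMap (K : ι → GSub T) (J : κ → GSub S) (f : ∀ n, T n →ₗ[ℚ] S n) : Prop where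
  dense : ∀ β n (y : S n), ∃ x, y - f n x ∈ J β n
  coherent : Coherent K J f
  reflects : ∀ α, ∃ β, ∀ n x, f n x ∈ J β n → x ∈ K α n

theorem mem_limKer_toLim (K : ι → GSub T) (α : ι) (n : ℕ) (x : T n) :
    toLim K n x ∈ limKer K α n ↔ x ∈ K α n := by
  change Submodule.Quotient.mk x = 0 ↔ _
  exact Submodule.Quotient.mk_eq_zero _

theorem isDenseMap_toLim (K : ι → GSub T) : IsDenseMap K (limKer K) (toLim K) where
  dense α n y := by
    obtain ⟨x, hx⟩ := Submodule.Quotient.mk_surjective _ (y.1 α)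
    refine ⟨x, ?_⟩
    change y.1 α - Submodule.Quotient.mk x = 0
    rw [hx, sub_self]
  coherent α := ⟨α, fun n x hx => (mem_limKer_toLim K α n x).2 hx⟩
  reflects α := ⟨α, fun n x hx => (mem_limKer_toLim K α n x).1 hx⟩

theorem IsDenseMap.comp_equiv {R : ℕ → Type*} [∀ n, AddCommGroup (R n)] [∀ n, Module ℚ (R n)]
    {μ : Type*} {K : ι → GSub T} {J : κ → GSub S} {H : μ → GSub R} {f : ∀ n, T n →ₗ[ℚ] S n}
    (hf : IsDenseMap K J f) (g : ∀ n, S n ≃ₗ[ℚ] R n)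
    (h1 : Coherent J H fun n => (g n).toLinearMap)
    (h2 : Coherent H J fun n => (g n).symm.toLinearMap) :
    IsDenseMap K H fun n => (g n).toLinearMap ∘ₗ f n where
  dense γ n y := by
    obtain ⟨β, hβ⟩ := h1 γ
    obtain ⟨x, hx⟩ := hf.dense β n ((g n).symm y)
    refine ⟨x, ?_⟩
    have := hβ n _ hx
    rwa [LinearEquiv.coe_coe, map_sub, LinearEquiv.apply_symm_apply] at this
  coherent γ := by
    obtain ⟨β, hβ⟩ := h1 γ
    obtain ⟨α, hα⟩ := hf.coherent β
    exact ⟨α, fun n x hx => hβ n _ (hα n x hx)⟩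
  reflects α := by
    obtain ⟨β, hβ⟩ := hf.reflects α
    obtain ⟨γ, hγ⟩ := h2 β
    refine ⟨γ, fun n x hx => hβ n x ?_⟩
    have := hγ n _ hx
    rwa [LinearMap.comp_apply, LinearEquiv.coe_coe, LinearEquiv.coe_coe,
      LinearEquiv.symm_apply_apply] at this

theorem exists_linearMap_factor {A B C : Type*} [AddCommGroup A] [Module ℚ A] [AddCommGroup B]
    [Module ℚ B] [AddCommGroup C] [Module ℚ C] (h : A →ₗ[ℚ] B) (hs : Function.Surjective h)
    (q : A →ₗ[ℚ] C) (hq : ∀ x, h x = 0 → q x = 0) : ∃ r : B →ₗ[ℚ] C, ∀ x, r (h x) = q x := by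
  obtain ⟨s, hs⟩ := LinearMap.exists_rightInverse_of_surjective h (LinearMap.range_eq_top.2 hs)
  refine ⟨q ∘ₗ s, fun x => ?_⟩
  have := LinearMap.congr_fun hs (h x)
  rw [LinearMap.comp_apply, ← sub_eq_zero, ← map_sub]
  refine hq _ ?_
  rw [map_sub, sub_eq_zero]
  exact this

/-- Density gives S = f(T) + J β, and the preimage of J β lies in K α; so T → T / K α descends to S
/ J β. -/
theorem IsDenseMap.exists_factor {K : ι → GSub T} {J : κ → GSub S} {f : ∀ n, T n →ₗ[ℚ] S n}
    (hf : IsDenseMap K J f) {C : Type*} [AddCommGroup C] [Module ℚ C] {α : ι} {β : κ} {n : ℕ}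
    (hβ : ∀ x, f n x ∈ J β n → x ∈ K α n) (q : T n →ₗ[ℚ] C) (hq : ∀ x ∈ K α n, q x = 0) :
    ∃ r : S n →ₗ[ℚ] C, (∀ x, r (f n x) = q x) ∧ ∀ y ∈ J β n, r y = 0 := by
  obtain ⟨r, hr⟩ := exists_linearMap_factor ((J β n).mkQ ∘ₗ f n) (fun y => by
    induction y using Submodule.Quotient.induction_on with | _ y => ?_
    obtain ⟨x, hx⟩ := hf.dense β n y
    exact ⟨x, ((Submodule.Quotient.eq _).2 hx).symm⟩) q
    (fun x hx => hq x (hβ x ((Submodule.Quotient.mk_eq_zero _).1 hx)))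
  refine ⟨r ∘ₗ (J β n).mkQ, hr, fun y hy => ?_⟩
  rw [LinearMap.comp_apply, Submodule.mkQ_apply, (Submodule.Quotient.mk_eq_zero _).2 hy, map_zero]

/-- A dense map to a complete space identifies it with the completion of the source. -/
theorem IsDenseMap.exists_equiv {K : ι → GSub T} {J : κ → GSub S} {f : ∀ n, T n →ₗ[ℚ] S n}
    (hf : IsDenseMap K J f) (hK : IsDirectedFamily K) (hJ : IsDirectedFamily J)
    (hJ' : IsLimComplete J) : ∃ Φ : ∀ n, invLim K n ≃ₗ[ℚ] S n,
      (∀ n x, Φ n (toLim K n x) = f n x) ∧ Coherent (limKer K) J (fun n => (Φ n).toLinearMap) ∧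
      Coherent J (limKer K) fun n => (Φ n).symm.toLinearMap := by
  choose b hb using hf.reflects
  choose a ha using hf.coherent
  -- The maps r extend the quotient maps T → T / K α along f. Together they form the inverse S → lim
  -- T / K α of the map sought.
  have hr : ∀ n α, ∃ r : S n →ₗ[ℚ] T n ⧸ K α n, (∀ x, r (f n x) = Submodule.Quotient.mk x) ∧
      ∀ y ∈ J (b α) n, r y = 0 := fun n α =>
    hf.exists_factor (hb α n) (K α n).mkQ fun x hx => (Submodule.Quotient.mk_eq_zero _).2 hx
  choose r hr hr' using hr
  have hsep : ∀ n (y : S n), (∀ β, y ∈ J β n) → y = 0 := fun n y hy =>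
    (hJ' n).1 (Subtype.ext (funext fun β => by
      rw [map_zero]; exact (Submodule.Quotient.mk_eq_zero _).2 (hy β)))
  have hrx : ∀ {n α} {y : S n} {x : T n}, y - f n x ∈ J (b α) n → r n α y = Submodule.Quotient.mk x :=
    fun {n α y x} h => by rw [← hr, ← sub_eq_zero, ← map_sub, hr' n α _ h]
  have hmem : ∀ {n β} {y : S n}, r n (a β) y = 0 → y ∈ J β n := by
    intro n β y hy
    obtain ⟨γ, h1, h2⟩ := hJ.2 β (b (a β))
    obtain ⟨x, hx⟩ := hf.dense γ n y
    rw [hrx (h2 n hx), Submodule.Quotient.mk_eq_zero] at hy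
    have := add_mem (h1 n hx) (ha β n x hy)
    rwa [sub_add_cancel] at this
  let Φ : ∀ n, S n →ₗ[ℚ] invLim K n := fun n =>
    LinearMap.codRestrict (invLim K n) (LinearMap.pi (r n)) fun y α β h => by
      obtain ⟨γ, h1, h2⟩ := hJ.2 (b α) (b β)
      obtain ⟨x, hx⟩ := hf.dense γ n y
      rw [LinearMap.pi_apply, LinearMap.pi_apply, hrx (h1 n hx), hrx (h2 n hx)]
      rfl
  have hΦ : ∀ n, Function.Bijective (Φ n) := by
    intro n
    refine ⟨(injective_iff_map_eq_zero _).2 fun y hy => hsep n y fun β => hmem ?_, fun y => ?_⟩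
    · exact congrFun (congrArg Subtype.val hy) (a β)
    · choose x hx using fun α => Submodule.Quotient.mk_surjective _ (y.1 α)
      have hxy : ∀ α β, K α ≤ K β → x α - x β ∈ K β n := fun α β h => by
        rw [← Submodule.Quotient.eq, hx β, ← y.2 α β h, ← hx α]; rfl
      have hxx : ∀ α β, x α - x (a β) ∈ K (a β) n → f n (x α) - f n (x (a β)) ∈ J β n := fun α β h => by
        rw [← map_sub]; exact ha β n _ h
      -- Surjectivity: representatives x of the given family have images in S that are compatible
      -- along the indices `a β`, and completeness of S provides the limit l.
      obtain ⟨l, hl⟩ := (hJ' n).2 ⟨fun β => Submodule.Quotient.mk (f n (x (a β))), fun α β h => by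
        change Submodule.Quotient.mk (f n (x (a α))) = Submodule.Quotient.mk (f n (x (a β)))
        rw [Submodule.Quotient.eq]
        obtain ⟨γ, h1, h2⟩ := hK.2 (a α) (a β)
        have := sub_mem (hxx γ β (hxy γ _ h2)) (h n (hxx γ α (hxy γ _ h1)))
        rwa [sub_sub_sub_cancel_left] at this⟩
      refine ⟨l, Subtype.ext (funext fun α => ?_)⟩
      have hl' : l - f n (x (a (b α))) ∈ J (b α) n :=
        (Submodule.Quotient.eq _).1 (congrFun (congrArg Subtype.val hl) (b α))
      change r n α l = y.1 α
      rw [hrx hl', ← hx α, Submodule.Quotient.eq]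
      obtain ⟨γ, h1, h2⟩ := hK.2 (a (b α)) α
      have h3 := hb α n _ (by rw [map_sub]; exact hxx γ (b α) (hxy γ _ h1))
      have := sub_mem (hxy γ α h2) h3
      rwa [sub_sub_sub_cancel_left] at this
  refine ⟨fun n => (LinearEquiv.ofBijective (Φ n) (hΦ n)).symm, fun n x => ?_, fun β => ?_, fun α => ?_⟩
  · rw [LinearEquiv.symm_apply_eq]
    exact Subtype.ext (funext fun α => (hr n α x).symm)
  · refine ⟨a β, fun n y hy => hmem ?_⟩
    obtain ⟨l, rfl⟩ := (hΦ n).2 y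
    have : (LinearEquiv.ofBijective (Φ n) (hΦ n)).symm (Φ n l) = l :=
      LinearEquiv.symm_apply_apply (LinearEquiv.ofBijective (Φ n) (hΦ n)) l
    rw [LinearEquiv.coe_coe, this]
    exact hy
  · exact ⟨b α, fun n y hy => hr' n α y hy⟩

section Lie

variable {L : ℕ → Type u} [∀ n, AddCommGroup (L n)] [∀ n, Module ℚ (L n)] [GradedLie L]
variable {F : ℕ → Type w} [∀ n, AddCommGroup (F n)] [∀ n, Module ℚ (F n)] [GradedLie F]

theorem toLim_br (J : κ → GradedIdeal F) {i j k : ℕ} (h : i + j = k) (x : F i) (y : F j) :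
    toLim (fun p => (J p).sub) k (br h x y) =
      br (L := fun n => invLim (fun p => (J p).sub) n) h (toLim (fun p => (J p).sub) i x)
        (toLim (fun p => (J p).sub) j y) := rfl

/-- The equivalence respects brackets by continuity: modulo any I α, the elements x and y can be
replaced by elements of F, where it is f. -/
theorem IsDenseMap.nonempty_enrichedIso {J : κ → GradedIdeal F} {I : ι → GradedIdeal L}
    {f : ∀ n, F n →ₗ[ℚ] L n} (hf : IsDenseMap (fun p => (J p).sub) (fun α => (I α).sub) f)
    (hbr : ∀ {i j k} (h : i + j = k) x y, f k (br h x y) = br h (f i x) (f j y))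
    (hJ : IsDirectedFamily fun p => (J p).sub) (hI : IsEnriched I)
    (hL : IsLimComplete fun α => (I α).sub) :
    Nonempty (EnrichedIso (limKer fun p => (J p).sub) fun α => (I α).sub) := by
  obtain ⟨Φ, h1, h2, h3⟩ := hf.exists_equiv hJ hI.directed hL
  refine ⟨⟨Φ, fun {i j k} h x y => ?_, h2, h3⟩⟩
  rw [← sub_eq_zero]
  refine hI.separated _ _ fun α => ?_
  obtain ⟨p, hp⟩ := h2 α
  obtain ⟨a, ha⟩ := (isDenseMap_toLim fun p => (J p).sub).dense p i x
  obtain ⟨b, hb⟩ := (isDenseMap_toLim fun p => (J p).sub).dense p j y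
  have e1 := hp i _ ha
  have e2 := hp j _ hb
  rw [LinearEquiv.coe_coe, map_sub, h1] at e1 e2
  have e3 : br (L := fun n => invLim (fun p => (J p).sub) n) h x y -
      br (L := fun n => invLim (fun p => (J p).sub) n) h (toLim (fun p => (J p).sub) i a) (toLim (fun p => (J p).sub) j b) ∈
      limKer (fun p => (J p).sub) p k := by
    have ha' : x.1 p = Submodule.Quotient.mk a := sub_eq_zero.1 ha
    have hb' : y.1 p = Submodule.Quotient.mk b := sub_eq_zero.1 hb
    change (J p).quotBr h (x.1 p) (y.1 p) - (J p).quotBr h (Submodule.Quotient.mk a)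
      (Submodule.Quotient.mk b) = 0
    rw [ha', hb', sub_self]
  have e4 := hp k _ e3
  rw [LinearEquiv.coe_coe, map_sub, ← toLim_br, h1, hbr] at e4
  have e5 := (I α).br_mem_left h (Φ i x - f i a) (Φ j y) e1
  have e6 := (I α).br_mem h (f i a) (Φ j y - f j b) e2
  have := sub_mem e4 (add_mem e5 e6)
  rw [map_sub, LinearMap.sub_apply, map_sub, sub_add_sub_cancel, sub_sub_sub_cancel_right] at this
  exact this

end Lie

section Predual

variable {L : ℕ → Type u} [∀ n, AddCommGroup (L n)] [∀ n, Module ℚ (L n)] [GradedLie L]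
variable {F : ℕ → Type w} [∀ n, AddCommGroup (F n)] [∀ n, Module ℚ (F n)]
variable {I : ι → GradedIdeal L}

theorem IsDenseMap.eq_zero (hI : IsEnriched I) {J : κ → GSub F} {f : ∀ n, F n →ₗ[ℚ] L n}
    (hf : IsDenseMap J (fun α => (I α).sub) f) {n : ℕ} (v : predual I n) (hv : ∀ x, v.1 (f n x) = 0) :
    v = 0 := by
  obtain ⟨α, hα⟩ := (mem_predual hI).1 v.2
  rw [Submodule.mem_dualAnnihilator] at hα
  refine Subtype.ext (LinearMap.ext fun y => ?_)
  obtain ⟨x, hx⟩ := hf.dense α n y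
  have := hα _ hx
  rwa [map_sub, hv, sub_zero] at this

theorem IsDenseMap.exists_kernel (hI : IsEnriched I) {J : κ → GSub F} {f : ∀ n, F n →ₗ[ℚ] L n}
    (hf : IsDenseMap J (fun α => (I α).sub) f) {n : ℕ} (v : predual I n) :
    ∃ p, ∀ x ∈ J p n, v.1 (f n x) = 0 := by
  obtain ⟨α, hα⟩ := (mem_predual hI).1 v.2
  rw [Submodule.mem_dualAnnihilator] at hα
  obtain ⟨p, hp⟩ := hf.coherent α
  exact ⟨p, fun x hx => hα _ (hp n x hx)⟩

/-- Together with `IsDenseMap.eq_zero` and `IsDenseMap.exists_kernel`: v ↦ v ∘ f identifies V with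
the continuous dual of F, as `IsCE.exists_eq_add_of_dual` requires. -/
theorem IsDenseMap.exists_predual (hI : IsEnriched I) {J : κ → GSub F} {f : ∀ n, F n →ₗ[ℚ] L n}
    (hf : IsDenseMap J (fun α => (I α).sub) f) {n : ℕ} (φ : Module.Dual ℚ (F n)) {p : κ}
    (hφ : ∀ x ∈ J p n, φ x = 0) : ∃ v : predual I n, ∀ x, v.1 (f n x) = φ x := by
  obtain ⟨α, hα⟩ := hf.reflects p
  obtain ⟨r, h1, h2⟩ := hf.exists_factor (hα n) φ hφ
  exact ⟨⟨r, (mem_predual hI).2 ⟨α, (Submodule.mem_dualAnnihilator _).2 h2⟩⟩, h1⟩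

end Predual

section Profree

variable {L : ℕ → Type u} [∀ n, AddCommGroup (L n)] [∀ n, Module ℚ (L n)] [GradedLie L]
variable {I : ι → GradedIdeal L} {T : ℕ → Type w} [∀ n, AddCommGroup (T n)] [∀ n, Module ℚ (T n)]
variable {K : κ → GSub T}

/-- The morphism from `𝕃_T` that an isomorphism with the completion of `𝕃_T` defines. -/
def EnrichedIso.ofFree (Ψ : EnrichedIso (profreeFamily K) fun α => (I α).sub) (n : ℕ) :
    FreeLie T n →ₗ[ℚ] L n := (Ψ.equiv n).toLinearMap ∘ₗ toLim (freeFamily K) n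

theorem EnrichedIso.isDenseMap (Ψ : EnrichedIso (profreeFamily K) fun α => (I α).sub) :
    IsDenseMap (freeFamily K) (fun α => (I α).sub) Ψ.ofFree :=
  (isDenseMap_toLim (freeFamily K)).comp_equiv Ψ.equiv Ψ.coherent Ψ.coherent_symm

theorem EnrichedIso.ofFree_br (Ψ : EnrichedIso (profreeFamily K) fun α => (I α).sub) {i j k : ℕ}
    (h : i + j = k) (x : FreeLie T i) (y : FreeLie T j) :
    Ψ.ofFree k (br h x y) = br h (Ψ.ofFree i x) (Ψ.ofFree j y) :=
  Ψ.map_br h (toLim (freeFamily K) i x) (toLim (freeFamily K) j y)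

theorem IsProfree.toCohomology_bijective (hI : IsEnriched I) (h : IsProfree I) :
    Function.Bijective (toCohomology hI) := by
  obtain ⟨T, _, _, κ, K, hK, -, ⟨Ψ⟩⟩ := h
  have hf := Ψ.isDenseMap
  refine (toCohomology_bijective_iff hI).2 fun a ha => ?_
  exact (isCE_modelD hI Ψ.ofFree Ψ.ofFree_br fun n v hv => hf.eq_zero hI v hv).exists_eq_add_of_dual
    hK.directed (fun n v => hf.exists_kernel hI v) (fun n φ p hφ => hf.exists_predual hI φ hφ) ha

end Profree

end DenseMaps
end EnrichedLie
end

/-! ### Complete enriched spaces as duals of their continuous duals. -/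

noncomputable section
namespace EnrichedLie

section Duals

/-! ## Duality for enriched vector spaces -/

/-- The annihilator of N is the dual of the finite dimensional space M / N, which is reflexive. -/
theorem exists_eval_dualAnnihilator {M : Type*} [AddCommGroup M] [Module ℚ M] (N : Submodule ℚ M)
    [FiniteDimensional ℚ (M ⧸ N)] (φ : N.dualAnnihilator →ₗ[ℚ] ℚ) :
    ∃ x : M, ∀ v : N.dualAnnihilator, φ v = v.1 x := by
  let E := Submodule.dualQuotEquivDualAnnihilator N
  obtain ⟨x, hx⟩ := Submodule.Quotient.mk_surjective _
    ((Module.evalEquiv ℚ (M ⧸ N)).symm (φ ∘ₗ E.toLinearMap))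
  refine ⟨x, fun v => ?_⟩
  have h1 : E.symm v (Submodule.Quotient.mk x) = (φ ∘ₗ E.toLinearMap) (E.symm v) := by
    rw [hx, Module.apply_evalEquiv_symm_apply]
  rw [LinearMap.comp_apply, LinearEquiv.coe_coe, LinearEquiv.apply_symm_apply] at h1
  rw [← h1]
  conv_rhs => rw [← E.apply_symm_apply v]
  rfl

/-- θ factors through restriction to U, and U is reflexive. -/
theorem exists_eval_of_finite {W : Type*} [AddCommGroup W] [Module ℚ W] (U : Submodule ℚ W)
    [FiniteDimensional ℚ U] (θ : Module.Dual ℚ (Module.Dual ℚ W))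
    (hθ : ∀ ξ ∈ U.dualAnnihilator, θ ξ = 0) : ∃ w ∈ U, ∀ ξ, θ ξ = ξ w := by
  obtain ⟨r, hr⟩ := exists_linearMap_factor U.dualRestrict Subspace.dualRestrict_surjective θ
    (fun ξ hξ => hθ ξ (by rwa [← Submodule.dualRestrict_ker_eq_dualAnnihilator, LinearMap.mem_ker]))
  refine ⟨((Module.evalEquiv ℚ U).symm r).1, ((Module.evalEquiv ℚ U).symm r).2, fun ξ => ?_⟩
  rw [← hr, ← Module.apply_evalEquiv_symm_apply]
  rfl

section Space

variable {T : ℕ → Type u} [∀ n, AddCommGroup (T n)] [∀ n, Module ℚ (T n)]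
variable {ι : Type v} {K : ι → GSub T}

/-- The linear forms that vanish on a member of the family. -/
def coherentDual (K : ι → GSub T) (n : ℕ) : Submodule ℚ (Module.Dual ℚ (T n)) :=
  ⨆ α, (K α n).dualAnnihilator

theorem mem_coherentDual (hK : IsDirectedFamily K) {n : ℕ} {f : Module.Dual ℚ (T n)} :
    f ∈ coherentDual K n ↔ ∃ α, f ∈ (K α n).dualAnnihilator := by
  have := hK.1
  refine Submodule.mem_iSup_of_directed _ fun α β => ?_
  obtain ⟨γ, hα, hβ⟩ := hK.2 α β
  exact ⟨γ, Submodule.dualAnnihilator_anti (hα n), Submodule.dualAnnihilator_anti (hβ n)⟩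

theorem mem_of_forall_dualAnnihilator {M : Type*} [AddCommGroup M] [Module ℚ M] {N : Submodule ℚ M}
    {x : M} (h : ∀ v ∈ N.dualAnnihilator, v x = 0) : x ∈ N := by
  rw [← Subspace.dualAnnihilator_dualCoannihilator_eq (W := N), Submodule.mem_dualCoannihilator]
  exact h

/-- On each annihilator of K α, that is on the dual of T / K α, a form φ is evaluation at an element
of T / K α. These elements are compatible, and completeness glues them to an element of T. -/
theorem coherentDual_eval_bijective (hK : IsDirectedFamily K) (hf : ∀ α n, FiniteDimensional ℚ (T n ⧸ K α n))
    (hc : IsLimComplete K) (n : ℕ) :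
    Function.Bijective (LinearMap.flip (coherentDual K n).subtype) := by
  constructor
  · rw [injective_iff_map_eq_zero]
    intro x hx
    refine (hc n).1 (Subtype.ext (funext fun α => ?_))
    rw [map_zero]
    refine (Submodule.Quotient.mk_eq_zero _).2 (mem_of_forall_dualAnnihilator fun v hv => ?_)
    exact LinearMap.congr_fun hx ⟨v, (mem_coherentDual hK).2 ⟨α, hv⟩⟩
  · intro φ
    have hle : ∀ α, (K α n).dualAnnihilator ≤ coherentDual K n := fun α => le_iSup (fun α => (K α n).dualAnnihilator) α
    have hx : ∀ α, ∃ x : T n, ∀ v : (K α n).dualAnnihilator, (φ ∘ₗ Submodule.inclusion (hle α)) v = v.1 x :=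
      fun α => by
        have := hf α n
        exact exists_eval_dualAnnihilator _ _
    choose x hx using hx
    obtain ⟨y, hy⟩ := (hc n).2 ⟨fun α => Submodule.Quotient.mk (x α), fun α β h => by
      change Submodule.Quotient.mk (x α) = Submodule.Quotient.mk (x β)
      rw [Submodule.Quotient.eq]
      refine mem_of_forall_dualAnnihilator fun v hv => ?_
      have h1 := hx β ⟨v, hv⟩
      have h2 := hx α ⟨v, Submodule.dualAnnihilator_anti (h n) hv⟩
      rw [map_sub, ← h1, ← h2]
      exact sub_self _⟩
    refine ⟨y, LinearMap.ext fun v => ?_⟩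
    obtain ⟨α, hα⟩ := (mem_coherentDual hK).1 v.2
    have hy' : y - x α ∈ K α n :=
      (Submodule.Quotient.eq _).1 (congrFun (congrArg Subtype.val hy) α)
    have h1 := hx α ⟨v.1, hα⟩
    have h2 := (Submodule.mem_dualAnnihilator _).1 hα _ hy'
    rw [map_sub, sub_eq_zero] at h2
    exact h2.trans h1.symm

/-- One finite set of homogeneous elements encodes both clauses of `FiniteCodim`. Such sets can be
bracketed, which serves the induction for free Lie algebras. -/
theorem FiniteCodim.exists_finite {K : GSub T} (hK : FiniteCodim K) :
    ∃ G : Set (Σ n, T n), G.Finite ∧ ∀ n (x : T n),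
      ∃ y ∈ Submodule.span ℚ {a | (⟨n, a⟩ : Σ n, T n) ∈ G}, x - y ∈ K n := by
  obtain ⟨h1, N, h2⟩ := hK
  have hs : ∀ n, ∃ s : Set (T n), s.Finite ∧ ∀ x, ∃ y ∈ Submodule.span ℚ s, x - y ∈ K n := by
    intro n
    let B := Module.finBasis ℚ (T n ⧸ K n)
    choose b hb using fun k => Submodule.Quotient.mk_surjective _ (B k)
    refine ⟨Set.range b, Set.finite_range b, fun x => ⟨∑ k, B.repr (Submodule.Quotient.mk x) k • b k,
      Submodule.sum_mem _ fun k _ => Submodule.smul_mem _ _ (Submodule.subset_span ⟨k, rfl⟩), ?_⟩⟩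
    rw [← Submodule.Quotient.eq]
    conv_lhs => rw [← B.sum_repr (Submodule.Quotient.mk x)]
    rw [← Submodule.mkQ_apply (K n) (∑ k, _), map_sum]
    exact Finset.sum_congr rfl fun k _ => by rw [map_smul, Submodule.mkQ_apply, hb]
  choose s hs hs' using hs
  refine ⟨⋃ n ∈ Set.Iio N, Sigma.mk n '' s n, (Set.finite_Iio N).biUnion fun n _ => (hs n).image _, fun n x => ?_⟩
  by_cases hn : n < N
  · obtain ⟨y, hy, hxy⟩ := hs' n x
    refine ⟨y, Submodule.span_mono (fun a ha => ?_) hy, hxy⟩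
    exact Set.mem_biUnion (Set.mem_Iio.2 hn) ⟨a, ha, rfl⟩
  · exact ⟨0, zero_mem _, by rw [h2 n (not_lt.1 hn)]; trivial⟩

theorem finiteCodim_of_finite {K : GSub T} {G : Set (Σ n, T n)} (hG : G.Finite)
    (h : ∀ n (x : T n), ∃ y ∈ Submodule.span ℚ {a | (⟨n, a⟩ : Σ n, T n) ∈ G}, x - y ∈ K n) :
    FiniteCodim K := by
  constructor
  · intro n
    have hfin : {a | (⟨n, a⟩ : Σ n, T n) ∈ G}.Finite :=
      hG.preimage (sigma_mk_injective.injOn)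
    have := FiniteDimensional.span_of_finite ℚ hfin
    refine Module.Finite.of_surjective ((K n).mkQ ∘ₗ (Submodule.span ℚ {a | (⟨n, a⟩ : Σ n, T n) ∈ G}).subtype) ?_
    intro x
    induction x using Submodule.Quotient.induction_on with | _ x => ?_
    obtain ⟨y, hy, hxy⟩ := h n x
    exact ⟨⟨y, hy⟩, ((Submodule.Quotient.eq _).2 hxy).symm⟩
  · obtain ⟨N, hN⟩ := (hG.image Sigma.fst).bddAbove
    refine ⟨N + 1, fun n hn => eq_top_iff.2 fun x _ => ?_⟩
    obtain ⟨y, hy, hxy⟩ := h n x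
    have he : {a | (⟨n, a⟩ : Σ n, T n) ∈ G} = ∅ := by
      refine Set.eq_empty_of_forall_notMem fun a ha => ?_
      have : n ≤ N := hN ⟨_, ha, rfl⟩
      omega
    rw [he, Submodule.span_empty, Submodule.mem_bot] at hy
    rwa [hy, sub_zero] at hxy

end Space

section Annihilators

variable {W : ℕ → Type u} [∀ n, AddCommGroup (W n)] [∀ n, Module ℚ (W n)]
variable {ι : Type v} {U : ι → GSub W}

/-- The annihilators of a family of graded subspaces. -/
def annFamily (U : ι → GSub W) (α : ι) : GSub fun n => Module.Dual ℚ (W n) :=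
  fun n => (U α n).dualAnnihilator

theorem isEnrichedSpace_annFamily (h1 : ∀ α n, FiniteDimensional ℚ (U α n))
    (h2 : ∀ α, ∃ N, ∀ n, N ≤ n → U α n = ⊥) (h3 : Nonempty ι)
    (h4 : ∀ α β, ∃ γ, U α ≤ U γ ∧ U β ≤ U γ) (h5 : ∀ n (w : W n), ∃ α, w ∈ U α n) :
    IsEnrichedSpace (annFamily U) where
  finiteCodim α := by
    refine ⟨fun n => ?_, ?_⟩
    · have := h1 α n
      exact Module.Finite.equiv (Subspace.quotAnnihilatorEquiv (U α n)).symm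
    · obtain ⟨N, hN⟩ := h2 α
      exact ⟨N, fun n hn => by rw [annFamily, hN n hn, Submodule.dualAnnihilator_bot]⟩
  directed := ⟨h3, fun α β => by
    obtain ⟨γ, h, h'⟩ := h4 α β
    exact ⟨γ, fun n => Submodule.dualAnnihilator_anti (h n), fun n => Submodule.dualAnnihilator_anti (h' n)⟩⟩
  separated n ξ hξ := LinearMap.ext fun w => by
    obtain ⟨α, hα⟩ := h5 n w
    exact (Submodule.mem_dualAnnihilator _).1 (hξ α) w hα

/-- A linear form on W is a compatible family of linear forms on the U α, because these are directed
and exhaust W. -/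
theorem isLimComplete_annFamily (h4 : ∀ α β, ∃ γ, U α ≤ U γ ∧ U β ≤ U γ)
    (h5 : ∀ n (w : W n), ∃ α, w ∈ U α n) : IsLimComplete (annFamily U) := by
  intro n
  constructor
  · rw [injective_iff_map_eq_zero]
    intro ξ hξ
    refine LinearMap.ext fun w => ?_
    obtain ⟨α, hα⟩ := h5 n w
    have : ξ ∈ annFamily U α n := (Submodule.Quotient.mk_eq_zero _).1 (congrFun (congrArg Subtype.val hξ) α)
    exact (Submodule.mem_dualAnnihilator _).1 this w hα
  · intro y
    choose x hx using fun α => Submodule.Quotient.mk_surjective _ (y.1 α)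
    have hle : ∀ α β, U α ≤ U β → ∀ w ∈ U α n, x α w = x β w := by
      intro α β h w hw
      have h' : annFamily U β ≤ annFamily U α := fun n => Submodule.dualAnnihilator_anti (h n)
      have := y.2 β α h'
      rw [← hx, ← hx] at this
      have h6 := (Submodule.mem_dualAnnihilator _).1 ((Submodule.Quotient.eq _).1 this) w hw
      rw [LinearMap.sub_apply, sub_eq_zero] at h6
      exact h6.symm
    have hxy : ∀ α β, ∀ w ∈ U α n, w ∈ U β n → x α w = x β w := by
      intro α β w hα hβ
      obtain ⟨γ, h, h'⟩ := h4 α β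
      rw [hle α γ h w hα, hle β γ h' w hβ]
    -- `a w` picks some member that contains w; by `hxy` the glued value `x (a w) w` does not depend
    -- on the choice.
    choose a ha using h5 n
    have key : ∀ α w, w ∈ U α n → x (a w) w = x α w := fun α w hw => hxy _ _ w (ha w) hw
    refine ⟨{ toFun := fun w => x (a w) w, map_add' := fun v w => ?_, map_smul' := fun c w => ?_ },
      Subtype.ext (funext fun α => ?_)⟩
    · obtain ⟨γ, h, h'⟩ := h4 (a v) (a w)
      rw [key γ v (h n (ha v)), key γ w (h' n (ha w)),
        key γ (v + w) (add_mem (h n (ha v)) (h' n (ha w))), map_add]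
    · rw [key (a w) (c • w) (Submodule.smul_mem _ c (ha w)), map_smul, RingHom.id_apply]
    · rw [← hx α]
      refine (Submodule.Quotient.eq _).2 ((Submodule.mem_dualAnnihilator _).2 fun w hw => ?_)
      rw [LinearMap.sub_apply, sub_eq_zero]
      exact key α w hw

end Annihilators

section Predual

variable {L : ℕ → Type u} [∀ n, AddCommGroup (L n)] [∀ n, Module ℚ (L n)] [GradedLie L]
variable {ι : Type v} {I : ι → GradedIdeal L}

theorem duality_bijective (hI : IsEnriched I) (hL : IsLimComplete fun α => (I α).sub) (n : ℕ) :
    Function.Bijective (duality I n) :=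
  coherentDual_eval_bijective (K := fun α => (I α).sub) hI.directed (fun α => (hI.finiteCodim α).1) hL n

theorem finiteDimensional_dualAnnihilator {M : Type*} [AddCommGroup M] [Module ℚ M]
    (N : Submodule ℚ M) [FiniteDimensional ℚ (M ⧸ N)] : FiniteDimensional ℚ N.dualAnnihilator :=
  Module.Finite.equiv (Submodule.dualQuotEquivDualAnnihilator N)

end Predual

end Duals
end EnrichedLie
end

/-! ### V ∩ ker d, the quotient L / L⁽²⁾, and the generators of a profree Lie algebra. -/

noncomputable section
namespace EnrichedLie

section Generators

open GradedLie

/-! ## Generators -/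

theorem IsCE.d_gen_eq_zero_iff {V : ℕ → Type u} [∀ n, AddCommGroup (V n)] [∀ n, Module ℚ (V n)]
    {F : ℕ → Type w} [∀ n, AddCommGroup (F n)] [∀ n, Module ℚ (F n)] [GradedLie F]
    {e : ∀ n, F n →ₗ[ℚ] Module.Dual ℚ (V n)} {d : Lambda V →ₗ[ℚ] Lambda V} (hd : IsCE e d)
    {n : ℕ} {v : V n} : d (gen n v) = 0 ↔
      ∀ {i j} (h : i + j = n) (x : F i) (y : F j), e n (br h x y) v = 0 := by
  constructor
  · intro h0 i j h x y
    have h1 := hd.bracket h x y v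
    rw [h0, map_zero, map_zero, map_zero, eq_comm, mul_eq_zero] at h1
    exact h1.resolve_left (pow_ne_zero _ (by norm_num))
  · intro h0
    refine hd.eq_of_two (hd.quadratic n v) (zero_mem _) fun p q x y => ?_
    rw [map_zero, map_zero, map_zero]
    by_cases h : p + q = n
    · rw [hd.bracket h, h0, mul_zero]
    · exact hd.bracket_ne h x y v

theorem FreeLie.exists_abelianization (T : ℕ → Type u) [∀ n, AddCommGroup (T n)] [∀ n, Module ℚ (T n)] :
    ∃ ab : ∀ n, FreeLie T n →ₗ[ℚ] T n, (∀ n t, ab n (FreeLie.of n t) = t) ∧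
      ∀ {i j k} (h : i + j = k) (x : FreeLie T i) (y : FreeLie T j), ab k (br h x y) = 0 := by
  let _ : GradedLie T :=
    { br := fun _ => 0
      skew := by simp
      jacobi := by simp }
  exact ⟨FreeLie.lift fun n => LinearMap.id, fun n t => rfl, fun h x y => FreeLie.lift_br _ h x y⟩

theorem eq_zero_of_mem_lcs_one {L : ℕ → Type u} [∀ n, AddCommGroup (L n)] [∀ n, Module ℚ (L n)]
    [GradedLie L] {M : Type*} [AddCommGroup M] [Module ℚ M] {n : ℕ} {φ : L n →ₗ[ℚ] M}
    (h : ∀ {i j} (h : i + j = n) (x : L i) (y : L j), φ (br h x y) = 0) {x : L n}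
    (hx : x ∈ lcs L 1 n) : φ x = 0 :=
  lcs_succ_induction (P := fun x => φ x = 0) (fun i j h' x y _ => h h' x y) (map_zero _)
    (fun x y hx hy => by rw [map_add, hx, hy, add_zero])
    (fun c x hx => by rw [map_smul, hx, smul_zero]) hx

variable {L : ℕ → Type u} [∀ n, AddCommGroup (L n)] [∀ n, Module ℚ (L n)] [GradedLie L]
variable {ι : Type v} {I : ι → GradedIdeal L}

theorem mem_cycleGen (hI : IsEnriched I) {n : ℕ} {v : predual I n} : v ∈ cycleGen hI n ↔
    ∀ {i j} (h : i + j = n) (x : L i) (y : L j), v.1 (br h x y) = 0 :=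
  (isCE_modelD_id hI).d_gen_eq_zero_iff

/-- The pairing of `L` with `V ∩ ker d`. -/
def cyclePairing (hI : IsEnriched I) (n : ℕ) : L n →ₗ[ℚ] Module.Dual ℚ (cycleGen hI n) :=
  (cycleGen hI n).dualRestrict ∘ₗ duality I n

theorem cyclePairing_surjective (hI : IsEnriched I) (hL : IsLimComplete fun α => (I α).sub) (n : ℕ) :
    Function.Surjective (cyclePairing hI n) :=
  (Subspace.dualRestrict_surjective (W := cycleGen hI n)).comp (duality_bijective hI hL n).2

/-- A form that vanishes on [L, L] + I α is continuous and a cycle, hence kills x; and linear forms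
detect membership in a subspace. -/
theorem mem_lcs_sup_of_cyclePairing (hI : IsEnriched I) {n : ℕ} {x : L n}
    (hx : cyclePairing hI n x = 0) (α : ι) : x ∈ lcs L 1 n ⊔ (I α).sub n := by
  refine mem_of_forall_dualAnnihilator fun v hv => ?_
  rw [Submodule.mem_dualAnnihilator] at hv
  refine LinearMap.congr_fun hx ⟨⟨v, (mem_predual hI).2 ⟨α, ?_⟩⟩, (mem_cycleGen hI).2 ?_⟩
  · rw [Submodule.mem_dualAnnihilator]
    exact fun y hy => hv y (Submodule.mem_sup_right hy)
  · exact fun h x y => hv _ (Submodule.mem_sup_left (br_mem_lcs_succ h x trivial))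

theorem ker_cyclePairing (hI : IsEnriched I) (n : ℕ) : LinearMap.ker (cyclePairing hI n) =
    limClosure (fun α => (I α).sub) (lcs L 1) n := by
  have hmem : ∀ x, x ∈ limClosure (fun α => (I α).sub) (lcs L 1) n ↔
      ∀ α, x ∈ lcs L 1 n ⊔ (I α).sub n := fun x => by
    simp only [limClosure, Submodule.mem_iInf, Submodule.comap_map_mkQ, sup_comm]
  ext x
  rw [LinearMap.mem_ker, hmem]
  refine ⟨mem_lcs_sup_of_cyclePairing hI, fun h => LinearMap.ext fun w => ?_⟩
  obtain ⟨α, hα⟩ := (mem_predual hI).1 w.1.2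
  obtain ⟨y, hy, z, hz, rfl⟩ := Submodule.mem_sup.1 (h α)
  have h1 : w.1.1 y = 0 := eq_zero_of_mem_lcs_one ((mem_cycleGen hI).1 w.2) hy
  have h2 := (Submodule.mem_dualAnnihilator _).1 hα z hz
  change w.1.1 (y + z) = 0
  rw [map_add, h1, h2, add_zero]

/-- The duality of `L / L⁽²⁾` and `V ∩ ker d`. -/
def cycleDuality (hI : IsEnriched I) (hL : IsLimComplete fun α => (I α).sub) (n : ℕ) :
    (L n ⧸ limClosure (fun α => (I α).sub) (lcs L 1) n) ≃ₗ[ℚ] Module.Dual ℚ (cycleGen hI n) :=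
  (Submodule.quotEquivOfEq _ _ (ker_cyclePairing hI n).symm).trans
    ((cyclePairing hI n).quotKerEquivOfSurjective (cyclePairing_surjective hI hL n))

theorem finite_comap_of_injective {M N : Type*} [AddCommMonoid M] [Module ℚ M]
    [AddCommGroup N] [Module ℚ N] {f : M →ₗ[ℚ] N} (hf : Function.Injective f) (S : Submodule ℚ N)
    [Module.Finite ℚ S] : Module.Finite ℚ (S.comap f) :=
  Module.Finite.of_injective (f.restrict (p := S.comap f) (q := S) fun _ h => h)
    fun _ _ h => Subtype.ext (hf (congrArg Subtype.val h))

theorem exists_finset_span {W : ℕ → Type u} [∀ n, AddCommGroup (W n)] [∀ n, Module ℚ (W n)]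
    (U : GSub W) (h1 : ∀ n, Module.Finite ℚ (U n)) (h2 : ∃ N, ∀ n, N ≤ n → U n = ⊥) :
    ∃ G : Finset (Σ n, W n), ∀ n, U n ≤ Submodule.span ℚ {a | (⟨n, a⟩ : Σ n, W n) ∈ G} := by
  obtain ⟨N, hN⟩ := h2
  have hs : ∀ n, ∃ s : Finset (W n), Submodule.span ℚ (s : Set (W n)) = U n := fun n =>
    Module.Finite.iff_fg.1 (h1 n)
  choose s hs using hs
  refine ⟨(Finset.range N).sigma s, fun n => ?_⟩
  by_cases hn : n < N
  · rw [← hs n]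
    exact Submodule.span_mono fun a ha => Finset.mem_sigma.2 ⟨Finset.mem_range.2 hn, ha⟩
  · rw [hN n (not_lt.1 hn)]; exact bot_le

section Profree

variable {T : ℕ → Type w} [∀ n, AddCommGroup (T n)] [∀ n, Module ℚ (T n)] {κ : Type z}
variable {K : κ → GSub T}

theorem of_mem_freeFamily {p : κ × ℕ} {n : ℕ} {t : T n} (ht : t ∈ K p.1 n) :
    FreeLie.of n t ∈ freeFamily K p n := by
  rw [mem_freeFamily, FreeLie.toQuot_eq_zero_of_mem _ ht]; exact zero_mem _

/-- The restriction of the elements of `V ∩ ker d` to the generators. -/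
def cycleRestrict (hI : IsEnriched I) (Ψ : EnrichedIso (profreeFamily K) fun α => (I α).sub) (n : ℕ) :
    cycleGen hI n →ₗ[ℚ] Module.Dual ℚ (T n) :=
  (Ψ.ofFree n ∘ₗ FreeLie.of n).dualMap ∘ₗ (predual I n).subtype ∘ₗ (cycleGen hI n).subtype

variable (hI : IsEnriched I) (Ψ : EnrichedIso (profreeFamily K) fun α => (I α).sub)

theorem cycleRestrict_mem (n : ℕ) (w : cycleGen hI n) :
    ∃ α, cycleRestrict hI Ψ n w ∈ (K α n).dualAnnihilator := by
  obtain ⟨p, hp⟩ := Ψ.isDenseMap.exists_kernel hI w.1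
  exact ⟨p.1, (Submodule.mem_dualAnnihilator _).2 fun t ht => hp _ (of_mem_freeFamily ht)⟩

/-- A cycle kills brackets, so on 𝕃_T it is determined by its values on T, and 𝕃_T is dense in L. -/
theorem cycleRestrict_injective (n : ℕ) : Function.Injective (cycleRestrict hI Ψ n) := by
  rw [injective_iff_map_eq_zero]
  intro w hw
  refine Subtype.ext (Ψ.isDenseMap.eq_zero hI w.1 fun x => ?_)
  obtain ⟨t, ht⟩ := FreeLie.exists_sub_of_mem x
  have h1 : (w.1.1 ∘ₗ Ψ.ofFree n) (x - FreeLie.of n t) = 0 := eq_zero_of_mem_lcs_one (fun h x y => by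
    rw [LinearMap.comp_apply, Ψ.ofFree_br]; exact (mem_cycleGen hI).1 w.2 h _ _) ht
  rw [map_sub, sub_eq_zero] at h1
  exact h1.trans (LinearMap.congr_fun hw t)

/-- Composing θ with the abelianization 𝕃_T → T gives a form that vanishes on the member (α, 1) of
the family, so it comes from V; it is a cycle because it kills brackets. -/
theorem exists_cycleRestrict (n : ℕ) {θ : Module.Dual ℚ (T n)} {α : κ}
    (hθ : θ ∈ (K α n).dualAnnihilator) : ∃ w, cycleRestrict hI Ψ n w = θ := by
  rw [Submodule.mem_dualAnnihilator] at hθ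
  obtain ⟨ab, h1, h2⟩ := FreeLie.exists_abelianization T
  have hf := Ψ.isDenseMap
  obtain ⟨v, hv⟩ := hf.exists_predual hI (θ ∘ₗ ab n) (p := (α, 1)) fun x hx => by
    obtain ⟨y, hy, hxy⟩ := mem_freeFamily_iff.1 hx
    let J : GradedIdeal (FreeLie T) :=
      { sub := fun n => (K α n).comap (ab n)
        br_mem := fun h x y _ => by rw [Submodule.mem_comap, h2]; exact zero_mem _ }
    have h3 : ab n (x - y) ∈ K α n := FreeLie.mem_of_toQuot_eq_zero (K α) J (fun n t ht => by
      rw [Submodule.mem_comap, h1]; exact ht) hxy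
    have h4 : ab n y = 0 := eq_zero_of_mem_lcs_one (fun h x y => h2 h x y) hy
    rw [map_sub, h4, sub_zero] at h3
    exact hθ _ h3
  have hd := isCE_modelD hI Ψ.ofFree Ψ.ofFree_br fun n v hv => hf.eq_zero hI v hv
  have hcyc : v ∈ cycleGen hI n := hd.d_gen_eq_zero_iff.2 fun h x y => by
    refine (hv _).trans ?_
    rw [LinearMap.comp_apply, h2, map_zero]
  refine ⟨⟨v, hcyc⟩, LinearMap.ext fun t => ?_⟩
  refine (hv _).trans ?_
  rw [LinearMap.comp_apply, h1]

/-- The duality of the generators of a profree Lie algebra and `V ∩ ker d`. -/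
theorem generators_bijective (hK : IsEnrichedSpace K) (hc : IsLimComplete K) (n : ℕ) :
    Function.Bijective (cycleRestrict hI Ψ n).flip := by
  have heval := coherentDual_eval_bijective hK.directed (fun α => (hK.finiteCodim α).1) hc n
  constructor
  · rw [injective_iff_map_eq_zero]
    intro t ht
    refine (injective_iff_map_eq_zero _).1 heval.1 t (LinearMap.ext fun θ => ?_)
    obtain ⟨α, hα⟩ := (mem_coherentDual hK.directed).1 θ.2
    obtain ⟨w, hw⟩ := exists_cycleRestrict hI Ψ n hα
    change θ.1 t = 0
    rw [← hw]
    exact LinearMap.congr_fun ht w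
  · intro ξ
    let ω : cycleGen hI n →ₗ[ℚ] coherentDual K n := LinearMap.codRestrict _ (cycleRestrict hI Ψ n)
      fun w => (mem_coherentDual hK.directed).2 (cycleRestrict_mem hI Ψ n w)
    have hω : Function.Bijective ω := by
      refine ⟨fun w w' h => cycleRestrict_injective hI Ψ n (congrArg Subtype.val h), fun θ => ?_⟩
      obtain ⟨α, hα⟩ := (mem_coherentDual hK.directed).1 θ.2
      obtain ⟨w, hw⟩ := exists_cycleRestrict hI Ψ n hα
      exact ⟨w, Subtype.ext hw⟩
    obtain ⟨t, ht⟩ := heval.2 (ξ ∘ₗ (LinearEquiv.ofBijective ω hω).symm.toLinearMap)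
    refine ⟨t, LinearMap.ext fun w => ?_⟩
    have h1 := LinearMap.congr_fun ht (ω w)
    have h2 : (LinearEquiv.ofBijective ω hω).symm (ω w) = w :=
      (LinearEquiv.ofBijective ω hω).symm_apply_apply w
    rw [LinearMap.comp_apply, LinearEquiv.coe_coe, h2] at h1
    exact h1

/-- Finitely many cycles vanish on a common K α, by directedness. -/
theorem generators_coherent (hK : IsEnrichedSpace K) :
    Coherent K (dualFamily fun n => cycleGen hI n) fun n => (cycleRestrict hI Ψ n).flip := by
  classical
  intro G
  suffices h : ∃ α, ∀ n, ∀ t ∈ K α n, ∀ a, (⟨n, a⟩ : Σ n, cycleGen hI n) ∈ G →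
      cycleRestrict hI Ψ n a t = 0 by
    obtain ⟨α, hα⟩ := h
    refine ⟨α, fun n t ht => (Submodule.mem_dualAnnihilator _).2 fun w hw => ?_⟩
    refine Submodule.span_induction (p := fun w _ => cycleRestrict hI Ψ n w t = 0)
      (fun a ha => hα n t ht a ha) (by simp) (fun a b _ _ ha hb => by
        rw [map_add, LinearMap.add_apply, ha, hb, add_zero])
      (fun c a _ ha => by rw [map_smul, LinearMap.smul_apply, ha, smul_zero]) hw
  induction G using Finset.induction_on with
  | empty =>
    obtain ⟨α⟩ := hK.directed.1
    exact ⟨α, fun n t _ a ha => absurd ha (Finset.notMem_empty _)⟩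
  | insert b G _ ih =>
    obtain ⟨α, hα⟩ := ih
    obtain ⟨m, b⟩ := b
    obtain ⟨β, hβ⟩ := cycleRestrict_mem hI Ψ m b
    obtain ⟨γ, h1, h2⟩ := hK.directed.2 α β
    refine ⟨γ, fun n t ht a ha => ?_⟩
    rcases Finset.mem_insert.1 ha with h | h
    · obtain ⟨rfl, h⟩ := Sigma.mk.inj_iff.1 h
      rw [eq_of_heq h]
      exact (Submodule.mem_dualAnnihilator _).1 hβ t (h2 n ht)
    · exact hα n t (h1 n ht) a h

/-- The cycles whose restriction to the generators vanishes on `K α`. -/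
def cycleAnn (α : κ) (n : ℕ) : Submodule ℚ (cycleGen hI n) :=
  ((K α n).dualAnnihilator).comap (cycleRestrict hI Ψ n)

theorem finite_cycleAnn (hK : IsEnrichedSpace K) (α : κ) (n : ℕ) :
    Module.Finite ℚ (cycleAnn hI Ψ α n) := by
  have := (hK.finiteCodim α).1 n
  have := finiteDimensional_dualAnnihilator (K α n)
  exact finite_comap_of_injective (cycleRestrict_injective hI Ψ n) _

theorem cycleAnn_eq_bot {α : κ} {n : ℕ} (h : K α n = ⊤) : cycleAnn hI Ψ α n = ⊥ := by
  rw [eq_bot_iff]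
  intro w hw
  rw [cycleAnn, h, Submodule.dualAnnihilator_top, Submodule.mem_comap, Submodule.mem_bot] at hw
  exact (Submodule.mem_bot ℚ).2 (cycleRestrict_injective hI Ψ n (hw.trans (map_zero _).symm))

/-- The cycles whose restriction kills K α form a finite dimensional graded space; G is chosen so
that its span contains them. -/
theorem generators_reflects (hK : IsEnrichedSpace K) (α : κ) : ∃ G, ∀ n t,
    (cycleRestrict hI Ψ n).flip t ∈ dualFamily (fun n => cycleGen hI n) G n → t ∈ K α n := by
  obtain ⟨N, hN⟩ := (hK.finiteCodim α).2
  obtain ⟨G, hG⟩ := exists_finset_span (W := fun n => cycleGen hI n) (cycleAnn hI Ψ α)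
    (finite_cycleAnn hI Ψ hK α)
    ⟨N, fun n hn => cycleAnn_eq_bot hI Ψ (hN n hn)⟩
  refine ⟨G, fun n t ht => mem_of_forall_dualAnnihilator fun θ hθ => ?_⟩
  obtain ⟨w, rfl⟩ := exists_cycleRestrict hI Ψ n hθ
  exact (Submodule.mem_dualAnnihilator _).1 ht w (hG n hθ)

end Profree

end Generators
end EnrichedLie
end

/-! ### Representing linear forms by elements of V when the cohomology is small. -/

noncomputable section
namespace EnrichedLie

section Cocycles

open GradedLie

/-! ## Linear forms on a graded Lie algebra whose model has no higher cohomology -/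

section Forms

variable {V : ℕ → Type u} [∀ n, AddCommGroup (V n)] [∀ n, Module ℚ (V n)]
variable {F : ℕ → Type w} [∀ n, AddCommGroup (F n)] [∀ n, Module ℚ (F n)]
variable {e : ∀ n, F n →ₗ[ℚ] Module.Dual ℚ (V n)}

theorem aug_ctr_toModule (b : ⨁ n, V n) {n : ℕ} (x : F n) :
    Lambda.aug (ctr e x (DirectSum.toModule ℚ ℕ (Lambda V) gen b)) = e n x (b n) := by
  have key : Lambda.aug ∘ₗ ctr e x ∘ₗ DirectSum.toModule ℚ ℕ (Lambda V) gen =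
      e n x ∘ₗ DirectSum.component ℚ ℕ _ n := by
    refine DirectSum.linearMap_ext _ fun m => LinearMap.ext fun v => ?_
    simp only [LinearMap.comp_apply, DirectSum.toModule_lof]
    by_cases h : m = n
    · subst h
      rw [ctr, contraction_gen_self, aug_algebraMap, DirectSum.component.lof_self]
    · rw [ctr, contraction_gen_ne h, DirectSum.component.of, dif_neg h, map_zero, map_zero]
  exact LinearMap.congr_fun key b

/-- A bilinear form of finite rank whose partial values are representable is representable by a
tensor. -/
theorem exists_tensor (e : ∀ n, F n →ₗ[ℚ] Module.Dual ℚ (V n)) {i j : ℕ}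
    (b : F i →ₗ[ℚ] F j →ₗ[ℚ] ℚ) (A : Submodule ℚ (F i)) [FiniteDimensional ℚ (F i ⧸ A)]
    (hA : ∀ φ : Module.Dual ℚ (F i), (∀ x ∈ A, φ x = 0) → ∃ v, ∀ x, e i x v = φ x)
    (hb : ∀ x ∈ A, b x = 0) (hb' : ∀ x, ∃ v, ∀ y, e j y v = b x y) :
    ∃ t : V i ⊗[ℚ] V j, ∀ x y,
      TensorProduct.lift ((LinearMap.mul ℚ ℚ).compl₁₂ (e i x) (e j y)) t = b x y := by
  let B := Module.finBasis ℚ (F i ⧸ A)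
  choose c hc using fun k => Submodule.Quotient.mk_surjective _ (B k)
  choose a ha using fun k => hA (B.coord k ∘ₗ A.mkQ) fun x hx => by
    simp [(Submodule.Quotient.mk_eq_zero _).2 hx]
  choose g hg using fun k => hb' (c k)
  refine ⟨∑ k, a k ⊗ₜ g k, fun x y => ?_⟩
  have hx : x - ∑ k, B.coord k (Submodule.Quotient.mk x) • c k ∈ A := by
    rw [← Submodule.Quotient.mk_eq_zero, Submodule.Quotient.mk_sub, sub_eq_zero]
    conv_lhs => rw [← B.sum_repr (Submodule.Quotient.mk x)]
    rw [← Submodule.mkQ_apply, ← Submodule.mkQ_apply, map_sum]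
    simp [hc]
  have := hb _ hx
  rw [map_sub, sub_eq_zero] at this
  rw [this]
  simp [LinearMap.sum_apply, ha, hg]

variable [GradedLie F] {d : Lambda V →ₗ[ℚ] Lambda V}

theorem IsCE.aug_ctr_ctr_lieDer (hd : IsCE e d) {p q r n m : ℕ} (h : p + q = n) (h' : p + r = m)
    (x : F p) (y : F q) (z : F r) (a : Lambda V) :
    Lambda.aug (ctr e z (ctr e y (lieDer e d x a))) =
      (-1 : ℚ) ^ (p * (q + 1)) * ((-1) ^ (p * r) * Lambda.aug (ctr e (br h' x z) (ctr e y a)) +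
        (-1) ^ p * Lambda.aug (ctr e z (ctr e (br h x y) a))) := by
  have h1 := congrArg (fun b => Lambda.aug (ctr e z b)) (hd.lieDer_ctr h x y a)
  simp only [map_sub, map_smul, smul_eq_mul] at h1
  rw [hd.aug_ctr_lieDer h'] at h1
  rw [h1, sub_add_cancel, ← mul_assoc, ← pow_add, Even.neg_one_pow ⟨_, rfl⟩, one_mul]

/-- The element of `Λ²V` defined by the composite of the bracket and a linear form is a cocycle. -/
theorem IsCE.d_eq_zero_of_form (hd : IsCE e d) {n : ℕ} (u : Module.Dual ℚ (F n)) {z : Lambda V}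
    (hz : z ∈ wordLength V 2)
    (h1 : ∀ {p q : ℕ} (h : p + q = n) (x : F p) (y : F q),
      Lambda.aug (ctr e y (ctr e x z)) = (-1 : ℚ) ^ (p * q + p) * u (br h x y))
    (h2 : ∀ {p q : ℕ} (_ : p + q ≠ n) (x : F p) (y : F q), Lambda.aug (ctr e y (ctr e x z)) = 0) :
    d z = 0 := by
  refine hd.eq_of_ctr (k := 2) (hd.der.mem_wordLength hd.quadratic hz) (zero_mem _) fun p x => ?_
  have hx : ctr e x z ∈ wordLength V 1 := contraction_mem _ hz
  -- The identity L_x z = d i_x z is the Jacobi identity under u. By definition of L_x it leaves i_x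
  -- d z = 0 for every x, and contractions detect d z.
  have key : lieDer e d x z = d (ctr e x z) := by
    refine hd.eq_of_two (hd.lieDer_mem x hz) (hd.der.mem_wordLength hd.quadratic hx)
      fun q r y w => ?_
    rw [hd.aug_ctr_ctr_lieDer rfl rfl, hd.aug_ctr_ctr_d rfl y w hx]
    by_cases h : p + (q + r) = n
    · have e1 : q + (p + r) = n := by omega
      have e2 : p + q + r = n := by omega
      rw [h1 h, h1 e1, h1 e2, jacobi rfl rfl rfl h e2 e1, map_add, map_smul, smul_eq_mul]
      rcases neg_one_pow_eq_or ℚ p with hp | hp <;> rcases neg_one_pow_eq_or ℚ q with hq | hq <;>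
        rcases neg_one_pow_eq_or ℚ r with hr | hr <;>
        simp [pow_add, pow_mul, mul_add, add_mul, hp, hq, hr] <;> ring
    · rw [h2 h, h2 (by omega), h2 (by omega)]; simp
  rw [lieDer_apply, add_eq_left] at key
  rw [map_zero]
  exact (smul_eq_zero.1 key).resolve_left (pow_ne_zero _ (by norm_num))

/-- The vanishing of the cohomology of word length two makes linear forms on `[F, F]`
representable. -/
theorem IsCE.exists_apply_br (hd : IsCE e d)
    (hH : ∀ a : Lambda V, d a = 0 → ∃ (c : ℚ) (b y : Lambda V), b ∈ wordLength V 1 ∧ d b = 0 ∧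
      a = algebraMap ℚ _ c + b + d y) {n : ℕ} (u : Module.Dual ℚ (F n))
    (hu : ∀ i j (h : i + j = n), ∃ t : V i ⊗[ℚ] V j, ∀ x y,
      TensorProduct.lift ((LinearMap.mul ℚ ℚ).compl₁₂ (e i x) (e j y)) t = u (br h x y)) :
    ∃ v, ∀ {i j} (h : i + j = n) (x : F i) (y : F j), e n (br h x y) v = u (br h x y) := by
  choose t ht using hu
  obtain ⟨z, hz, h1, h2⟩ := exists_mem_wordLength_two e (fun h x y => u (br h x y))
    (fun h h' x y => by
      rw [eq_neg_of_add_eq_zero_left (skew h h' x y), map_neg, map_smul, smul_eq_mul])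
    (fun {i j} h => t i j h) fun {i j} h => ht i j h
  obtain ⟨c, b, y, hb, -, hzy⟩ := hH z (hd.d_eq_zero_of_form u hz h1 h2)
  have h0 : algebraMap ℚ (Lambda V) c ∈ wordLength V 0 := by
    rw [Algebra.algebraMap_eq_smul_one]; exact Submodule.smul_mem _ _ one_mem_wordLength
  -- In word length two the decomposition of z reads z = d (linear part of y); the component of that
  -- part in degree n is the required element.
  have h3 := congrArg (component 2) hzy
  rw [map_add, map_add, (hd.der.component_comm hd.quadratic y).2, component_of_mem _ hz,
    component_of_mem _ h0, component_of_mem _ hb, if_pos rfl, if_neg (by norm_num),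
    if_neg (by norm_num), zero_add, zero_add] at h3
  obtain ⟨β, hβ⟩ := exists_eq_toModule (component_mem 1 y)
  refine ⟨β n, fun {i j} h x y' => ?_⟩
  have h4 := h1 h x y'
  rw [h3, hd.aug_ctr_ctr_d h x y' (component_mem 1 y), hβ, aug_ctr_toModule] at h4
  exact mul_left_cancel₀ (pow_ne_zero _ (by norm_num)) h4

end Forms

section Free

variable {T : ℕ → Type w} [∀ n, AddCommGroup (T n)] [∀ n, Module ℚ (T n)] {κ : Type z}
variable {K : κ → GSub T}

theorem br_mem_freeFamily_succ {α : κ} {m i j n : ℕ} (h : i + j = n) (x : FreeLie T i)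
    {y : FreeLie T j} (hy : y ∈ freeFamily K (α, m) j) : br h x y ∈ freeFamily K (α, m + 1) n := by
  rw [mem_freeFamily, FreeLie.toQuot_br]
  exact br_mem_lcs_succ h _ hy

theorem br_mem_freeFamily_succ_left {α : κ} {m i j n : ℕ} (h : i + j = n) {x : FreeLie T i}
    (y : FreeLie T j) (hx : x ∈ freeFamily K (α, m) i) : br h x y ∈ freeFamily K (α, m + 1) n := by
  rw [mem_freeFamily, FreeLie.toQuot_br]
  exact br_mem_lcs_succ_left h _ hx

/-- Modulo the member (α, m + 1), a bracket depends only on its factors modulo (α, m). So spanning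
elements for T modulo K α, together with brackets of spanning elements modulo (α, m), suffice. -/
theorem exists_finite_freeFamily {α : κ} (hK : FiniteCodim (K α)) (m : ℕ) :
    ∃ G : Set (Σ n, FreeLie T n), G.Finite ∧ ∀ n (x : FreeLie T n),
      ∃ y ∈ Submodule.span ℚ {a | (⟨n, a⟩ : Σ n, FreeLie T n) ∈ G}, x - y ∈ freeFamily K (α, m) n := by
  induction m with
  | zero => exact ⟨∅, Set.finite_empty, fun n x => ⟨0, zero_mem _, trivial⟩⟩
  | succ m ih =>
    obtain ⟨G, hG, hG'⟩ := ih
    obtain ⟨S, hS, hS'⟩ := hK.exists_finite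
    let H : Set (Σ n, FreeLie T n) := (fun s : Σ n, T n => ⟨s.1, FreeLie.of s.1 s.2⟩) '' S ∪
      Set.image2 (fun a b => ⟨a.1 + b.1, br rfl a.2 b.2⟩) G G
    have hH : ∀ {i j k} (h : i + j = k) (x : FreeLie T i) (y : FreeLie T j),
        x ∈ Submodule.span ℚ {a | (⟨i, a⟩ : Σ n, FreeLie T n) ∈ G} →
        y ∈ Submodule.span ℚ {a | (⟨j, a⟩ : Σ n, FreeLie T n) ∈ G} →
        br h x y ∈ Submodule.span ℚ {a | (⟨k, a⟩ : Σ n, FreeLie T n) ∈ H} := by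
      rintro i j _ rfl x y hx hy
      have := Submodule.apply_mem_map₂ (br rfl) hx hy
      rw [Submodule.map₂_span_span] at this
      refine Submodule.span_mono ?_ this
      rintro _ ⟨a, ha, b, hb, rfl⟩
      exact Or.inr ⟨_, ha, _, hb, rfl⟩
    refine ⟨H, (hS.image _).union (hG.image2 _ hG), fun n x => ?_⟩
    induction x using FreeLie.induction with
    | of n t =>
      obtain ⟨s, hs, hts⟩ := hS' n t
      refine ⟨FreeLie.of n s, ?_, by rw [← map_sub]; exact of_mem_freeFamily (p := (α, m + 1)) hts⟩
      have := Submodule.mem_map_of_mem (f := FreeLie.of n) hs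
      rw [Submodule.map_span] at this
      refine Submodule.span_mono ?_ this
      rintro _ ⟨a, ha, rfl⟩
      exact Or.inl ⟨_, ha, rfl⟩
    | zero n => exact ⟨0, zero_mem _, by rw [sub_zero]; exact zero_mem _⟩
    | add n x y hx hy =>
      obtain ⟨a, ha, hxa⟩ := hx
      obtain ⟨b, hb, hyb⟩ := hy
      exact ⟨a + b, add_mem ha hb, by rw [add_sub_add_comm]; exact add_mem hxa hyb⟩
    | smul n c x hx =>
      obtain ⟨a, ha, hxa⟩ := hx
      exact ⟨c • a, Submodule.smul_mem _ _ ha, by rw [← smul_sub]; exact Submodule.smul_mem _ _ hxa⟩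
    | br h x y hx hy =>
      obtain ⟨a, ha, hxa⟩ := hG' _ x
      obtain ⟨b, hb, hyb⟩ := hG' _ y
      refine ⟨br h a b, hH h a b ha hb, ?_⟩
      have := add_mem (br_mem_freeFamily_succ_left h y hxa) (br_mem_freeFamily_succ h a hyb)
      rwa [map_sub, map_sub, LinearMap.sub_apply, sub_add_sub_cancel] at this

theorem finiteCodim_freeFamily {α : κ} (hK : FiniteCodim (K α)) (m : ℕ) :
    FiniteCodim (freeFamily K (α, m)) := by
  obtain ⟨G, h1, h2⟩ := exists_finite_freeFamily hK m
  exact finiteCodim_of_finite h1 h2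

variable {V : ℕ → Type u} [∀ n, AddCommGroup (V n)] [∀ n, Module ℚ (V n)]
variable {e : ∀ n, FreeLie T n →ₗ[ℚ] Module.Dual ℚ (V n)} {d : Lambda V →ₗ[ℚ] Lambda V}

/-- Induction on m. If u vanishes on (α, m + 1), each u ∘ [x, ·] vanishes on (α, m), so it is
represented by V; hence u ∘ [ , ] is a tensor. By `hH` some v agrees with u on all brackets, and
`h2` provides a cycle w that corrects v on T. -/
theorem IsCE.exists_of_mem_dualAnnihilator (hd : IsCE e d)
    (hH : ∀ a : Lambda V, d a = 0 → ∃ (c : ℚ) (b y : Lambda V), b ∈ wordLength V 1 ∧ d b = 0 ∧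
      a = algebraMap ℚ _ c + b + d y) (hK : IsDirectedFamily K) (hfin : ∀ α, FiniteCodim (K α))
    (h1 : ∀ n (v : V n), ∃ α, ∀ t ∈ K α n, e n (FreeLie.of n t) v = 0)
    (h2 : ∀ n α (θ : Module.Dual ℚ (T n)), (∀ t ∈ K α n, θ t = 0) →
      ∃ v, (∀ t, e n (FreeLie.of n t) v = θ t) ∧
        ∀ {i j} (h : i + j = n) (x : FreeLie T i) (y : FreeLie T j), e n (br h x y) v = 0)
    (α : κ) (m : ℕ) : ∀ {n : ℕ} (u : Module.Dual ℚ (FreeLie T n)),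
      (∀ x ∈ freeFamily K (α, m) n, u x = 0) → ∃ v, ∀ x, e n x v = u x := by
  induction m with
  | zero => exact fun u hu => ⟨0, fun x => by rw [map_zero, hu x trivial]⟩
  | succ m ih =>
    intro n u hu
    obtain ⟨v, hv⟩ := hd.exists_apply_br hH u fun i j h => by
      have := (finiteCodim_freeFamily (hfin α) m).1 i
      exact exists_tensor e ((br h).compr₂ u) (freeFamily K (α, m) i) ih
        (fun x hx => LinearMap.ext fun y => hu _ (br_mem_freeFamily_succ_left h y hx))
        fun x => ih (u ∘ₗ br h x) fun y hy => hu _ (br_mem_freeFamily_succ h x hy)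
    obtain ⟨β, hβ⟩ := h1 n v
    obtain ⟨γ, hα, hβ'⟩ := hK.2 α β
    -- Both u and v are continuous on T, so their difference vanishes there on a common K γ.
    obtain ⟨w, hw, hw'⟩ := h2 n γ ((u - (e n).flip v) ∘ₗ FreeLie.of n) fun t ht => by
      have h3 := hu _ (of_mem_freeFamily (p := (α, m + 1)) (hα n ht))
      have h4 := hβ t (hβ' n ht)
      rw [LinearMap.comp_apply, LinearMap.sub_apply, LinearMap.flip_apply, h3, h4, sub_zero]
    have h3 : ∀ t, ((e n).flip (v + w) - u) (FreeLie.of n t) = 0 := fun t => by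
      rw [LinearMap.sub_apply, LinearMap.flip_apply, map_add, hw, LinearMap.comp_apply,
        LinearMap.sub_apply, LinearMap.flip_apply]
      ring
    refine ⟨v + w, fun x => ?_⟩
    obtain ⟨t, ht⟩ := FreeLie.exists_sub_of_mem x
    have h4 : ((e n).flip (v + w) - u) (x - FreeLie.of n t) = 0 :=
      eq_zero_of_mem_lcs_one (fun h x y => by
        rw [LinearMap.sub_apply, LinearMap.flip_apply, map_add, hv h, hw' h, add_zero, sub_self]) ht
    rw [map_sub, h3, sub_zero] at h4
    exact sub_eq_zero.1 h4

end Free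

end Cocycles
end EnrichedLie
end

/-! ### Construction of the generators and of the isomorphism in (ii) ⇒ (i). -/

noncomputable section
namespace EnrichedLie

section Converse

open GradedLie

/-! ## Profreeness -/

/-- The source of coherence below: taking annihilators turns X ≤ U β into the inclusion of kernels
that coherence asks for. -/
theorem exists_le_of_finite {W : ℕ → Type u} [∀ n, AddCommGroup (W n)] [∀ n, Module ℚ (W n)]
    {ι : Type v} {U : ι → GSub W} (h3 : Nonempty ι) (h4 : ∀ α β, ∃ γ, U α ≤ U γ ∧ U β ≤ U γ)
    (h5 : ∀ n (w : W n), ∃ α, w ∈ U α n) (X : GSub W) (h1 : ∀ n, Module.Finite ℚ (X n))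
    (h2 : ∃ N, ∀ n, N ≤ n → X n = ⊥) : ∃ β, X ≤ U β := by
  classical
  obtain ⟨G, hG⟩ := exists_finset_span X h1 h2
  suffices h : ∃ β, ∀ n a, (⟨n, a⟩ : Σ n, W n) ∈ G → a ∈ U β n by
    obtain ⟨β, hβ⟩ := h
    exact ⟨β, fun n => (hG n).trans (Submodule.span_le.2 fun a ha => hβ n a ha)⟩
  clear hG
  induction G using Finset.induction_on with
  | empty => exact ⟨h3.some, fun n a ha => absurd ha (Finset.notMem_empty _)⟩
  | insert b G _ ih =>
    obtain ⟨α, hα⟩ := ih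
    obtain ⟨m, b⟩ := b
    obtain ⟨β, hβ⟩ := h5 m b
    obtain ⟨γ, h, h'⟩ := h4 α β
    refine ⟨γ, fun n a ha => ?_⟩
    rcases Finset.mem_insert.1 ha with he | he
    · obtain ⟨rfl, he⟩ := Sigma.mk.inj_iff.1 he
      rw [eq_of_heq he]
      exact h' n hβ
    · exact h n (hα n a he)

variable {L : ℕ → Type u} [∀ n, AddCommGroup (L n)] [∀ n, Module ℚ (L n)] [GradedLie L]
variable {ι : Type v} {I : ι → GradedIdeal L}

theorem IsEnriched.exists_lcs_le (hI : IsEnriched I) (α : ι) : ∃ k, lcs L k ≤ (I α).sub := by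
  obtain ⟨k, hk⟩ := hI.nilpotent α
  refine ⟨k, fun n x hx => (Submodule.Quotient.mk_eq_zero _).1 ?_⟩
  have : (((I α).sub n).mkQ x : GQuot (I α).sub n) ∈ lcs (GQuot (I α).sub) k n :=
    map_mem_lcs (fun n => ((I α).sub n).mkQ) (fun _ _ _ => rfl) hx
  rw [hk] at this
  exact (Submodule.mem_bot ℚ).1 this

/-- The elements of `V` that vanish on `I α`. -/
def predualAnn (I : ι → GradedIdeal L) (α : ι) (n : ℕ) : Submodule ℚ (predual I n) :=
  (((I α).sub n).dualAnnihilator).comap (predual I n).subtype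

theorem mem_predualAnn {α : ι} {n : ℕ} {v : predual I n} :
    v ∈ predualAnn I α n ↔ ∀ x ∈ (I α).sub n, v.1 x = 0 :=
  Submodule.mem_dualAnnihilator _

theorem predualAnn_mono {α β : ι} (h : (I β).sub ≤ (I α).sub) (n : ℕ) :
    predualAnn I α n ≤ predualAnn I β n := fun _ hv =>
  mem_predualAnn.2 fun x hx => mem_predualAnn.1 hv x (h n hx)

theorem finite_predualAnn (hI : IsEnriched I) (α : ι) (n : ℕ) :
    Module.Finite ℚ (predualAnn I α n) := by
  have := (hI.finiteCodim α).1 n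
  have := finiteDimensional_dualAnnihilator ((I α).sub n)
  exact finite_comap_of_injective (Submodule.subtype_injective _) _

theorem predualAnn_eq_bot {α : ι} {n : ℕ} (h : (I α).sub n = ⊤) : predualAnn I α n = ⊥ := by
  rw [eq_bot_iff]
  intro v hv
  refine (Submodule.mem_bot ℚ).2 (Subtype.ext (LinearMap.ext fun x => ?_))
  exact mem_predualAnn.1 hv x (by rw [h]; trivial)

theorem exists_mem_predualAnn (hI : IsEnriched I) (n : ℕ) (v : predual I n) :
    ∃ α, v ∈ predualAnn I α n := (mem_predual hI).1 v.2

theorem directed_predualAnn (hI : IsEnriched I) (α β : ι) :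
    ∃ γ, predualAnn I α ≤ predualAnn I γ ∧ predualAnn I β ≤ predualAnn I γ := by
  obtain ⟨γ, h, h'⟩ := hI.directed.2 α β
  exact ⟨γ, predualAnn_mono h, predualAnn_mono h'⟩

/-- The elements of `V ∩ ker d` that vanish on `I α`. -/
def idealCycles (hI : IsEnriched I) (α : ι) (n : ℕ) : Submodule ℚ (cycleGen hI n) :=
  (predualAnn I α n).comap (cycleGen hI n).subtype

theorem mem_idealCycles {hI : IsEnriched I} {α : ι} {n : ℕ} {v : cycleGen hI n} :
    v ∈ idealCycles hI α n ↔ v.1 ∈ predualAnn I α n := Iff.rfl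

theorem finite_idealCycles (hI : IsEnriched I) (α : ι) (n : ℕ) :
    Module.Finite ℚ (idealCycles hI α n) := by
  have := finite_predualAnn hI α n
  exact finite_comap_of_injective (Submodule.subtype_injective _) _

theorem idealCycles_eq_bot {hI : IsEnriched I} {α : ι} {n : ℕ} (h : (I α).sub n = ⊤) :
    idealCycles hI α n = ⊥ := by
  rw [eq_bot_iff]
  intro v hv
  rw [mem_idealCycles, predualAnn_eq_bot h] at hv
  exact (Submodule.mem_bot ℚ).2 (Subtype.ext ((Submodule.mem_bot ℚ).1 hv))

theorem exists_mem_idealCycles (hI : IsEnriched I) (n : ℕ) (v : cycleGen hI n) :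
    ∃ α, v ∈ idealCycles hI α n := exists_mem_predualAnn hI n v.1

theorem directed_idealCycles (hI : IsEnriched I) (α β : ι) : ∃ γ,
    (∀ n, idealCycles hI α n ≤ idealCycles hI γ n) ∧ ∀ n, idealCycles hI β n ≤ idealCycles hI γ n := by
  obtain ⟨γ, h, h'⟩ := directed_predualAnn hI α β
  exact ⟨γ, fun n v hv => h n hv, fun n v hv => h' n hv⟩

/-- The dual of `V ∩ ker d`. -/
abbrev CycleDual (hI : IsEnriched I) (n : ℕ) : Type u := Module.Dual ℚ (cycleGen hI n)

/-- The enriched structure of the dual of `V ∩ ker d` defined by the ideals `I α`. -/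
def cycleDualFamily (hI : IsEnriched I) : ι → GSub (CycleDual hI) :=
  annFamily (W := fun n => cycleGen hI n) (idealCycles hI)

theorem isEnrichedSpace_cycleDualFamily (hI : IsEnriched I) :
    IsEnrichedSpace (cycleDualFamily hI) :=
  isEnrichedSpace_annFamily (W := fun n => cycleGen hI n) (finite_idealCycles hI)
    (fun α => by
      obtain ⟨N, hN⟩ := (hI.finiteCodim α).2
      exact ⟨N, fun n hn => idealCycles_eq_bot (hN n hn)⟩)
    hI.directed.1 (directed_idealCycles hI) (exists_mem_idealCycles hI)

theorem isLimComplete_cycleDualFamily (hI : IsEnriched I) : IsLimComplete (cycleDualFamily hI) :=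
  isLimComplete_annFamily (W := fun n => cycleGen hI n) (directed_idealCycles hI)
    (exists_mem_idealCycles hI)

theorem exists_retraction {M : Type*} [AddCommGroup M] [Module ℚ M] (N : Submodule ℚ M) :
    ∃ π : M →ₗ[ℚ] N, ∀ w : N, π w.1 = w := by
  obtain ⟨π, hπ⟩ := LinearMap.exists_leftInverse_of_injective N.subtype N.ker_subtype
  exact ⟨π, LinearMap.congr_fun hπ⟩

/-- A coherent section of the projection of `L` to the dual of `V ∩ ker d`. -/
theorem exists_coherent_section (hI : IsEnriched I) (hL : IsLimComplete fun α => (I α).sub) :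
    ∃ s : ∀ n, CycleDual hI n →ₗ[ℚ] L n, (∀ n t, cyclePairing hI n (s n t) = t) ∧
      Coherent (cycleDualFamily hI) (fun α => (I α).sub) s := by
  -- The section is dual to a retraction π of V onto V ∩ ker d, through L ≅ V^∨. It is coherent
  -- because π maps the finite dimensional space of forms killing I α into the cycles killing some I
  -- β.
  choose π hπ using fun n => exists_retraction (cycleGen hI n)
  let E := fun n => LinearEquiv.ofBijective (duality I n) (duality_bijective hI hL n)
  have hE : ∀ n (t : CycleDual hI n) (v : predual I n),
      v.1 ((E n).symm ((π n).dualMap t)) = t (π n v) := fun n t v =>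
    LinearMap.congr_fun ((E n).apply_symm_apply ((π n).dualMap t)) v
  refine ⟨fun n => (E n).symm.toLinearMap ∘ₗ (π n).dualMap, fun n t => LinearMap.ext fun w => ?_,
    fun α => ?_⟩
  · refine (hE n t w.1).trans ?_
    rw [hπ]
  · obtain ⟨N, hN⟩ := (hI.finiteCodim α).2
    obtain ⟨β, hβ⟩ := exists_le_of_finite (W := fun n => cycleGen hI n) (U := idealCycles hI)
      hI.directed.1 (directed_idealCycles hI) (exists_mem_idealCycles hI)
      (fun n => (predualAnn I α n).map (π n))
      (fun n => by
        have := finite_predualAnn hI α n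
        infer_instance)
      ⟨N, fun n hn => by rw [predualAnn_eq_bot (hN n hn), Submodule.map_bot]⟩
    refine ⟨β, fun n t ht => mem_of_forall_dualAnnihilator fun v hv => ?_⟩
    let v' : predual I n := ⟨v, (mem_predual hI).2 ⟨α, hv⟩⟩
    refine (hE n t v').trans ?_
    exact (Submodule.mem_dualAnnihilator _).1 ht _ (hβ n ⟨v', hv, rfl⟩)

section Lift

variable {T : ℕ → Type w} [∀ n, AddCommGroup (T n)] [∀ n, Module ℚ (T n)] {κ : Type z}
variable {K : κ → GSub T}

/-- Pick β with K β mapped into I α and, by nilpotency of L / I α, a k with `lcs L k` inside I α.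
Then both parts of the member (β, k), the kernel and `lcs k`, go into I α. -/
theorem coherent_lift (hI : IsEnriched I) {s : ∀ n, T n →ₗ[ℚ] L n}
    (hs : Coherent K (fun α => (I α).sub) s) :
    Coherent (freeFamily K) (fun α => (I α).sub) (FreeLie.lift s) := by
  intro α
  obtain ⟨β, hβ⟩ := hs α
  obtain ⟨k, hk⟩ := hI.exists_lcs_le α
  refine ⟨(β, k), fun n x hx => ?_⟩
  obtain ⟨y, hy, hxy⟩ := mem_freeFamily_iff.1 hx
  let J : GradedIdeal (FreeLie T) :=
    { sub := fun n => ((I α).sub n).comap (FreeLie.lift s n)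
      br_mem := fun h x y hy => by
        rw [Submodule.mem_comap, FreeLie.lift_br]; exact (I α).br_mem h _ _ hy }
  have h1 : FreeLie.lift s n (x - y) ∈ (I α).sub n :=
    FreeLie.mem_of_toQuot_eq_zero (K β) J (fun n t ht => hβ n t ht) hxy
  have h2 := hk n (map_mem_lcs (FreeLie.lift s) (fun h x y => FreeLie.lift_br s h x y) hy)
  have := add_mem h1 h2
  rwa [← map_add, sub_add_cancel] at this

/-- A nilpotent Lie algebra is generated by any subspace that spans it modulo brackets. An error in
`lcs L k` is corrected, up to `lcs L (k + 1)` and I α, by an element of `lcs k` of 𝕃_T; after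
finitely many steps the error lies in I α. -/
theorem lift_dense (hI : IsEnriched I) {s : ∀ n, T n →ₗ[ℚ] L n}
    (hs : ∀ α n (x : L n), ∃ t, x - s n t ∈ lcs L 1 n ⊔ (I α).sub n) (α : ι) (n : ℕ) (y : L n) :
    ∃ x, y - FreeLie.lift s n x ∈ (I α).sub n := by
  have hbr : ∀ k, ∀ {n} {y : L n}, y ∈ lcs L k n → ∃ x ∈ lcs (FreeLie T) k n,
      y - FreeLie.lift s n x ∈ lcs L (k + 1) n ⊔ (I α).sub n := by
    intro k
    induction k with
    | zero =>
      intro n y _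
      obtain ⟨t, ht⟩ := hs α n y
      exact ⟨FreeLie.of n t, trivial, ht⟩
    | succ k ih =>
      intro n y hy
      refine lcs_succ_induction (P := fun y => ∃ x ∈ lcs (FreeLie T) (k + 1) n,
        y - FreeLie.lift s n x ∈ lcs L (k + 1 + 1) n ⊔ (I α).sub n) (fun i j h a b hb => ?_)
        ⟨0, zero_mem _, by rw [map_zero, sub_zero]; exact zero_mem _⟩ ?_ ?_ hy
      · obtain ⟨t, ht⟩ := hs α i a
        obtain ⟨b', hb', hbb⟩ := ih hb
        refine ⟨br h (FreeLie.of i t) b', br_mem_lcs_succ h _ hb', ?_⟩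
        rw [FreeLie.lift_br, FreeLie.lift_of]
        obtain ⟨p, hp, q, hq, hpq⟩ := Submodule.mem_sup.1 ht
        obtain ⟨p', hp', q', hq', hpq'⟩ := Submodule.mem_sup.1 hbb
        have e1 : br h a b - br h (s i t) (FreeLie.lift s j b') =
            br h p b + br h (s i t) p' + (br h q b + br h (s i t) q') := by
          have e2 : br h (p + q) b + br h (s i t) (p' + q') =
              br h p b + br h (s i t) p' + (br h q b + br h (s i t) q') := by
            simp only [map_add, LinearMap.add_apply]; abel
          rw [← e2, hpq, hpq', map_sub, map_sub, LinearMap.sub_apply, sub_add_sub_cancel]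
        rw [e1]
        refine add_mem (Submodule.mem_sup_left (add_mem ?_ (br_mem_lcs_succ h _ hp')))
          (Submodule.mem_sup_right (add_mem ((I α).br_mem_left h _ _ hq) ((I α).br_mem h _ _ hq')))
        have := br_mem_lcs_add h hp hb
        rwa [add_comm 1 k] at this
      · rintro y y' ⟨x, hx, hxy⟩ ⟨x', hx', hxy'⟩
        exact ⟨x + x', add_mem hx hx', by rw [map_add, add_sub_add_comm]; exact add_mem hxy hxy'⟩
      · rintro c y ⟨x, hx, hxy⟩
        exact ⟨c • x, Submodule.smul_mem _ _ hx, by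
          rw [map_smul, ← smul_sub]; exact Submodule.smul_mem _ _ hxy⟩
  have key : ∀ k, ∃ x, y - FreeLie.lift s n x ∈ lcs L k n ⊔ (I α).sub n := by
    intro k
    induction k with
    | zero => exact ⟨0, Submodule.mem_sup_left trivial⟩
    | succ k ih =>
      obtain ⟨x, hx⟩ := ih
      obtain ⟨p, hp, q, hq, hpq⟩ := Submodule.mem_sup.1 hx
      obtain ⟨x', -, hx'⟩ := hbr k hp
      refine ⟨x + x', ?_⟩
      rw [map_add, ← sub_sub, ← hpq, add_sub_right_comm]
      exact add_mem hx' (Submodule.mem_sup_right hq)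
  obtain ⟨k, hk⟩ := hI.exists_lcs_le α
  obtain ⟨x, hx⟩ := key k
  exact ⟨x, sup_le (hk n) le_rfl hx⟩

/-- A coherent family of finite codimension whose annihilators are represented by `V` is reflected by
a dense map. -/
theorem reflects_of_dual (hI : IsEnriched I) {f : ∀ n, T n →ₗ[ℚ] L n}
    (hf : ∀ n (v : predual I n), (∀ x, v.1 (f n x) = 0) → v = 0) {J : GSub T} (hJ : FiniteCodim J)
    (h : ∀ n (u : Module.Dual ℚ (T n)), (∀ x ∈ J n, u x = 0) →
      ∃ v : predual I n, ∀ x, v.1 (f n x) = u x) :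
    ∃ β, ∀ n x, f n x ∈ (I β).sub n → x ∈ J n := by
  let g : ∀ n, predual I n →ₗ[ℚ] Module.Dual ℚ (T n) := fun n => (f n).dualMap ∘ₗ (predual I n).subtype
  have hg : ∀ n, Function.Injective (g n) := fun n => (injective_iff_map_eq_zero _).2 fun v hv =>
    hf n v fun x => LinearMap.congr_fun hv x
  obtain ⟨N, hN⟩ := hJ.2
  -- The v with v ∘ f in the annihilator of J form a finite dimensional space, as v ↦ v ∘ f is
  -- injective; so all of them vanish on a single I β.
  obtain ⟨β, hβ⟩ := exists_le_of_finite (W := fun n => predual I n) (U := predualAnn I)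
    hI.directed.1 (directed_predualAnn hI) (exists_mem_predualAnn hI)
    (fun n => ((J n).dualAnnihilator).comap (g n))
    (fun n => by
      have := hJ.1 n
      have := finiteDimensional_dualAnnihilator (J n)
      exact finite_comap_of_injective (hg n) _)
    ⟨N, fun n hn => by
      rw [hN n hn, Submodule.dualAnnihilator_top, Submodule.comap_bot]
      exact LinearMap.ker_eq_bot.2 (hg n)⟩
  refine ⟨β, fun n x hx => mem_of_forall_dualAnnihilator fun u hu => ?_⟩
  obtain ⟨v, hv⟩ := h n u ((Submodule.mem_dualAnnihilator _).1 hu)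
  rw [← hv]
  refine mem_predualAnn.1 (hβ n ?_) _ hx
  have : g n v = u := LinearMap.ext hv
  rw [Submodule.mem_comap, this]
  exact hu

end Lift

theorem isProfree_of_toCohomology_bijective (hI : IsEnriched I) (hL : IsLimComplete fun α => (I α).sub)
    (h : Function.Bijective (toCohomology hI)) : IsProfree I := by
  obtain ⟨s, hs, hsc⟩ := exists_coherent_section hI hL
  have hK := isEnrichedSpace_cycleDualFamily hI
  have hbr : ∀ {i j k} (h : i + j = k) (x : FreeLie (CycleDual hI) i) (y : FreeLie (CycleDual hI) j),
      FreeLie.lift s k (br h x y) = br h (FreeLie.lift s i x) (FreeLie.lift s j y) :=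
    fun h x y => FreeLie.lift_br s h x y
  have hdense : ∀ α n (y : L n), ∃ x, y - FreeLie.lift s n x ∈ (I α).sub n :=
    lift_dense hI fun α n x => ⟨cyclePairing hI n x, mem_lcs_sup_of_cyclePairing hI (by
      rw [map_sub, hs, sub_self]) α⟩
  have hzero : ∀ n (v : predual I n), (∀ x, v.1 (FreeLie.lift s n x) = 0) → v = 0 := fun n v hv => by
    obtain ⟨α, hα⟩ := exists_mem_predualAnn hI n v
    refine Subtype.ext (LinearMap.ext fun y => ?_)
    obtain ⟨x, hx⟩ := hdense α n y
    have := mem_predualAnn.1 hα _ hx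
    rwa [map_sub, hv, sub_zero] at this
  have hd := isCE_modelD hI (FreeLie.lift s) hbr hzero
  have hf : IsDenseMap (freeFamily (cycleDualFamily hI)) (fun α => (I α).sub) (FreeLie.lift s) :=
    { dense := hdense
      coherent := coherent_lift hI hsc
      -- This is where the hypothesis on cohomology enters: it makes the topology of 𝕃_T the one
      -- induced from L.
      reflects := fun p => by
        refine reflects_of_dual hI hzero (finiteCodim_freeFamily (hK.finiteCodim p.1) p.2) fun n u hu =>
          hd.exists_of_mem_dualAnnihilator ((toCohomology_bijective_iff hI).1 h) hK.directed
            hK.finiteCodim (fun n v => ?_) (fun n α θ hθ => ?_) p.1 p.2 u hu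
        · obtain ⟨α, hα⟩ := exists_mem_predualAnn hI n v
          obtain ⟨β, hβ⟩ := hsc α
          exact ⟨β, fun t ht => mem_predualAnn.1 hα _ (hβ n t ht)⟩
        · have := finite_idealCycles hI α n
          obtain ⟨w, -, hw⟩ := exists_eval_of_finite (W := cycleGen hI n) (idealCycles hI α n) θ hθ
          refine ⟨w.1, fun t => ?_, fun h x y => ?_⟩
          · rw [hw]; exact LinearMap.congr_fun (hs n t) w
          · change w.1.1 (FreeLie.lift s n (br h x y)) = 0
            rw [hbr]
            exact (mem_cycleGen hI).1 w.2 h _ _ }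
  -- Indexing the family on T by ι, rather than by finite subsets of V ∩ ker d, keeps the index type
  -- in the universe that `IsProfree` prescribes.
  exact ⟨CycleDual hI, inferInstance, inferInstance, ι, cycleDualFamily hI, hK,
    isLimComplete_cycleDualFamily hI,
    hf.nonempty_enrichedIso (J := freeIdeal (cycleDualFamily hI)) hbr
      (isDirectedFamily_freeFamily hK.directed) hI hL⟩

end Converse
end EnrichedLie
end

theorem theorem1 {L : ℕ → Type u} [∀ n, AddCommGroup (L n)] [∀ n, Module ℚ (L n)] [GradedLie L]
    {ι : Type v} (I : ι → GradedIdeal L) (hI : IsEnriched I)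
    (hL : IsLimComplete fun α => (I α).sub) :
    (IsProfree I ↔ Function.Bijective (toCohomology hI)) ∧
    (∀ n, Function.Bijective (duality I n)) ∧
    ∀ (T : ℕ → Type w) [∀ n, AddCommGroup (T n)] [∀ n, Module ℚ (T n)] (κ : Type z)
      (K : κ → GSub T), IsEnrichedSpace K → IsLimComplete K →
      ∀ Ψ : EnrichedIso (profreeFamily K) (fun α => (I α).sub),
      ∃ (e : ∀ n, (L n ⧸ limClosure (fun α => (I α).sub) (lcs L 1) n) ≃ₗ[ℚ]
            Module.Dual ℚ (cycleGen hI n))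
        (τ : ∀ n, T n ≃ₗ[ℚ] Module.Dual ℚ (cycleGen hI n)),
        (∀ n (x : L n) (v : cycleGen hI n),
          e n (Submodule.Quotient.mk x) v = duality I n x v.1) ∧
        (∀ n (t : T n), τ n t = e n (Submodule.Quotient.mk (Ψ.equiv n (profreeOf K n t)))) ∧
        Coherent K (dualFamily fun n => cycleGen hI n) (fun n => (τ n).toLinearMap) ∧
        Coherent (dualFamily fun n => cycleGen hI n) K (fun n => (τ n).symm.toLinearMap) := by
  refine ⟨⟨fun h => h.toCohomology_bijective hI, isProfree_of_toCohomology_bijective hI hL⟩,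
    duality_bijective hI hL, fun T _ _ κ K hK hc Ψ => ?_⟩
  -- τ is the transpose of the restriction of cycles to T, so both compatibilities hold by
  -- definition.
  refine ⟨cycleDuality hI hL, fun n => LinearEquiv.ofBijective (cycleRestrict hI Ψ n).flip
    (generators_bijective hI Ψ hK hc n), fun n x v => rfl, fun n t => rfl,
    generators_coherent hI Ψ hK, fun α => ?_⟩
  obtain ⟨G, hG⟩ := generators_reflects hI Ψ hK α
  refine ⟨G, fun n ξ hξ => hG n _ ?_⟩
  have h : (cycleRestrict hI Ψ n).flip ((LinearEquiv.ofBijective (cycleRestrict hI Ψ n).flip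
      (generators_bijective hI Ψ hK hc n)).symm ξ) = ξ :=
    (LinearEquiv.ofBijective (cycleRestrict hI Ψ n).flip
      (generators_bijective hI Ψ hK hc n)).apply_symm_apply ξ
  exact h.symm ▸ hξ
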